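/- **Conventions.** A *square group* $Q$ consists of a group $Q_e$ and an abelian group $Q_{ee}$ (both written additively), a homomorphism $P:Q_{ee}\to Q_e$ and a map $H:Q_e\to Q_{ee}$ such that $(x\mid y)_H=H(x+y)-H(y)-H(x)$ is additive in $x$ and in $y$, $(Pa\mid y)_H=0$, $P(x\mid y)_H=-x-y+x+y$ and $PHP=P+P$. Put $T=HP-\mathrm{id}$ and $Q^{\rm ad}=\mathrm{Coker}\,P$. A *square ring* is a square group with a multiplicative monoid structure on $Q_e$ inducing a ring structure on $Q^{\rm ad}$, and a $Q^{\rm ad}\otimes Q^{\rm ad}\otimes (Q^{\rm ad})^{\rm op}$-module structure $(\bar x\otimes\bar y)\cdot a\cdot\bar z$ on $Q_{ee}$, such that $x(y+z)=xy+xz$, $(x+y)z=xz+yz+P((\bar x\otimes\bar y)\cdot H(z))$, $(x\mid y)_H=(\bar y\otimes\bar x)\cdot H(2)$, $T((\bar x\otimes\bar y)\cdot a\cdot\bar z)=(\bar y\otimes\bar x)\cdot T(a)\cdot\bar z$, $P(a\cdot\bar x)=P(a)x$, $P((\bar x\otimes\bar x)\cdot a)=xP(a)$, $H(xy)=(\bar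 x\otimes\bar x)\cdot H(y)+H(x)\cdot\bar y$. A ring is a square ring with trivial $ee$-part. Let $p:Q\to R$ be a surjective morphism from a square ring $Q$ to a ring $R$, and let $M$ be an $R$-bimodule. *Crossed square ring extensions.* A crossed square ring extension of $R$ by $M$ with $C_{(0)}=Q$ is an exact sequence of groups $0\to M\xrightarrow{i}C_1\xrightarrow{\partial}Q_e\xrightarrow{p}R\to0$ together with a homomorphism $P:Q_{ee}\to C_1$ and an associative unital two-sided action of $Q_e$ on $C_1$ such that $\partial P=P^Q$, $PH\partial P=2P$, $PH(\partial r+\partial s)=PH\partial r+PH\partial s+(-r-s+r+s)$, $P((\bar x\otimes\bar x)\cdot a\cdot\bar y)=xP(a)y$, $\partial(xry)=x\,\partial(r)\,y$, $\partial(r)s=r\,\partial(s)$, $x(r+s)=xr+xs$, $r(x+y)=rx+ry$, $(x+y)r=xr+yr+P((\bar x\otimes\bar y)\cdot H\partial r)$, $(r+s)x=rx+sx+P((\overline{\partial r}\otimes\overline{\partial s})\cdot Hx)$, and $i(p(x)m)=x\,i(m)$, $i(m\,p(x))=i(m)\,x$, for all $x,y\in Q_e$, $r,s\in C_1$, $a\in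 Q_{ee}$, $m\in M$. Let $\mathcal{X}ext(R,Q;M)$ be the category of these extensions, whose morphisms are the homomorphisms $C_1\to C_1'$ that are compatible with $P$, with $\partial$ and with the actions and that induce the identity on $Q$, $M$ and $R$. *Relative Mac Lane cohomology.* Let $\mathbf{mod}\text{-}Q$ be the category of finitely generated free right $Q$-modules: its objects are the natural numbers, and a morphism $y\to x$ is a family $(f_i^k,f_{ij}^k)$, $1\le k\le y$, $1\le i\le x$ resp. $1\le i<j\le x$, with $f_i^k\in Q_e$, $f_{ij}^k\in Q_{ee}$, which sends the $k$-th generator to $e_1f_1^k+\dots+e_xf_x^k+\sum_{i<j}[e_i,e_j]_{f_{ij}^k}$. Let $\mathbf{mod}\text{-}R$ be the category with the same objects and with the $x\times y$-matrices over $R$ as morphisms $y\to x$; there is a functor $\mathbf{mod}\text{-}Q\to\mathbf{mod}\text{-}R$, $(f_i^k,f_{ij}^k)\mapsto(p f_i^k)$. Let $D_M$ be the bifunctor $D_M(y,x)=\mathrm{Hom}_R(R^y,R^x\otimes_RM)$ on $\mathbf{mod}\text{-}R$. For a category $\mathcal C$ and a bifunctor $D:\mathcal C^{\rm op}\times\mathcal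 C\to\mathbf{Ab}$ let $F^*(\mathcal C;D)$ be the Baues–Wirsching cochain complex, with $F^n(\mathcal C;D)=\prod_{c_0\leftarrow\dots\leftarrow c_n}D(c_n,c_0)$. Then $\mathrm{HML}^3(R,Q;M)=H^3(\mathbf{mod}\text{-}R,\mathbf{mod}\text{-}Q;D_M)$ is the homology in degree $2$ of the cokernel of $F^*(\mathbf{mod}\text{-}R;D_M)\to F^*(\mathbf{mod}\text{-}Q;D_M)$. *Track extensions.* Let $q:\mathcal K\to\mathcal C$ be a functor that is the identity on objects and surjective on morphisms. A linear track extension of $\mathcal C$ by $D$ with underlying category $\mathcal K$ is a track category (category enriched in groupoids) $\mathcal T$ with underlying category $\mathcal K$ and homotopy category $\mathcal C$ (so that $q f=q g$ if and only if there is a track $f\Rightarrow g$), together with isomorphisms $\tau_f:D(a,b)\cong\mathrm{Aut}(f)$ for all morphisms $f:a\to b$ of $\mathcal K$, which are compatible with conjugation by tracks and with composition with morphisms of $\mathcal K$ on either side. Its class in $H^3(\mathcal C,\mathcal K;D)$ is defined as follows. Choose a morphism $s\alpha$ over every morphism $\alpha$ of $\mathcal C$, a track $\eta_f:f\Rightarrow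 s(qf)$ for every morphism $f$ of $\mathcal K$, and a track $\mu_{\beta,\alpha}:(s\beta)(s\alpha)\Rightarrow s(\beta\alpha)$ for all composable $\alpha$, $\beta$. The class is represented by the $2$-cochain $c$ for which, with vertical composition of tracks written from left to right, $(\eta_g * \eta_f)\,\mu_{qg,qf}=\tau_{gf}(c(g,f))\,\eta_{gf}$ for all composable $f$, $g$ in $\mathcal K$. A crossed square ring extension $E$ yields a linear track extension $\chi(E)$ of $\mathbf{mod}\text{-}R$ by $D_M$ with underlying category $\mathbf{mod}\text{-}Q$: a track $(f_i^k,f_{ij}^k)\Rightarrow(g_i^k,g_{ij}^k)$ is a matrix $(h_i^k)$ of elements of $C_1$ with $\partial h_i^k=f_i^k-g_i^k$. Vertical composition is the addition of these matrices, and $\tau$ is given by $i:M\to C_1$. Horizontal composition is composition in the category of finitely generated free right modules over the square ring whose $e$-part consists of the pairs $(h,x)\in C_1\times Q_e$, viewed as tracks $\partial h+x\Rightarrow x$, and whose $ee$-part is $Q_{ee}\times Q_{ee}$ (source and target); here $(h,x)+(k,y)=(h+k+P((\overline{\partial k}\otimes\bar x)\cdot H(2)),\,x+y)$ and $(h,x)(k,y)=(h(\partial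 k+y)+xk+P((\overline{\partial h}\otimes\bar x)\cdot H(\partial k+y)),\,xy)$. **Theorem 4.1.** The category $\mathcal{X}ext(R,Q;M)$ is a groupoid, and there is a bijection $$\pi_0\big(\mathcal{X}ext(R,Q;M)\big)\;\approx\;\mathrm{HML}^3(R,Q;M)$$ which sends the connected component of an extension $E$ to the class of the linear track extension $\chi(E)$. -/

import Mathlib

open CategoryTheory
universe u

/-- A square group: a group `e` and an abelian group `ee` (both written additively), a homomorphism
`P : ee → e` and a map `H : e → ee` whose cross effect `(x ∣ y) = H (x + y) - H y - H x` is additive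
in both variables, with `(P a ∣ y) = 0`, `P (x ∣ y) = -x - y + x + y` and `P H P = P + P`. -/
structure SquareGroup where
  e : Type u
  ee : Type u
  [addGroup : AddGroup e]
  [addCommGroup : AddCommGroup ee]
  P : ee →+ e
  H : e → ee
  cross_add_left : ∀ x x' y : e, H (x + x' + y) - H y - H (x + x') =
    (H (x + y) - H y - H x) + (H (x' + y) - H y - H x')
  cross_add_right : ∀ x y y' : e, H (x + (y + y')) - H (y + y') - H x =
    (H (x + y) - H y - H x) + (H (x + y') - H y' - H x)
  cross_P_left : ∀ (a : ee) (y : e), H (P a + y) - H y - H (P a) = 0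
  P_cross : ∀ x y : e, P (H (x + y) - H y - H x) = -x - y + x + y
  P_H_P : ∀ a : ee, P (H (P a)) = P a + P a

attribute [instance] SquareGroup.addGroup SquareGroup.addCommGroup

namespace SquareGroup

/-- The cross effect `(x ∣ y)_H = H (x + y) - H y - H x`. -/
def cross (A : SquareGroup.{u}) (x y : A.e) : A.ee := A.H (x + y) - A.H y - A.H x

/-- The involution `T = H P - id` of `ee`. -/
def T (A : SquareGroup.{u}) (a : A.ee) : A.ee := A.H (A.P a) - a

end SquareGroup

/-- A square ring: a square group with a multiplicative monoid structure on `e` and an action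
of `Q^ad ⊗ Q^ad ⊗ (Q^ad)ᵒᵖ` on the abelian group `ee`, where `Q^ad = coker P`.
The element `(x̄ ⊗ ȳ) · a · z̄` is written `act x y a z`. An additive map defined on `Q^ad` is the
same as an additive map on `e` that vanishes on the image of `P`, so the action is recorded as a map
of elements of `e` that is additive in each variable and vanishes if `x`, `y` or `z` lies in the
image of `P`. The axioms `mul_add`, `add_mul`, `P_act` and `P_act_diag` imply that the
multiplication of `e` induces a ring structure on `Q^ad`. -/
structure SquareRing extends SquareGroup.{u} where
  [monoid : Monoid e]
  act : e → e → ee → e → ee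
  act_add_fst : ∀ x x' y a z, act (x + x') y a z = act x y a z + act x' y a z
  act_add_snd : ∀ x y y' a z, act x (y + y') a z = act x y a z + act x y' a z
  act_add_mid : ∀ x y a a' z, act x y (a + a') z = act x y a z + act x y a' z
  act_add_right : ∀ x y a z z', act x y a (z + z') = act x y a z + act x y a z'
  act_P_fst : ∀ b y a z, act (P b) y a z = 0
  act_P_snd : ∀ x b a z, act x (P b) a z = 0
  act_P_right : ∀ x y a b, act x y a (P b) = 0
  act_one : ∀ a, act 1 1 a 1 = a
  act_act : ∀ x y x' y' a z' z, act x y (act x' y' a z') z = act (x * x') (y * y') a (z' * z)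
  mul_add : ∀ x y z : e, x * (y + z) = x * y + x * z
  add_mul : ∀ x y z : e, (x + y) * z = x * z + y * z + P (act x y (H z) 1)
  cross_eq : ∀ x y : e, H (x + y) - H y - H x = act y x (H (1 + 1)) 1
  T_act : ∀ x y a z, H (P (act x y a z)) - act x y a z = act y x (H (P a) - a) z
  P_act : ∀ a x, P (act 1 1 a x) = P a * x
  P_act_diag : ∀ x a, P (act x x a 1) = x * P a
  H_mul : ∀ x y : e, H (x * y) = act x x (H y) 1 + act 1 1 (H x) y

attribute [instance] SquareRing.monoid

namespace SquareRing

variable (Q : SquareRing.{u})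

/-- The action as a homomorphism in the element of `ee`. -/
def actHom (x y z : Q.e) : Q.ee →+ Q.ee where
  toFun a := Q.act x y a z
  map_zero' := by simpa using Q.act_add_mid x y 0 0 z
  map_add' a b := Q.act_add_mid x y a b z

@[simp] theorem act_zero_mid (x y z : Q.e) : Q.act x y 0 z = 0 := (Q.actHom x y z).map_zero
@[simp] theorem act_neg_mid (x y z : Q.e) (a : Q.ee) : Q.act x y (-a) z = -Q.act x y a z :=
  (Q.actHom x y z).map_neg a
@[simp] theorem act_sub_mid (x y z : Q.e) (a b : Q.ee) :
    Q.act x y (a - b) z = Q.act x y a z - Q.act x y b z := (Q.actHom x y z).map_sub a b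
@[simp] theorem act_zero_fst (y z : Q.e) (a : Q.ee) : Q.act 0 y a z = 0 := by
  simpa using Q.act_add_fst 0 0 y a z
@[simp] theorem act_zero_snd (x z : Q.e) (a : Q.ee) : Q.act x 0 a z = 0 := by
  simpa using Q.act_add_snd x 0 0 a z
@[simp] theorem act_zero_right (x y : Q.e) (a : Q.ee) : Q.act x y a 0 = 0 := by
  simpa using Q.act_add_right x y a 0 0
theorem act_neg_fst (x y z : Q.e) (a : Q.ee) : Q.act (-x) y a z = -Q.act x y a z := by
  rw [eq_neg_iff_add_eq_zero, ← Q.act_add_fst]; simp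
theorem act_neg_snd (x y z : Q.e) (a : Q.ee) : Q.act x (-y) a z = -Q.act x y a z := by
  rw [eq_neg_iff_add_eq_zero, ← Q.act_add_snd]; simp
theorem H_add (x y : Q.e) : Q.H (x + y) = Q.H x + Q.H y + Q.act y x (Q.H (1 + 1)) 1 := by
  rw [← Q.cross_eq]; abel
@[simp] theorem H_zero : Q.H 0 = 0 := by
  simpa using Q.H_add 0 0
@[simp] theorem mul_zero (x : Q.e) : x * 0 = 0 := by
  simpa using Q.mul_add x 0 0
@[simp] theorem zero_mul (x : Q.e) : 0 * x = 0 := by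
  simpa using Q.add_mul 0 0 x
@[simp] theorem H_one : Q.H 1 = 0 := by
  have := Q.H_mul 1 1
  simpa [Q.act_one] using this
theorem P_central (a : Q.ee) (x : Q.e) : Q.P a + x = x + Q.P a := by
  have h := Q.P_cross x (Q.P a)
  rw [Q.cross_eq, Q.act_P_fst, map_zero] at h
  have h2 : x + Q.P a = (Q.P a + x) + (-x - Q.P a + x + Q.P a) := by
    simp [sub_eq_add_neg, add_assoc]
  rw [h2, ← h, add_zero]
theorem T_eq (a : Q.ee) : Q.T a = Q.H (Q.P a) - a := rfl
theorem P_T (a : Q.ee) : Q.P (Q.T a) = Q.P a := by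
  rw [T_eq, map_sub, Q.P_H_P]; simp
theorem add_swap (x y : Q.e) : x + y = y + x + Q.P (Q.act y x (Q.H (1 + 1)) 1) := by
  have h := Q.P_cross x y
  rw [Q.cross_eq] at h
  rw [h]; simp [sub_eq_add_neg, add_assoc]
theorem T_act' (x y : Q.e) (a : Q.ee) (z : Q.e) : Q.T (Q.act x y a z) = Q.act y x (Q.T a) z :=
  Q.T_act x y a z
theorem H_add_P (x : Q.e) (a : Q.ee) : Q.H (x + Q.P a) = Q.H x + Q.H (Q.P a) := by
  rw [Q.H_add, Q.act_P_fst, add_zero]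
theorem H_P (a : Q.ee) : Q.H (Q.P a) = a + Q.T a := by rw [T_eq]; abel
theorem T_zero : Q.T 0 = 0 := by simp [T_eq]
theorem T_add (a b : Q.ee) : Q.T (a + b) = Q.T a + Q.T b := by
  simp only [T_eq, map_add, Q.H_add_P]; abel
theorem T_neg (a : Q.ee) : Q.T (-a) = -Q.T a := by
  rw [eq_neg_iff_add_eq_zero, ← T_add]; simp [T_zero]
theorem T_T (a : Q.ee) : Q.T (Q.T a) = a := by
  have h := Q.P_T a
  rw [Q.T_eq (Q.T a), h, T_eq]; abel
theorem P_two : Q.P (Q.H (1 + 1)) = 0 := by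
  have h := Q.P_cross 1 1
  rw [Q.cross_eq, Q.act_one] at h
  rw [h]; simp [sub_eq_add_neg]
theorem T_two : Q.T (Q.H (1 + 1)) = -Q.H (1 + 1) := by
  rw [T_eq, P_two]; simp
theorem T_cross (x y : Q.e) :
    Q.T (Q.act x y (Q.H (1 + 1)) 1) = -Q.act y x (Q.H (1 + 1)) 1 := by
  rw [T_act', T_two, act_neg_mid]
/-- The defect of `H 2` being equivariant. -/
theorem two_act (z : Q.e) :
    Q.act 1 1 (Q.H (1 + 1)) z = Q.act z z (Q.H (1 + 1)) 1 + Q.T (Q.H z) - Q.H z := by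
  have h1 := Q.H_mul (1 + 1) z
  have h2 := Q.H_mul z (1 + 1)
  have h3 : (1 + 1) * z = z * (1 + 1) + Q.P (Q.H z) := by
    rw [Q.add_mul, Q.mul_add, Q.act_one]; simp
  rw [h3, Q.H_add_P, h2] at h1
  simp only [Q.act_add_fst, Q.act_add_snd, Q.act_add_right, Q.act_one] at h1
  rw [T_eq]
  have : Q.act 1 1 (Q.H (1 + 1)) z = (Q.H z + Q.H z + (Q.H z + Q.H z) +
      Q.act 1 1 (Q.H (1 + 1)) z) - (Q.H z + Q.H z + (Q.H z + Q.H z)) := by abel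
  rw [this, ← h1]; abel

end SquareRing

/-- The sum `f 0 + f 1 + ⋯ + f (n - 1)`, in this order. -/
def osum {G : Type*} [AddMonoid G] {n : ℕ} (f : Fin n → G) : G := (List.ofFn f).sum

@[simp] theorem osum_zero {G : Type*} [AddMonoid G] (f : Fin 0 → G) : osum f = 0 := by
  simp [osum]

theorem osum_succ {G : Type*} [AddMonoid G] {n : ℕ} (f : Fin (n + 1) → G) :
    osum f = f 0 + osum (fun k => f k.succ) := by
  simp [osum, List.ofFn_succ]

theorem osum_eq_sum {G : Type*} [AddCommMonoid G] {n : ℕ} (f : Fin n → G) :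
    osum f = ∑ k, f k := by
  simp [osum, List.sum_ofFn]

theorem map_osum {G G' : Type*} [AddMonoid G] [AddMonoid G'] {n : ℕ} (φ : G → G')
    (h0 : φ 0 = 0) (ha : ∀ x y, φ (x + y) = φ x + φ y) (f : Fin n → G) :
    φ (osum f) = osum (fun k => φ (f k)) := by
  induction n with
  | zero => simpa using h0
  | succ n ih => rw [osum_succ, osum_succ, ha, ih]

theorem osum_eq_zero {G : Type*} [AddMonoid G] {n : ℕ} (f : Fin n → G) (h : ∀ k, f k = 0) :
    osum f = 0 := by
  induction n with
  | zero => simp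
  | succ n ih => rw [osum_succ, h, ih _ (fun k => h _), add_zero]

theorem osum_single {G : Type*} [AddMonoid G] {n : ℕ} (i : Fin n) (f : Fin n → G)
    (h : ∀ k, k ≠ i → f k = 0) : osum f = f i := by
  induction n with
  | zero => exact i.elim0
  | succ n ih =>
    rw [osum_succ]
    refine Fin.cases (fun h => ?_) (fun j h => ?_) i h
    · rw [osum_eq_zero, add_zero]
      exact fun k => h _ (Fin.succ_ne_zero k)
    · rw [ih j _ (fun k hk => h _ (by simpa using hk)), h 0 (Fin.succ_ne_zero j).symm, zero_add]

/-- A right module over a square ring `Q`: a group `M` with maps `(m, x) ↦ m x` and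
`(m, n, a) ↦ [m, n]_a`. -/
class RightModule (Q : SquareRing.{u}) (M : Type u) [AddGroup M] where
  sm : M → Q.e → M
  br : M → M → Q.ee → M
  sm_one : ∀ m, sm m 1 = m
  sm_mul : ∀ m x y, sm m (x * y) = sm (sm m x) y
  sm_add : ∀ m x y, sm m (x + y) = sm m x + sm m y
  add_sm : ∀ m n x, sm (m + n) x = sm m x + sm n x + br m n (Q.H x)
  sm_P : ∀ m a, sm m (Q.P a) = br m m a
  br_T : ∀ m n a, br m n (Q.T a) = br n m a
  br_sm : ∀ m n x y a, br (sm m x) (sm n y) a = br m n (Q.act x y a 1)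
  sm_br : ∀ m n a x, sm (br m n a) x = br m n (Q.act 1 1 a x)
  br_br : ∀ m n a z b, br (br m n a) z b = 0
  br_add_left : ∀ m m' n a, br (m + m') n a = br m n a + br m' n a
  br_add_right : ∀ m n n' a, br m (n + n') a = br m n a + br m n' a
  br_add : ∀ m n a b, br m n (a + b) = br m n a + br m n b
  br_central : ∀ m n a z, br m n a + z = z + br m n a

/-- The underlying set of the free right `Q`-module on generators `e 0, …, e (n - 1)`. The family
`(v i, v i j)` stands for `e 0 · v 0 + ⋯ + e (n - 1) · v (n - 1) + ∑ i < j, [e i, e j]_(v i j)`. -/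
@[ext] structure FreeMod (Q : SquareRing.{u}) (n : ℕ) : Type u where
  e : Fin n → Q.e
  ee : ∀ i j : Fin n, i < j → Q.ee

namespace FreeMod

variable {Q : SquareRing.{u}} {n : ℕ}

instance : Zero (FreeMod Q n) := ⟨⟨fun _ => 0, fun _ _ _ => 0⟩⟩

instance : Add (FreeMod Q n) := ⟨fun v w =>
  ⟨fun i => v.e i + w.e i,
   fun i j h => v.ee i j h + w.ee i j h + Q.act (w.e i) (v.e j) (Q.H (1 + 1)) 1⟩⟩

instance : Neg (FreeMod Q n) := ⟨fun v =>
  ⟨fun i => -v.e i, fun i j h => -v.ee i j h + Q.act (v.e i) (v.e j) (Q.H (1 + 1)) 1⟩⟩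

@[simp] theorem zero_e (i : Fin n) : (0 : FreeMod Q n).e i = 0 := rfl
@[simp] theorem zero_ee (i j : Fin n) (h : i < j) : (0 : FreeMod Q n).ee i j h = 0 := rfl
@[simp] theorem add_e (v w : FreeMod Q n) (i : Fin n) : (v + w).e i = v.e i + w.e i := rfl
@[simp] theorem add_ee (v w : FreeMod Q n) (i j : Fin n) (h : i < j) : (v + w).ee i j h =
  v.ee i j h + w.ee i j h + Q.act (w.e i) (v.e j) (Q.H (1 + 1)) 1 := rfl
@[simp] theorem neg_e (v : FreeMod Q n) (i : Fin n) : (-v).e i = -v.e i := rfl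
@[simp] theorem neg_ee (v : FreeMod Q n) (i j : Fin n) (h : i < j) : (-v).ee i j h =
  -v.ee i j h + Q.act (v.e i) (v.e j) (Q.H (1 + 1)) 1 := rfl

theorem ext' {v w : FreeMod Q n} (h : ∀ i, v.e i = w.e i)
    (h' : ∀ i j hij, v.ee i j hij = w.ee i j hij) : v = w :=
  FreeMod.ext (funext h) (funext fun i => funext fun j => funext fun hij => h' i j hij)

instance : AddGroup (FreeMod Q n) := AddGroup.ofLeftAxioms
  (fun u v w => ext' (fun i => by simp [add_assoc]) (fun i j h => by
    simp only [add_ee, add_e, Q.act_add_fst, Q.act_add_snd]; abel))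
  (fun v => ext' (fun i => by simp) (fun i j h => by simp))
  (fun v => ext' (fun i => by simp) (fun i j h => by
    simp [Q.act_neg_snd]))

/-- Multiplication of an element of the free module by an element of `Q`. -/
def scalar (v : FreeMod Q n) (x : Q.e) : FreeMod Q n :=
  ⟨fun i => v.e i * x, fun i j h => Q.act 1 1 (v.ee i j h) x + Q.act (v.e i) (v.e j) (Q.H x) 1⟩

/-- The bracket `[v, w]_a` in the free module. -/
def bracket (v w : FreeMod Q n) (a : Q.ee) : FreeMod Q n :=
  ⟨fun i => Q.P (Q.act (v.e i) (w.e i) a 1),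
   fun i j _ => Q.act (v.e i) (w.e j) a 1 + Q.act (w.e i) (v.e j) (Q.T a) 1⟩

theorem act_eq (x y : Q.e) (a : Q.ee) (z : Q.e) :
    Q.act x y a z = Q.act x y (Q.act 1 1 a z) 1 := by
  rw [Q.act_act]; simp

instance rightModule : RightModule Q (FreeMod Q n) where
  sm := scalar
  br := bracket
  sm_one v := ext' (fun i => by simp [scalar]) (fun i j h => by simp [scalar, Q.act_one])
  sm_mul v x y := ext' (fun i => by simp [scalar, mul_assoc]) (fun i j h => by
    simp only [scalar, Q.H_mul, Q.act_add_mid, Q.act_act, one_mul, mul_one]; abel)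
  sm_add v x y := ext' (fun i => by simp [scalar, Q.mul_add]) (fun i j h => by
    simp only [scalar, add_ee, Q.H_add x y, Q.act_add_mid, Q.act_act, mul_one, Q.act_add_right]
    abel)
  add_sm v w x := ext' (fun i => by simp [scalar, bracket, Q.add_mul]) (fun i j h => by
    simp only [scalar, bracket, add_ee, add_e, Q.act_add_mid, Q.act_act, one_mul, Q.act_add_fst,
      Q.act_add_snd, Q.act_P_fst]
    rw [act_eq (w.e i) (v.e j) _ x, Q.two_act]
    simp only [Q.act_add_mid, Q.act_sub_mid, Q.act_act, mul_one]
    abel)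
  sm_P v a := ext' (fun i => by simp [scalar, bracket, Q.P_act_diag]) (fun i j h => by
    simp only [scalar, bracket, Q.act_P_right, Q.H_P, Q.act_add_mid]; abel)
  br_T v w a := ext' (fun i => by
      simp only [bracket]; rw [← Q.T_act', Q.P_T]) (fun i j h => by
    simp only [bracket, Q.T_T]; abel)
  br_sm v w x y a := ext' (fun i => by simp [scalar, bracket, Q.act_act]) (fun i j h => by
    simp only [scalar, bracket, Q.T_act', Q.act_act, one_mul])
  sm_br v w a x := ext' (fun i => by
      simp only [scalar, bracket, Q.act_act, one_mul, mul_one, ← Q.P_act]) (fun i j h => by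
    simp only [scalar, bracket, Q.act_P_fst, Q.T_act', Q.act_add_mid, Q.act_act, one_mul, mul_one]
    abel)
  br_br v w a z b := ext' (fun i => by simp [bracket, Q.act_P_fst]) (fun i j h => by
    simp [bracket, Q.act_P_fst, Q.act_P_snd])
  br_add_left v v' w a := ext' (fun i => by simp [bracket, Q.act_add_fst]) (fun i j h => by
    simp only [bracket, add_ee, add_e, Q.act_add_fst, Q.act_add_snd, Q.act_P_fst]; abel)
  br_add_right v v' w a := ext' (fun i => by simp [bracket, Q.act_add_snd]) (fun i j h => by
    simp only [bracket, add_ee, add_e, Q.act_add_fst, Q.act_add_snd, Q.act_P_fst]; abel)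
  br_add v w a b := ext' (fun i => by simp [bracket, Q.act_add_mid]) (fun i j h => by
    simp only [bracket, add_ee, Q.T_add, Q.act_add_mid, Q.act_P_fst]; abel)
  br_central v w a z := ext' (fun i => by simp [bracket, Q.P_central]) (fun i j h => by
    simp only [bracket, add_ee, Q.act_P_fst, Q.act_P_snd]; abel)

end FreeMod

namespace RightModule

variable {Q : SquareRing.{u}} {M : Type u} [AddGroup M] [RightModule Q M]

instance centerAddCommGroup : AddCommGroup (AddSubgroup.center M) :=
  { (inferInstance : AddGroup (AddSubgroup.center M)) with
    add_comm := fun c z => Subtype.ext (AddSubgroup.mem_center_iff.1 z.2 c) }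

/-- The bracket with values in the center. -/
def brc (m n : M) (a : Q.ee) : AddSubgroup.center M :=
  ⟨br m n a, AddSubgroup.mem_center_iff.2 fun z => (br_central m n a z).symm⟩

theorem coe_brc (m n : M) (a : Q.ee) : (brc m n a : M) = br m n a := rfl

theorem coe_comm (c : AddSubgroup.center M) (z : M) : (c : M) + z = z + c :=
  (AddSubgroup.mem_center_iff.1 c.2 z).symm

theorem brc_add_left (m m' n : M) (a : Q.ee) : brc (m + m') n a = brc m n a + brc m' n a :=
  Subtype.ext (br_add_left m m' n a)
theorem brc_add_right (m n n' : M) (a : Q.ee) : brc m (n + n') a = brc m n a + brc m n' a :=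
  Subtype.ext (br_add_right m n n' a)
theorem brc_add (m n : M) (a b : Q.ee) : brc m n (a + b) = brc m n a + brc m n b :=
  Subtype.ext (br_add m n a b)
theorem brc_zero_left (n : M) (a : Q.ee) : brc 0 n a = 0 := by
  simpa using brc_add_left 0 0 n a
theorem brc_zero_right (m : M) (a : Q.ee) : brc m 0 a = 0 := by
  simpa using brc_add_right m 0 0 a
theorem brc_zero (m n : M) : brc m n (0 : Q.ee) = 0 := by
  simpa using brc_add m n (0 : Q.ee) 0
theorem brc_neg (m n : M) (a : Q.ee) : brc m n (-a) = -brc m n a := by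
  rw [eq_neg_iff_add_eq_zero, ← brc_add]; simp [brc_zero]
theorem sm_zero (m : M) : sm m (0 : Q.e) = 0 := by
  simpa using sm_add m (0 : Q.e) 0
theorem zero_sm (x : Q.e) : sm (0 : M) x = 0 := by
  have h := add_sm (0 : M) 0 x
  rw [← coe_brc, brc_zero_left] at h
  simpa using h
theorem brc_osum_left {n : ℕ} (u : Fin n → M) (m : M) (a : Q.ee) :
    brc (osum u) m a = ∑ k, brc (u k) m a := by
  rw [map_osum (fun m' => brc m' m a) (brc_zero_left m a) (fun x y => brc_add_left x y m a),
    osum_eq_sum]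
theorem brc_osum_right {n : ℕ} (u : Fin n → M) (m : M) (a : Q.ee) :
    brc m (osum u) a = ∑ k, brc m (u k) a := by
  rw [map_osum (fun m' => brc m m' a) (brc_zero_right m a) (fun x y => brc_add_right m x y a),
    osum_eq_sum]

theorem add_swap (m n : M) : n + m = m + n + br m n (Q.H (1 + 1)) := by
  have h1 := sm_add (m + n) (1 : Q.e) 1
  rw [add_sm, sm_add, sm_add, sm_one, sm_one, sm_one] at h1
  have h2 : m + (m + n + br m n (Q.H (1 + 1)) + n) = m + (n + m + n) := by
    rw [add_assoc (m + n), br_central]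
    simpa [add_assoc] using h1
  exact add_right_cancel (add_left_cancel h2.symm)

theorem brc_two_symm (m n : M) : brc m n (Q.H (1 + 1)) = -brc n m (Q.H (1 + 1)) := by
  rw [← brc_neg, ← Q.T_two]
  exact Subtype.ext (br_T n m _).symm

/-- The sum of `z k l` over the pairs `k < l`. -/
def psum {G : Type*} [AddMonoid G] {n : ℕ} (z : ∀ k l : Fin n, k < l → G) : G :=
  osum fun k => osum fun l => if h : k < l then z k l h else 0

theorem map_psum {G G' : Type*} [AddMonoid G] [AddMonoid G'] {n : ℕ} (φ : G → G')
    (h0 : φ 0 = 0) (ha : ∀ x y, φ (x + y) = φ x + φ y) (z : ∀ k l : Fin n, k < l → G) :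
    φ (psum z) = psum (fun k l h => φ (z k l h)) := by
  unfold psum
  rw [map_osum φ h0 ha]
  congr 1; funext k
  rw [map_osum φ h0 ha]
  congr 1; funext l
  split_ifs
  · rfl
  · exact h0

theorem psum_eq_sum {G : Type*} [AddCommMonoid G] {n : ℕ} (z : ∀ k l : Fin n, k < l → G) :
    psum z = ∑ k, ∑ l, if h : k < l then z k l h else 0 := by
  simp [psum, osum_eq_sum]

theorem psum_add {G : Type*} [AddCommMonoid G] {n : ℕ} (z w : ∀ k l : Fin n, k < l → G) :
    psum (fun k l h => z k l h + w k l h) = psum z + psum w := by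
  rw [psum_eq_sum, psum_eq_sum, psum_eq_sum, ← Finset.sum_add_distrib]
  refine Finset.sum_congr rfl fun k _ => ?_
  rw [← Finset.sum_add_distrib]
  refine Finset.sum_congr rfl fun l _ => ?_
  split_ifs <;> simp

theorem psum_neg {G : Type*} [AddCommGroup G] {n : ℕ} (z : ∀ k l : Fin n, k < l → G) :
    psum (fun k l h => -z k l h) = -psum z :=
  (map_psum (fun x : G => -x) neg_zero (fun x y => neg_add x y) z).symm

theorem psum_succ {G : Type*} [AddCommMonoid G] {n : ℕ} (z : ∀ k l : Fin (n + 1), k < l → G) :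
    psum z = ∑ l : Fin n, z 0 l.succ (Fin.succ_pos l) +
      psum (fun k l h => z k.succ l.succ (Fin.succ_lt_succ_iff.2 h)) := by
  rw [psum_eq_sum, psum_eq_sum, Fin.sum_univ_succ, Fin.sum_univ_succ]
  congr 1
  · simp
  · refine Finset.sum_congr rfl fun k _ => ?_
    rw [Fin.sum_univ_succ]
    simp

theorem coe_psum {n : ℕ} (z : ∀ k l : Fin n, k < l → AddSubgroup.center M) :
    ((psum z : AddSubgroup.center M) : M) = psum (fun k l h => (z k l h : M)) :=
  map_psum (fun c : AddSubgroup.center M => (c : M)) rfl (fun _ _ => rfl) z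

theorem coe_osum {n : ℕ} (z : Fin n → AddSubgroup.center M) :
    ((∑ k, z k : AddSubgroup.center M) : M) = osum (fun k => (z k : M)) := by
  rw [← osum_eq_sum]
  exact map_osum (fun c : AddSubgroup.center M => (c : M)) rfl (fun _ _ => rfl) z

theorem osum_add {n : ℕ} (u v : Fin n → M) : osum (fun k => u k + v k) =
    osum u + osum v + (psum (fun k l _ => brc (u l) (v k) (Q.H (1 + 1))) :
      AddSubgroup.center M) := by
  induction n with
  | zero => simp [psum]
  | succ n ih =>
    rw [osum_succ, osum_succ u, osum_succ v, ih, psum_succ, ← brc_osum_left, AddSubgroup.coe_add]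
    set U := osum fun k => u k.succ
    set V := osum fun k => v k.succ
    generalize (psum _ : AddSubgroup.center M) = c
    have h := add_swap (Q := Q) U (v 0)
    rw [coe_brc]
    calc u 0 + v 0 + (U + V + c) = u 0 + (v 0 + U) + V + c := by simp only [add_assoc]
      _ = u 0 + (U + v 0) + (br U (v 0) (Q.H (1 + 1)) + V) + c := by rw [h]; simp only [add_assoc]
      _ = _ := by rw [br_central]; simp only [add_assoc]

theorem osum_sm {n : ℕ} (u : Fin n → M) (x : Q.e) : sm (osum u) x =
    osum (fun k => sm (u k) x) + (psum (fun k l _ => brc (u k) (u l) (Q.H x)) :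
      AddSubgroup.center M) := by
  induction n with
  | zero => simp [psum, zero_sm]
  | succ n ih =>
    rw [osum_succ, osum_succ, psum_succ, ← brc_osum_right, add_sm, ih, AddSubgroup.coe_add, coe_brc]
    set U := osum fun k => u k.succ
    generalize (psum _ : AddSubgroup.center M) = c
    simp only [add_assoc]
    rw [coe_comm]

/-- The homomorphism from the free module to `M` which sends the generators to the elements `f k`,
`f 0 · g 0 + ⋯ + f (n - 1) · g (n - 1) + ∑ k < l, [f k, f l]_(g k l)`. -/
def lift {n : ℕ} (f : Fin n → M) (g : FreeMod Q n) : M :=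
  osum (fun k => sm (f k) (g.e k)) + psum (fun k l h => br (f k) (f l) (g.ee k l h))

theorem lift_eq {n : ℕ} (f : Fin n → M) (g : FreeMod Q n) :
    lift f g = osum (fun k => sm (f k) (g.e k)) +
      (psum (fun k l h => brc (f k) (f l) (g.ee k l h)) : AddSubgroup.center M) := by
  rw [coe_psum]; rfl

theorem lift_zero {n : ℕ} (f : Fin n → M) : lift f (0 : FreeMod Q n) = 0 := by
  rw [lift_eq, psum_eq_sum]
  rw [osum_eq_zero]
  · simp [brc_zero]
  · intro k; simp [sm_zero]

theorem lift_add {n : ℕ} (f : Fin n → M) (g g' : FreeMod Q n) :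
    lift f (g + g') = lift f g + lift f g' := by
  simp only [lift_eq, FreeMod.add_e, sm_add, FreeMod.add_ee, brc_add, psum_add]
  rw [osum_add (Q := Q)]
  have h : psum (fun k l _ => brc (sm (f l) (g.e l)) (sm (f k) (g'.e k)) (Q.H (1 + 1))) =
      - psum (fun k l (_ : k < l) => brc (f k) (f l) (Q.act (g'.e k) (g.e l) (Q.H (1 + 1)) 1)) := by
    rw [← psum_neg]
    congr 1; funext k l _
    rw [brc_two_symm]
    congr 1
    exact Subtype.ext (br_sm _ _ _ _ _)
  rw [h]
  generalize (psum _ : AddSubgroup.center M) = c1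
  generalize (psum _ : AddSubgroup.center M) = c2
  generalize (psum _ : AddSubgroup.center M) = c3
  have h4 : (-c1) + ((c2 + c3) + c1) = c2 + c3 := by abel
  rw [add_assoc, ← AddSubgroup.coe_add, h4, AddSubgroup.coe_add]
  simp only [add_assoc]
  rw [← add_assoc (c2 : M), coe_comm c2, add_assoc, coe_comm c2, add_assoc]

theorem br_psum_left {n : ℕ} (f : Fin n → M) (z : ∀ k l : Fin n, k < l → Q.ee) (m : M) (a : Q.ee) :
    brc ((psum (fun k l h => brc (f k) (f l) (z k l h)) : AddSubgroup.center M) : M) m a = 0 := by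
  rw [coe_psum, map_psum (fun m' => brc m' m a) (brc_zero_left m a)
    (fun x y => brc_add_left x y m a), psum_eq_sum]
  refine Finset.sum_eq_zero fun k _ => Finset.sum_eq_zero fun l _ => ?_
  split_ifs
  · exact Subtype.ext (br_br _ _ _ _ _)
  · rfl

theorem br_psum_right {n : ℕ} (f : Fin n → M) (z : ∀ k l : Fin n, k < l → Q.ee) (m : M)
    (a : Q.ee) :
    brc m ((psum (fun k l h => brc (f k) (f l) (z k l h)) : AddSubgroup.center M) : M) a = 0 := by
  have h := br_psum_left f z m (Q.T a)
  rw [← h]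
  exact Subtype.ext (br_T _ _ _).symm

theorem osum_sm_of_br {n : ℕ} (u : Fin n → M) (x : Q.e)
    (h : ∀ k m, brc (u k) m (Q.H x) = 0) : sm (osum u) x = osum (fun k => sm (u k) x) := by
  rw [osum_sm, psum_eq_sum]
  simp [h]

theorem psum_sm {n : ℕ} (f : Fin n → M) (z : ∀ k l : Fin n, k < l → Q.ee) (x : Q.e) :
    sm ((psum (fun k l h => brc (f k) (f l) (z k l h)) : AddSubgroup.center M) : M) x =
      (psum (fun k l h => brc (f k) (f l) (Q.act 1 1 (z k l h) x)) : AddSubgroup.center M) := by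
  have h1 : ∀ (k l : Fin n) (m : M) (a : Q.ee),
      brc (if h : k < l then br (f k) (f l) (z k l h) else (0 : M)) m a = 0 := by
    intro k l m a
    split_ifs
    · exact Subtype.ext (br_br _ _ _ _ _)
    · exact brc_zero_left _ _
  rw [coe_psum, coe_psum]
  unfold psum
  simp only [coe_brc]
  rw [osum_sm_of_br]
  · congr 1; funext k
    rw [osum_sm_of_br]
    · congr 1; funext l
      split_ifs
      · exact sm_br _ _ _ _
      · exact zero_sm _
    · exact fun l m => h1 k l m _
  · intro k m
    rw [brc_osum_left]
    exact Finset.sum_eq_zero fun l _ => h1 k l m _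

theorem lift_sm {n : ℕ} (f : Fin n → M) (g : FreeMod Q n) (x : Q.e) :
    lift f (sm g x) = sm (lift f g) x := by
  rw [lift_eq f g, add_sm, osum_sm, psum_sm, ← coe_brc, br_psum_right]
  have h1 : ∀ k, (sm g x).e k = g.e k * x := fun k => rfl
  have h2 : ∀ k l h, (sm g x).ee k l h =
    Q.act 1 1 (g.ee k l h) x + Q.act (g.e k) (g.e l) (Q.H x) 1 := fun k l h => rfl
  have h3 : ∀ k l, brc (sm (f k) (g.e k)) (sm (f l) (g.e l)) (Q.H x) =
    brc (f k) (f l) (Q.act (g.e k) (g.e l) (Q.H x) 1) := fun k l => Subtype.ext (br_sm _ _ _ _ _)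
  simp only [lift_eq, h1, h2, h3, sm_mul, brc_add, psum_add, AddSubgroup.coe_add,
    AddSubgroup.coe_zero, add_zero, add_assoc]
  rw [coe_comm]

theorem lift_br {n : ℕ} (f : Fin n → M) (g g' : FreeMod Q n) (a : Q.ee) :
    lift f (br g g' a) = br (lift f g) (lift f g') a := by
  have h1 : ∀ k, (br g g' a).e k = Q.P (Q.act (g.e k) (g'.e k) a 1) := fun k => rfl
  have h2 : ∀ k l h, (br g g' a).ee k l h =
    Q.act (g.e k) (g'.e l) a 1 + Q.act (g'.e k) (g.e l) (Q.T a) 1 := fun k l h => rfl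
  have h3 : ∀ k l, brc (f k) (f l) (Q.act (g'.e k) (g.e l) (Q.T a) 1) =
      brc (f l) (f k) (Q.act (g.e l) (g'.e k) a 1) := by
    intro k l
    rw [← Q.T_act']
    exact Subtype.ext (br_T _ _ _)
  have h4 : ∀ k l, brc (sm (f k) (g.e k)) (sm (f l) (g'.e l)) a =
    brc (f k) (f l) (Q.act (g.e k) (g'.e l) a 1) := fun k l => Subtype.ext (br_sm _ _ _ _ _)
  rw [← coe_brc (lift f g), lift_eq f g, lift_eq f g', brc_add_left, brc_add_right, br_psum_left,
    br_psum_right, brc_osum_left, lift_eq]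
  simp only [brc_osum_right, h1, h2, h4, sm_P, brc_add, psum_add, h3, add_zero]
  simp only [← coe_brc]
  rw [← coe_osum, ← AddSubgroup.coe_add]
  congr 1
  simp only [psum_eq_sum]
  set F : Fin n → Fin n → AddSubgroup.center M := fun k l =>
    brc (f k) (f l) (Q.act (g.e k) (g'.e l) a 1) with hF
  have h5 : ∑ k, ∑ l, (if k < l then F l k else 0) = ∑ k, ∑ l, (if l < k then F k l else 0) :=
    Finset.sum_comm
  have h6 : ∀ k, F k k = ∑ l, if k = l then F k l else 0 := by intro k; simp
  change ∑ k, F k k + (∑ k, ∑ l, (if k < l then F k l else 0) +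
    ∑ k, ∑ l, (if k < l then F l k else 0)) = ∑ k, ∑ l, F k l
  rw [h5, Finset.sum_congr rfl (fun k _ => h6 k), ← Finset.sum_add_distrib,
    ← Finset.sum_add_distrib]
  refine Finset.sum_congr rfl fun k _ => ?_
  rw [← Finset.sum_add_distrib, ← Finset.sum_add_distrib]
  refine Finset.sum_congr rfl fun l _ => ?_
  rcases lt_trichotomy k l with h | h | h
  · simp [h, h.ne, h.not_gt]
  · simp [h]
  · simp [h, h.ne', h.not_gt]

theorem map_lift {N : Type u} [AddGroup N] [RightModule Q N] (φ : M → N) (h0 : φ 0 = 0)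
    (ha : ∀ x y, φ (x + y) = φ x + φ y) (hs : ∀ (m : M) (x : Q.e), φ (sm m x) = sm (φ m) x)
    (hb : ∀ (m m' : M) (a : Q.ee), φ (br m m' a) = br (φ m) (φ m') a) {n : ℕ} (f : Fin n → M)
    (g : FreeMod Q n) : φ (lift f g) = lift (fun k => φ (f k)) g := by
  unfold lift
  rw [ha, map_osum φ h0 ha, map_psum φ h0 ha]
  simp only [hs, hb]

theorem lift_lift {n m : ℕ} (f : Fin n → M) (g : Fin m → FreeMod Q n) (h : FreeMod Q m) :
    lift f (lift g h) = lift (fun k => lift f (g k)) h :=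
  map_lift _ (lift_zero f) (lift_add f) (lift_sm f) (lift_br f) g h

end RightModule

namespace FreeMod

variable {Q : SquareRing.{u}} {n : ℕ}

theorem osum_e {m : ℕ} (u : Fin m → FreeMod Q n) (i : Fin n) :
    (osum u).e i = osum (fun k => (u k).e i) :=
  map_osum (fun v : FreeMod Q n => v.e i) rfl (fun _ _ => rfl) u

open RightModule

theorem osum_ee {m : ℕ} (u : Fin m → FreeMod Q n) (i j : Fin n) (h : i < j) :
    (osum u).ee i j h = ∑ k, (u k).ee i j h +
      psum (fun k l _ => Q.act ((u l).e i) ((u k).e j) (Q.H (1 + 1)) 1) := by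
  induction m with
  | zero => simp [psum]
  | succ m ih =>
    rw [osum_succ, psum_succ, add_ee, ih, Fin.sum_univ_succ, osum_e]
    have : Q.act (osum fun k : Fin m => (u k.succ).e i) ((u 0).e j) (Q.H (1 + 1)) 1 =
        ∑ l : Fin m, Q.act ((u l.succ).e i) ((u 0).e j) (Q.H (1 + 1)) 1 := by
      rw [map_osum (fun x => Q.act x ((u 0).e j) (Q.H (1 + 1)) 1) (by simp)
        (fun x y => Q.act_add_fst _ _ _ _ _), osum_eq_sum]
    rw [this]; abel

/-- The generator `e i` of the free module. -/
def gen (Q : SquareRing.{u}) {n : ℕ} (i : Fin n) : FreeMod Q n :=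
  ⟨fun j => if j = i then 1 else 0, fun _ _ _ => 0⟩

/-- Explicit formula for the first components of `f 0 · g 0 + ⋯ + ∑ k < l, [f k, f l]_(g k l)`. -/
theorem lift_e {m : ℕ} (f : Fin m → FreeMod Q n) (g : FreeMod Q m) (i : Fin n) :
    (lift f g).e i = osum (fun k => (f k).e i * g.e k) +
      Q.P (psum (fun k l h => Q.act ((f k).e i) ((f l).e i) (g.ee k l h) 1)) := by
  rw [map_psum Q.P Q.P.map_zero Q.P.map_add]
  unfold lift
  rw [add_e, osum_e, map_psum (fun v : FreeMod Q n => v.e i) rfl (fun _ _ => rfl)]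
  rfl

/-- Explicit formula for the second components of
`f 0 · g 0 + ⋯ + ∑ k < l, [f k, f l]_(g k l)`. -/
theorem lift_ee {m : ℕ} (f : Fin m → FreeMod Q n) (g : FreeMod Q m) (i j : Fin n) (h : i < j) :
    (lift f g).ee i j h =
      ∑ k, (Q.act 1 1 ((f k).ee i j h) (g.e k) + Q.act ((f k).e i) ((f k).e j) (Q.H (g.e k)) 1) +
      psum (fun k l hkl => Q.act ((f k).e i) ((f l).e j) (g.ee k l hkl) 1 +
        Q.act ((f l).e i) ((f k).e j) (Q.T (g.ee k l hkl)) 1 +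
        Q.act ((f l).e i * g.e l) ((f k).e j * g.e k) (Q.H (1 + 1)) 1) := by
  have h1 : ∀ (k l : Fin m) (a : Q.ee) (i' : Fin n) (y : Q.e) (b : Q.ee),
      Q.act ((br (f k) (f l) a).e i') y b 1 = 0 := fun k l a i' y b => Q.act_P_fst _ _ _ _
  have h2 : ∀ (k : Fin m) (i' : Fin n) (y : Q.e) (b : Q.ee),
      Q.act ((osum fun l : Fin m => if h : k < l then br (f k) (f l) (g.ee k l h) else 0).e i')
        y b 1 = 0 := by
    intro k i' y b
    rw [osum_e, map_osum (fun x => Q.act x y b 1) (by simp) (fun _ _ => Q.act_add_fst _ _ _ _ _)]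
    refine osum_eq_zero _ fun l => ?_
    split_ifs
    · exact h1 _ _ _ _ _ _
    · simp
  have h3 : (psum (fun k l h => br (f k) (f l) (g.ee k l h))).ee i j h =
      psum (fun k l hkl => Q.act ((f k).e i) ((f l).e j) (g.ee k l hkl) 1 +
        Q.act ((f l).e i) ((f k).e j) (Q.T (g.ee k l hkl)) 1) := by
    rw [psum, osum_ee, psum_eq_sum (fun k l _ => Q.act _ _ _ _), psum_eq_sum]
    simp only [h2, dite_eq_ite, ite_self, Finset.sum_const_zero, add_zero]
    refine Finset.sum_congr rfl fun k _ => ?_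
    rw [osum_ee, psum_eq_sum, add_eq_left.2]
    · refine Finset.sum_congr rfl fun l _ => ?_
      split_ifs <;> rfl
    · refine Finset.sum_eq_zero fun a _ => Finset.sum_eq_zero fun b _ => ?_
      split_ifs
      · exact h1 _ _ _ _ _ _
      all_goals simp
  have h4 : ∀ y, Q.act ((psum (fun k l h => br (f k) (f l) (g.ee k l h))).e i) y
      (Q.H (1 + 1)) 1 = 0 := by
    intro y
    rw [psum, osum_e, map_osum (fun x => Q.act x y (Q.H (1 + 1)) 1) (by simp)
      (fun _ _ => Q.act_add_fst _ _ _ _ _)]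
    exact osum_eq_zero _ fun k => h2 k i y _
  rw [lift, add_ee, h4, h3, osum_ee, add_zero]
  conv_rhs => rw [psum_add]
  rw [add_assoc, add_comm (psum _) (psum _)]
  rfl

theorem lift_gen {M : Type u} [AddGroup M] [RightModule Q M] (f : Fin n → M) (i : Fin n) :
    lift f (gen Q i) = f i := by
  rw [lift_eq, osum_single i]
  · simp [gen, sm_one, brc_zero, psum_eq_sum]
  · intro k hk
    simp [gen, hk, sm_zero]

theorem gen_lift (g : FreeMod Q n) : lift (gen Q) g = g := by
  refine ext' (fun i => ?_) (fun i j h => ?_)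
  · rw [lift_e, osum_single i]
    · rw [psum_eq_sum, Finset.sum_eq_zero]
      · simp [gen]
      · intro k _
        refine Finset.sum_eq_zero fun l _ => ?_
        split_ifs with hkl
        · by_cases hk : i = k
          · have : i ≠ l := by rw [hk]; exact hkl.ne
            simp [gen, this]
          · simp [gen, hk]
        · rfl
    · intro k hk
      simp [gen, hk.symm]
  · rw [lift_ee, Finset.sum_eq_zero, zero_add, psum_eq_sum, Finset.sum_eq_single i,
      Finset.sum_eq_single j]
    · simp [gen, h, h.ne, h.ne', Q.act_one]
    · intro l _ hl
      split_ifs with hil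
      · simp [gen, hl.symm, hil.ne, h.ne']
      · rfl
    · simp
    · intro k _ hk
      refine Finset.sum_eq_zero fun l _ => ?_
      split_ifs with hkl
      · by_cases hjk : j = k
        · have h1 : i ≠ l := by rintro rfl; exact absurd (hjk ▸ h) hkl.not_gt
          simp [gen, hk.symm, h1]
        · simp [gen, hk.symm, hjk]
      · rfl
    · simp
    · intro k _
      by_cases hik : i = k
      · have : j ≠ k := by rw [← hik]; exact h.ne'
        simp [gen, this]
      · simp [gen, hik]

end FreeMod

namespace SquareRing

/-- Morphisms of square rings. -/
structure Hom (A B : SquareRing.{u}) where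
  e : A.e → B.e
  ee : A.ee →+ B.ee
  map_add : ∀ x y, e (x + y) = e x + e y
  map_one : e 1 = 1
  map_mul : ∀ x y, e (x * y) = e x * e y
  map_P : ∀ a, e (A.P a) = B.P (ee a)
  map_H : ∀ x, ee (A.H x) = B.H (e x)
  map_act : ∀ x y a z, ee (A.act x y a z) = B.act (e x) (e y) (ee a) (e z)

/-- A ring, viewed as a square ring with trivial `ee`. -/
def ofRing (R : Type u) [Ring R] : SquareRing.{u} where
  e := R
  ee := PUnit
  P := 0
  H _ := 0
  cross_add_left _ _ _ := rfl
  cross_add_right _ _ _ := rfl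
  cross_P_left _ _ := rfl
  P_cross x y := show (0 : R) = -x - y + x + y by abel
  P_H_P _ := show (0 : R) = 0 + 0 by simp
  act _ _ _ _ := 0
  act_add_fst _ _ _ _ _ := rfl
  act_add_snd _ _ _ _ _ := rfl
  act_add_mid _ _ _ _ _ := rfl
  act_add_right _ _ _ _ _ := rfl
  act_P_fst _ _ _ _ := rfl
  act_P_snd _ _ _ _ := rfl
  act_P_right _ _ _ _ := rfl
  act_one _ := rfl
  act_act _ _ _ _ _ _ _ := rfl
  mul_add x y z := _root_.mul_add (R := R) x y z
  add_mul x y z := show (x + y) * z = x * z + y * z + (0 : R) by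
    rw [_root_.add_mul (R := R), add_zero]
  cross_eq _ _ := rfl
  T_act _ _ _ _ := rfl
  P_act _ x := show (0 : R) = 0 * x by simp
  P_act_diag x _ := show (0 : R) = x * 0 by simp
  H_mul _ _ := rfl

namespace Hom

variable {A B : SquareRing.{u}} (φ : Hom A B)

theorem map_zero : φ.e 0 = 0 := by simpa using φ.map_add 0 0

theorem map_H_two : φ.ee (A.H (1 + 1)) = B.H (1 + 1) := by
  rw [φ.map_H, φ.map_add, φ.map_one]

theorem map_T (a : A.ee) : φ.ee (A.T a) = B.T (φ.ee a) := by
  rw [A.T_eq, B.T_eq, _root_.map_sub, φ.map_H, φ.map_P]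

end Hom

end SquareRing

namespace FreeMod

variable {A B : SquareRing.{u}} (φ : A.Hom B) {n : ℕ}

/-- The map of free modules induced by a morphism of square rings. -/
def map (v : FreeMod A n) : FreeMod B n := ⟨fun i => φ.e (v.e i), fun i j h => φ.ee (v.ee i j h)⟩

theorem map_lift {m : ℕ} (f : Fin m → FreeMod A n) (g : FreeMod A m) :
    (RightModule.lift f g).map φ = RightModule.lift (fun k => (f k).map φ) (g.map φ) := by
  have h0 : (0 : FreeMod A n).map φ = 0 :=
    ext' (fun i => φ.map_zero) (fun i j h => φ.ee.map_zero)
  have ha : ∀ v w : FreeMod A n, (v + w).map φ = v.map φ + w.map φ := fun v w =>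
    ext' (fun i => φ.map_add _ _) (fun i j h => by
      simp [map, φ.map_act, φ.map_H_two, φ.map_one])
  unfold RightModule.lift
  rw [ha, map_osum (map φ) h0 ha, RightModule.map_psum (map φ) h0 ha]
  congr 2
  · funext k
    exact ext' (fun i => φ.map_mul _ _) (fun i j h => by
      simp [map, RightModule.sm, scalar, φ.map_act, φ.map_H, φ.map_one])
  · funext k l h
    exact ext' (fun i => by simp [map, RightModule.br, bracket, φ.map_P, φ.map_act, φ.map_one])
      (fun i j h => by
        simp [map, RightModule.br, bracket, φ.map_act, φ.map_T, φ.map_one])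

theorem map_gen (i : Fin n) : (gen A i).map φ = gen B i :=
  ext' (fun j => by simp only [map, gen]; split_ifs <;> simp [φ.map_one, φ.map_zero])
    (fun _ _ _ => φ.ee.map_zero)

end FreeMod

/-- The category of finitely generated free right modules over a square ring `Q`. Its objects are
the natural numbers (the ranks). A morphism from `y` to `x` is a homomorphism from the free module
of rank `y` to the free module of rank `x`, given by the images `f k` of the generators, that is by
elements `(f k).e i` of `Q.e` for all `i` and elements `(f k).ee i j` of `Q.ee` for `i < j`. -/
structure ModSq (Q : SquareRing.{u}) : Type where
  rank : ℕ

instance (Q : SquareRing.{u}) : Category.{u, 0} (ModSq Q) where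
  Hom y x := Fin y.rank → FreeMod Q x.rank
  id _ := FreeMod.gen Q
  comp f g := fun k => RightModule.lift g (f k)
  id_comp f := funext fun k => FreeMod.lift_gen f k
  comp_id f := funext fun k => FreeMod.gen_lift (f k)
  assoc f g h := funext fun k => RightModule.lift_lift h g (f k)

/-- The category of finitely generated free right modules over a ring `R`. Its objects are the
natural numbers, a morphism from `y` to `x` is an `x × y`-matrix with entries in `R`. -/
structure ModRing (R : Type u) : Type where
  rank : ℕ

instance (R : Type u) [Ring R] : Category.{u, 0} (ModRing R) where
  Hom y x := Matrix (Fin x.rank) (Fin y.rank) R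
  id _ := 1
  comp f g := g * f
  id_comp f := Matrix.mul_one f
  comp_id f := Matrix.one_mul f
  assoc f g h := (Matrix.mul_assoc h g f).symm

/-- The functor `mod-Q ⥤ mod-R` induced by a morphism of square rings `p : Q → R`. It is the
identity on objects, and sends `(f_i^k, f_{ij}^k)` to the matrix `(p (f_i^k))`. -/
def ModSq.toRing {Q : SquareRing.{u}} {R : Type u} [Ring R]
    (p : Q.Hom (SquareRing.ofRing R)) : ModSq Q ⥤ ModRing R where
  obj y := ⟨y.rank⟩
  map {y x} f := show Matrix (Fin x.rank) (Fin y.rank) R from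
    Matrix.of fun i k => p.e ((f k).e i)
  map_id y := by
    refine Matrix.ext fun i k => ?_
    change p.e (if i = k then 1 else 0) = (1 : Matrix (Fin y.rank) (Fin y.rank) R) i k
    rw [Matrix.one_apply]
    split_ifs
    · exact p.map_one
    · exact p.map_zero
  map_comp {z y x} f g := by
    refine Matrix.ext fun i k => ?_
    change p.e ((RightModule.lift g (f k)).e i) =
      ∑ j, (show R from p.e ((g j).e i)) * (show R from p.e ((f k).e j))
    rw [FreeMod.lift_e, p.map_add, p.map_P, map_osum p.e p.map_zero p.map_add]
    have h : osum (fun j => p.e ((g j).e i * (f k).e j)) =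
        osum (G := R) (fun j => (show R from p.e ((g j).e i)) * (show R from p.e ((f k).e j))) :=
      congrArg osum (funext fun j => p.map_mul _ _)
    rw [h]
    exact (add_zero (M := R) _).trans (osum_eq_sum (G := R) _)

section DM

variable (R M : Type u) [Ring R] [AddCommGroup M] [Module R M] [Module Rᵐᵒᵖ M]
  [SMulCommClass R Rᵐᵒᵖ M]

/-- The bifunctor `D_M (y, x) = Hom_R (y, x ⊗_R M)` on `mod-R`. As `x` stands for `R^x` and `y` for
`R^y`, this is the group of right `R`-linear maps from `R^y` to `R^x ⊗_R M = M^x`, that is, the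
group of `x × y`-matrices with entries in `M`. Morphisms of `mod-R` act by multiplication of
matrices from the left and from the right. -/
def matBifunctor : (ModRing R)ᵒᵖ ⥤ ModRing R ⥤ AddCommGrpCat.{u} where
  obj y :=
    { obj := fun x => AddCommGrpCat.of (Matrix (Fin x.rank) (Fin y.unop.rank) M)
      map := fun {x x'} f => AddCommGrpCat.ofHom
        { toFun := fun m => Matrix.of fun i k =>
            ∑ j, (f : Matrix (Fin x'.rank) (Fin x.rank) R) i j • m j k
          map_zero' := by ext; simp
          map_add' := fun m m' => by ext; simp [Finset.sum_add_distrib] }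
      map_id := fun x => by
        ext m i k
        change ∑ j, (1 : Matrix (Fin x.rank) (Fin x.rank) R) i j • m j k = m i k
        simp [Matrix.one_apply]
      map_comp := fun {x x' x''} f g => by
        ext m i k
        change ∑ j, (∑ l, g i l * f l j) • m j k = ∑ l, g i l • ∑ j, f l j • m j k
        simp only [Finset.sum_smul, Finset.smul_sum, mul_smul]
        exact Finset.sum_comm }
  map {y y'} g :=
    { app := fun x => AddCommGrpCat.ofHom
        { toFun := fun m => Matrix.of fun i k =>
            ∑ j, MulOpposite.op
              ((g.unop : Matrix (Fin y.unop.rank) (Fin y'.unop.rank) R) j k) • m i j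
          map_zero' := by ext; simp
          map_add' := fun m m' => by ext; simp [Finset.sum_add_distrib] }
      naturality := fun x x' f => by
        ext m i k
        change ∑ j, MulOpposite.op (g.unop j k) • ∑ l, f i l • m l j =
          ∑ l, f i l • ∑ j, MulOpposite.op (g.unop j k) • m l j
        simp only [Finset.smul_sum]
        rw [Finset.sum_comm]
        exact Finset.sum_congr rfl fun _ _ => Finset.sum_congr rfl fun _ _ =>
          (smul_comm _ _ _).symm }
  map_id y := by
    ext x m i k
    change ∑ j, MulOpposite.op ((1 : Matrix (Fin y.unop.rank) (Fin y.unop.rank) R) j k) • m i j =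
      m i k
    simp [Matrix.one_apply, apply_ite MulOpposite.op, ite_smul]
  map_comp {y y' y''} g h := by
    ext x m i k
    change ∑ j, MulOpposite.op (∑ l, g.unop j l * h.unop l k) • m i j =
      ∑ l, MulOpposite.op (h.unop l k) • ∑ j, MulOpposite.op (g.unop j l) • m i j
    simp only [Finset.op_sum, Finset.sum_smul, Finset.smul_sum, MulOpposite.op_mul, mul_smul]
    exact Finset.sum_comm

end DM

namespace BWCoh

universe v w

variable {C : Type w} [Category.{v} C] (D : Cᵒᵖ ⥤ C ⥤ AddCommGrpCat.{u})

/-- The value `D (a, b)` of a bifunctor. -/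
abbrev Coef (a b : C) : Type u := (D.obj (Opposite.op a)).obj b

/-- The induced map `g_* : D (a, b) → D (a, b')`. -/
def push {a b b' : C} (g : b ⟶ b') : Coef D a b →+ Coef D a b' :=
  ((D.obj (Opposite.op a)).map g).hom

/-- The induced map `f^* : D (a, b) → D (a', b)`. -/
def pull {a' a b : C} (f : a' ⟶ a) : Coef D a b →+ Coef D a' b :=
  ((D.map f.op).app b).hom

/-- The groups of cochains of degrees `1`, `2`, `3` of the Baues-Wirsching complex of a category
with coefficients in a bifunctor: functions on chains of `n` composable morphisms, with values in
`D (source of the composite, target of the composite)`. -/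
abbrev Cochain1 : Type _ := ∀ a b : C, (a ⟶ b) → Coef D a b

/-- Cochains of degree `2`. -/
abbrev Cochain2 : Type _ := ∀ a b c : C, (a ⟶ b) → (b ⟶ c) → Coef D a c

/-- Cochains of degree `3`. -/
abbrev Cochain3 : Type _ := ∀ a b c d : C, (a ⟶ b) → (b ⟶ c) → (c ⟶ d) → Coef D a d

/-- The coboundary map in degree `1`. -/
def d1 : Cochain1 D →+ Cochain2 D where
  toFun t a b c f g := push D g (t a b f) - t a c (f ≫ g) + pull D f (t b c g)
  map_zero' := by funext a b c f g; simp
  map_add' t t' := by funext a b c f g; simp; abel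

/-- The coboundary map in degree `2`. -/
def d2 : Cochain2 D →+ Cochain3 D where
  toFun t a b c d f g h := push D h (t a b c f g) - t a b d f (g ≫ h) + t a c d (f ≫ g) h -
    pull D f (t b c d g h)
  map_zero' := by funext a b c d f g h; simp
  map_add' t t' := by funext a b c d f g h; simp; abel

variable {K : Type w} [Category.{v} K] (p : K ⥤ C)

/-- The bifunctor on `K` induced by a bifunctor on `C` along a functor `p : K ⥤ C`. -/
abbrev res : Kᵒᵖ ⥤ K ⥤ AddCommGrpCat.{u} :=
  p.op ⋙ D ⋙ (Functor.whiskeringLeft K C AddCommGrpCat.{u}).obj p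

/-- The map of cochain complexes induced by `p : K ⥤ C`, in degree `1`. -/
def res1 : Cochain1 D →+ Cochain1 (res D p) where
  toFun t a b f := t (p.obj a) (p.obj b) (p.map f)
  map_zero' := rfl
  map_add' _ _ := rfl

/-- The map of cochain complexes induced by `p : K ⥤ C`, in degree `2`. -/
def res2 : Cochain2 D →+ Cochain2 (res D p) where
  toFun t a b c f g := t (p.obj a) (p.obj b) (p.obj c) (p.map f) (p.map g)
  map_zero' := rfl
  map_add' _ _ := rfl

/-- The map of cochain complexes induced by `p : K ⥤ C`, in degree `3`. -/
def res3 : Cochain3 D →+ Cochain3 (res D p) where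
  toFun t a b c d f g h :=
    t (p.obj a) (p.obj b) (p.obj c) (p.obj d) (p.map f) (p.map g) (p.map h)
  map_zero' := rfl
  map_add' _ _ := rfl

theorem d1_res1 (t : Cochain1 D) : d1 (res D p) (res1 D p t) = res2 D p (d1 D t) := by
  funext a b c f g
  change push D (p.map g) (t _ _ (p.map f)) - t _ _ (p.map (f ≫ g)) +
    pull D (p.map f) (t _ _ (p.map g)) = _
  rw [p.map_comp]; rfl

theorem d2_res2 (t : Cochain2 D) : d2 (res D p) (res2 D p t) = res3 D p (d2 D t) := by
  funext a b c d f g h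
  change push D (p.map h) (t _ _ _ (p.map f) (p.map g)) - t _ _ _ (p.map f) (p.map (g ≫ h)) +
    t _ _ _ (p.map (f ≫ g)) (p.map h) - pull D (p.map f) (t _ _ _ (p.map g) (p.map h)) = _
  rw [p.map_comp, p.map_comp]; rfl

/-- The relative cochain complex in degree `1`, the cokernel of `F^1 (C, D) → F^1 (K, D)`. -/
abbrev Rel1 : Type _ := Cochain1 (res D p) ⧸ (res1 D p).range

/-- The relative cochain complex in degree `2`, the cokernel of `F^2 (C, D) → F^2 (K, D)`. -/
abbrev Rel2 : Type _ := Cochain2 (res D p) ⧸ (res2 D p).range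

/-- The relative cochain complex in degree `3`, the cokernel of `F^3 (C, D) → F^3 (K, D)`. -/
abbrev Rel3 : Type _ := Cochain3 (res D p) ⧸ (res3 D p).range

/-- The coboundary map of the relative complex in degree `1`. -/
def rd1 : Rel1 D p →+ Rel2 D p :=
  QuotientAddGroup.map _ _ (d1 (res D p)) (by
    rintro _ ⟨t, rfl⟩; exact ⟨d1 D t, (d1_res1 D p t).symm⟩)

/-- The coboundary map of the relative complex in degree `2`. -/
def rd2 : Rel2 D p →+ Rel3 D p :=
  QuotientAddGroup.map _ _ (d2 (res D p)) (by
    rintro _ ⟨t, rfl⟩; exact ⟨d2 D t, (d2_res2 D p t).symm⟩)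

/-- The third relative cohomology `H^3 (C, K; D)`: the cohomology in degree `2` of the cokernel of
`F^* (C, D) → F^* (K, D)`. -/
abbrev RelH3 : Type _ := (rd2 D p).ker ⧸ (rd1 D p).range.addSubgroupOf (rd2 D p).ker

end BWCoh

/-- A crossed square ring `C` with `C_(0) = Q`. Its quadratic pair module consists of the group `C1`,
of `C_0 = Q.e`, `C_ee = Q.ee`, `P : C_ee → C1`, `d : C1 → C_0` and `H = Q.H`, with `d P = Q.P`;
those axioms of a quadratic pair module that do not involve `C1` are axioms of `Q`. The two-sided
action of `C_0` on `C1` is written `l x r` for `x r` and `rr r x` for `r x`. -/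
structure CrossedSquareRing (Q : SquareRing.{u}) where
  C1 : Type u
  [addGroup : AddGroup C1]
  P : Q.ee →+ C1
  d : C1 →+ Q.e
  d_P : ∀ a, d (P a) = Q.P a
  P_H_d_P : ∀ a, P (Q.H (d (P a))) = P a + P a
  P_H_add : ∀ r s, P (Q.H (d r + d s)) = P (Q.H (d r)) + P (Q.H (d s)) + (-r - s + r + s)
  l : Q.e → C1 → C1
  rr : C1 → Q.e → C1
  one_l : ∀ r, l 1 r = r
  mul_l : ∀ x y r, l (x * y) r = l x (l y r)
  rr_one : ∀ r, rr r 1 = r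
  rr_mul : ∀ r x y, rr r (x * y) = rr (rr r x) y
  l_rr : ∀ x r y, l x (rr r y) = rr (l x r) y
  P_act : ∀ x a y, P (Q.act x x a y) = rr (l x (P a)) y
  d_l_rr : ∀ x r y, d (rr (l x r) y) = x * d r * y
  d_l : ∀ r s, l (d r) s = rr r (d s)
  l_add : ∀ x r s, l x (r + s) = l x r + l x s
  rr_add : ∀ r x y, rr r (x + y) = rr r x + rr r y
  add_l : ∀ x y r, l (x + y) r = l x r + l y r + P (Q.act x y (Q.H (d r)) 1)
  add_rr : ∀ r s x, rr (r + s) x = rr r x + rr s x + P (Q.act (d r) (d s) (Q.H x) 1)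

attribute [instance] CrossedSquareRing.addGroup

namespace CrossedSquareRing

variable {Q : SquareRing.{u}} (E : CrossedSquareRing Q)

theorem l_P (x : Q.e) (a : Q.ee) : E.l x (E.P a) = E.P (Q.act x x a 1) := by
  rw [E.P_act, E.rr_one]

theorem rr_P (x : Q.e) (a : Q.ee) : E.rr (E.P a) x = E.P (Q.act 1 1 a x) := by
  rw [E.P_act, E.one_l]

theorem d_l' (x : Q.e) (r : E.C1) : E.d (E.l x r) = x * E.d r := by
  rw [← E.rr_one (E.l x r), E.d_l_rr, mul_one]

theorem d_rr' (x : Q.e) (r : E.C1) : E.d (E.rr r x) = E.d r * x := by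
  rw [← E.one_l r, E.d_l_rr, one_mul, E.one_l]

theorem l_zero (x : Q.e) : E.l x 0 = 0 := by simpa using E.l_add x 0 0

theorem rr_zero (r : E.C1) : E.rr r 0 = 0 := by simpa using E.rr_add r 0 0

theorem zero_l (r : E.C1) : E.l 0 r = 0 := by simpa using E.add_l 0 0 r

theorem zero_rr (x : Q.e) : E.rr 0 x = 0 := by simpa using E.add_rr 0 0 x

/-- `B u v = (u ⊗ v) · H 2`, the cross effect of `v` and `u`. -/
def B (Q : SquareRing.{u}) (u v : Q.e) : Q.ee := Q.act u v (Q.H (1 + 1)) 1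

theorem B_add_left (u u' v : Q.e) : B Q (u + u') v = B Q u v + B Q u' v := Q.act_add_fst _ _ _ _ _
theorem B_add_right (u v v' : Q.e) : B Q u (v + v') = B Q u v + B Q u v' := Q.act_add_snd _ _ _ _ _
theorem B_P_left (a : Q.ee) (v : Q.e) : B Q (Q.P a) v = 0 := Q.act_P_fst _ _ _ _
theorem B_P_right (a : Q.ee) (v : Q.e) : B Q v (Q.P a) = 0 := Q.act_P_snd _ _ _ _
theorem act_B (x y u v : Q.e) : Q.act x y (B Q u v) 1 = B Q (x * u) (y * v) := by
  unfold B; rw [Q.act_act, one_mul]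
theorem H_add' (x y : Q.e) : Q.H (x + y) = Q.H x + Q.H y + B Q y x := Q.H_add x y
theorem T_B (u v : Q.e) : Q.T (B Q u v) = - B Q v u := Q.T_cross u v
theorem B_zero_left (v : Q.e) : B Q 0 v = 0 := Q.act_zero_fst _ _ _
theorem B_zero_right (v : Q.e) : B Q v 0 = 0 := Q.act_zero_snd _ _ _
theorem B_neg_right (u v : Q.e) : B Q u (-v) = - B Q u v := Q.act_neg_snd _ _ _ _

theorem P_T (a : Q.ee) : E.P (Q.T a) = E.P a := by
  rw [Q.T_eq, ← E.d_P, map_sub, E.P_H_d_P]; simp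

theorem P_of_T {a b : Q.ee} (c : Q.ee) (h : a = b + (Q.T c - c)) : E.P a = E.P b := by
  rw [h, map_add, map_sub, P_T, sub_self, add_zero]

/-- `r + s = s + r + P (s ∣ r)`-type rule for exchanging two summands. -/
theorem swap (r s : E.C1) : r + s = s + r + E.P (B Q (E.d s) (E.d r)) := by
  have h := E.P_H_add r s
  rw [H_add', map_add, map_add] at h
  rw [add_left_cancel h]
  simp [sub_eq_add_neg, add_assoc]

theorem P_comm (a : Q.ee) (r : E.C1) : E.P a + r = r + E.P a := by
  rw [E.swap, E.d_P, B_P_right, map_zero, add_zero]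

/-- The sum `r + P a`, where `P a` is central. -/
def pr (r : E.C1) (a : Q.ee) : E.C1 := r + E.P a

theorem pr_zero (r : E.C1) : E.pr r 0 = r := by simp [pr]
theorem add_P (r : E.C1) (a : Q.ee) : r + E.P a = E.pr r a := rfl
theorem P_eq (a : Q.ee) : E.P a = E.pr 0 a := (zero_add _).symm
theorem pr_add (r s : E.C1) (a : Q.ee) : E.pr r a + s = E.pr (r + s) a := by
  rw [pr, pr, add_assoc, P_comm, add_assoc]
theorem add_pr (r s : E.C1) (a : Q.ee) : r + E.pr s a = E.pr (r + s) a :=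
  (add_assoc _ _ _).symm
theorem pr_pr (r : E.C1) (a b : Q.ee) : E.pr (E.pr r a) b = E.pr r (a + b) := by
  rw [pr, pr, pr, add_assoc, map_add]
theorem swap' (r s : E.C1) : r + s = E.pr (s + r) (B Q (E.d s) (E.d r)) := E.swap r s
theorem swap4 (r s t v : E.C1) :
    r + s + (t + v) = E.pr (r + t + (s + v)) (B Q (E.d t) (E.d s)) := by
  rw [add_assoc, ← add_assoc s, E.swap' s t, pr_add, add_pr]
  simp only [add_assoc]
theorem d_pr (r : E.C1) (a : Q.ee) : E.d (E.pr r a) = E.d r + Q.P a := by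
  rw [pr, map_add, E.d_P]
theorem l_pr (x : Q.e) (r : E.C1) (a : Q.ee) :
    E.l x (E.pr r a) = E.pr (E.l x r) (Q.act x x a 1) := by
  rw [pr, E.l_add, l_P]; rfl
theorem rr_pr (x : Q.e) (r : E.C1) (a : Q.ee) :
    E.rr (E.pr r a) x = E.pr (E.rr r x) (Q.act 1 1 a x) := by
  rw [pr, E.add_rr, rr_P, E.d_P, Q.act_P_snd, map_zero, add_zero]; rfl
theorem rr_add' (r s : E.C1) (x : Q.e) : E.rr (r + s) x =
    E.pr (E.rr r x + E.rr s x) (Q.act (E.d r) (E.d s) (Q.H x) 1) := E.add_rr r s x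
theorem add_l' (x y : Q.e) (r : E.C1) : E.l (x + y) r =
    E.pr (E.l x r + E.l y r) (Q.act x y (Q.H (E.d r)) 1) := E.add_l x y r
theorem pr_congr (r : E.C1) {a b : Q.ee} (h : a = b) : E.pr r a = E.pr r b := by rw [h]
theorem pr_of_T (r : E.C1) {a b : Q.ee} (c : Q.ee) (h : a = b + (Q.T c - c)) :
    E.pr r a = E.pr r b := by
  rw [pr, pr, E.P_of_T c h]

/-- The tracks between elements of `Q.e` given by a crossed square ring `C`: a pair `(r, x)` is the
element `r` of `C1`, viewed as a track from `d r + x` to `x`. -/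
@[ext] structure Tr : Type u where
  r : E.C1
  x : Q.e

namespace Tr

variable {E}

/-- The source of a track; its target is `X.x`. -/
def src (X : Tr E) : Q.e := E.d X.r + X.x

instance : Zero (Tr E) := ⟨⟨0, 0⟩⟩
instance : One (Tr E) := ⟨⟨0, 1⟩⟩
/-- The pointwise sum of the source and of the target tracks. -/
instance : Add (Tr E) := ⟨fun X Y => ⟨X.r + Y.r + E.P (B Q (E.d Y.r) X.x), X.x + Y.x⟩⟩
instance : Neg (Tr E) := ⟨fun X => ⟨-X.r + E.P (B Q (E.d X.r) X.x), -X.x⟩⟩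
instance : Mul (Tr E) := ⟨fun X Y =>
  ⟨E.rr X.r Y.src + E.l X.x Y.r + E.P (Q.act (E.d X.r) X.x (Q.H Y.src) 1), X.x * Y.x⟩⟩

theorem add_r (X Y : Tr E) : (X + Y).r = E.pr (X.r + Y.r) (B Q (E.d Y.r) X.x) := rfl
theorem add_x (X Y : Tr E) : (X + Y).x = X.x + Y.x := rfl
theorem neg_r (X : Tr E) : (-X).r = E.pr (-X.r) (B Q (E.d X.r) X.x) := rfl
theorem neg_x (X : Tr E) : (-X).x = -X.x := rfl
theorem mul_r (X Y : Tr E) : (X * Y).r = E.pr (E.rr X.r Y.src + E.l X.x Y.r)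
  (Q.act (E.d X.r) X.x (Q.H Y.src) 1) := rfl
theorem mul_x (X Y : Tr E) : (X * Y).x = X.x * Y.x := rfl
theorem zero_r : (0 : Tr E).r = 0 := rfl
theorem zero_x : (0 : Tr E).x = 0 := rfl
theorem one_r : (1 : Tr E).r = 0 := rfl
theorem one_x : (1 : Tr E).x = 1 := rfl

theorem src_add (X Y : Tr E) : (X + Y).src = X.src + Y.src := by
  simp only [src, add_r, add_x, map_add, E.d_pr]
  have h := Q.add_swap X.x (E.d Y.r)
  change _ = _ + Q.P (B Q _ _) at h
  simp only [add_assoc]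
  rw [← add_assoc X.x, h, Q.P_central]
  simp only [add_assoc]
  rw [Q.P_central, ← add_assoc (X.x), ← Q.P_central]
theorem src_zero : (0 : Tr E).src = 0 := by simp [src, zero_r, zero_x]
theorem src_one : (1 : Tr E).src = 1 := by simp [src, one_r, one_x]
theorem src_mul (X Y : Tr E) : (X * Y).src = X.src * Y.src := by
  have h : X.src * Y.src = E.d X.r * Y.src + X.x * Y.src +
    Q.P (Q.act (E.d X.r) X.x (Q.H Y.src) 1) := Q.add_mul _ _ _
  rw [h]
  conv_lhs => rw [src]
  simp only [mul_r, mul_x, map_add, E.d_pr, E.d_l', E.d_rr']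
  have h2 : X.x * Y.src = X.x * E.d Y.r + X.x * Y.x := Q.mul_add _ _ _
  rw [h2]
  simp only [add_assoc]
  rw [Q.P_central]

instance : AddGroup (Tr E) := AddGroup.ofLeftAxioms
  (fun X Y Z => by
    ext
    · simp only [add_r, add_x, map_add, E.d_pr, E.pr_add, E.add_pr, E.pr_pr, B_add_left,
        B_add_right, B_P_left, add_assoc]
      exact E.pr_congr _ (by abel)
    · simp only [add_x, add_assoc])
  (fun X => by
    ext
    · simp [add_r, zero_r, zero_x, B_zero_right, pr_zero]
    · simp [add_x, zero_x])
  (fun X => by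
    ext
    · simp only [add_r, neg_r, neg_x, E.pr_add, E.pr_pr, zero_r, B_neg_right]
      simp [pr_zero]
    · simp [add_x, neg_x, zero_x])

theorem d_mul_r (X Y : Tr E) : E.d (X * Y).r = E.d X.r * Y.src + X.x * E.d Y.r +
    Q.P (Q.act (E.d X.r) X.x (Q.H Y.src) 1) := by
  simp only [mul_r, map_add, E.d_pr, E.d_l', E.d_rr']

instance : Monoid (Tr E) where
  mul_assoc X Y Z := by
    ext
    · have hY : ∀ u v : Q.e, Q.act u (v * Y.src) (Q.H Z.src) 1 =
          Q.act u (v * E.d Y.r) (Q.H Z.src) 1 + Q.act u (v * Y.x) (Q.H Z.src) 1 := by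
        intro u v
        rw [← Q.act_add_snd, ← Q.mul_add]; rfl
      rw [mul_r (X * Y), d_mul_r, mul_r X (Y * Z), src_mul, mul_x, mul_r X Y, mul_r Y Z]
      simp only [E.rr_pr, E.rr_add', E.l_pr, E.l_add, E.mul_l, E.rr_mul, E.l_rr, E.pr_add,
        E.add_pr, E.pr_pr, E.d_l', E.d_rr', Q.H_mul Y.src, Q.act_add_fst,
        Q.act_add_mid, Q.act_P_fst, Q.act_act, one_mul, mul_one, add_assoc, hY, add_zero]
      exact E.pr_congr _ (by abel)
    · exact mul_assoc _ _ _
  one_mul X := by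
    ext
    · simp [mul_r, one_r, one_x, E.zero_rr, E.one_l, pr_zero]
    · exact one_mul _
  mul_one X := by
    ext
    · simp [mul_r, one_r, src_one, E.l_zero, E.rr_one, pr_zero]
    · exact mul_one _

/-- The map `P` of the square ring of tracks. -/
def ofP (E : CrossedSquareRing Q) : Q.ee × Q.ee →+ Tr E where
  toFun a := ⟨E.P (a.1 - a.2), Q.P a.2⟩
  map_zero' := by ext <;> simp [zero_r, zero_x]
  map_add' a b := by
    ext
    · simp only [add_r, E.d_P, B_P_left, pr_zero, ← map_add]
      congr 1
      simp only [Prod.fst_add, Prod.snd_add]; abel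
    · simp [add_x]

theorem ofP_r (a : Q.ee × Q.ee) : (ofP E a).r = E.P (a.1 - a.2) := rfl
theorem ofP_x (a : Q.ee × Q.ee) : (ofP E a).x = Q.P a.2 := rfl
theorem src_ofP (a : Q.ee × Q.ee) : (ofP E a).src = Q.P a.1 := by
  rw [src, ofP_r, ofP_x, E.d_P, ← map_add]; simp

end Tr

/-- The square ring of tracks of a crossed square ring: it consists of the tracks between elements
of `Q.e` and of the pairs (source, target) of elements of `Q.ee`. -/
def trackRing : SquareRing.{u} where
  e := Tr E
  ee := Q.ee × Q.ee
  P := Tr.ofP E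
  H X := (Q.H X.src, Q.H X.x)
  cross_add_left X X' Y := by
    ext
    · simp only [Tr.src_add]; exact Q.cross_add_left _ _ _
    · exact Q.cross_add_left _ _ _
  cross_add_right X Y Y' := by
    ext
    · simp only [Tr.src_add]; exact Q.cross_add_right _ _ _
    · exact Q.cross_add_right _ _ _
  cross_P_left a Y := by
    ext
    · simp only [Tr.src_add, Tr.src_ofP]; exact Q.cross_P_left _ _
    · exact Q.cross_P_left _ _
  P_cross X Y := by
    have h : X + Y = Y + X + Tr.ofP E (Q.H (X + Y).src - Q.H Y.src - Q.H X.src,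
        Q.H (X + Y).x - Q.H Y.x - Q.H X.x) := by
      ext
      · simp only [Tr.add_r, Tr.add_x, Tr.ofP_r, Tr.src_add, H_add', E.add_P, E.d_P,
          E.pr_pr, B_P_left]
        rw [E.swap' X.r, E.pr_pr]
        refine E.pr_of_T _ (B Q Y.x (E.d X.r)) ?_
        rw [T_B]
        simp only [Tr.src, B_add_left, B_add_right]
        abel
      · simp only [Tr.add_x, Tr.ofP_x, H_add']
        rw [Q.add_swap]
        congr 2
        unfold B; abel
    calc _ = -(Y + X) + (Y + X + Tr.ofP E (Q.H (X + Y).src - Q.H Y.src - Q.H X.src,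
        Q.H (X + Y).x - Q.H Y.x - Q.H X.x)) := by rw [← add_assoc, neg_add_cancel, zero_add]; rfl
      _ = _ := by rw [← h]; simp [sub_eq_add_neg, add_assoc]
  P_H_P a := by
    have h : ∀ b c : Q.ee, Q.P b = Q.P c → E.P (Q.H (Q.P b)) = E.P c + E.P c := by
      intro b c hbc
      rw [hbc, ← E.d_P, E.P_H_d_P]
    ext
    · change E.P (Q.H (Tr.ofP E a).src - Q.H (Q.P a.2)) = E.P (a.1 - a.2) + E.P (a.1 - a.2) +
        E.P (B Q (E.d (E.P (a.1 - a.2))) (Q.P a.2))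
      rw [E.d_P, B_P_left, map_zero, add_zero, Tr.src_ofP, map_sub, h _ _ rfl, h _ _ rfl,
        ← map_add, ← map_add, ← map_add, ← map_sub]
      congr 1; abel
    · exact Q.P_H_P a.2
  act X Y a Z := (Q.act X.src Y.src a.1 Z.src, Q.act X.x Y.x a.2 Z.x)
  act_add_fst X X' Y a Z := by
    ext
    · simp only [Tr.src_add]; exact Q.act_add_fst _ _ _ _ _
    · exact Q.act_add_fst _ _ _ _ _
  act_add_snd X Y Y' a Z := by
    ext
    · simp only [Tr.src_add]; exact Q.act_add_snd _ _ _ _ _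
    · exact Q.act_add_snd _ _ _ _ _
  act_add_mid X Y a a' Z := by
    ext
    · exact Q.act_add_mid _ _ _ _ _
    · exact Q.act_add_mid _ _ _ _ _
  act_add_right X Y a Z Z' := by
    ext
    · simp only [Tr.src_add]; exact Q.act_add_right _ _ _ _ _
    · exact Q.act_add_right _ _ _ _ _
  act_P_fst b Y a Z := by
    ext
    · simp only [Tr.src_ofP]; exact Q.act_P_fst _ _ _ _
    · exact Q.act_P_fst _ _ _ _
  act_P_snd X b a Z := by
    ext
    · simp only [Tr.src_ofP]; exact Q.act_P_snd _ _ _ _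
    · exact Q.act_P_snd _ _ _ _
  act_P_right X Y a b := by
    ext
    · simp only [Tr.src_ofP]; exact Q.act_P_right _ _ _ _
    · exact Q.act_P_right _ _ _ _
  act_one a := by
    ext
    · simp only [Tr.src_one]; exact Q.act_one _
    · exact Q.act_one _
  act_act X Y X' Y' a Z' Z := by
    ext
    · simp only [Tr.src_mul]; exact Q.act_act _ _ _ _ _ _ _
    · exact Q.act_act _ _ _ _ _ _ _
  mul_add X Y Z := by
    ext
    · rw [Tr.mul_r, Tr.add_r (X * Y), Tr.d_mul_r, Tr.src_add, Tr.mul_x, Tr.mul_r, Tr.mul_r]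
      simp only [Tr.add_r, E.rr_add, E.l_pr, E.l_add, E.pr_add, E.add_pr, E.pr_pr, H_add',
        B_add_left, B_P_left, act_B, Q.act_add_mid]
      rw [E.swap4 (E.rr X.r Y.src), E.pr_pr, E.d_rr', E.d_l']
      refine E.pr_of_T _ (-B Q (X.x * E.d Y.r) (E.d X.r * Z.src)) ?_
      have hB : B Q (E.d X.r * Z.src) (X.x * Y.src) = B Q (E.d X.r * Z.src) (X.x * E.d Y.r) +
          B Q (E.d X.r * Z.src) (X.x * Y.x) := by
        rw [← B_add_right, ← Q.mul_add]; rfl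
      rw [hB, Q.T_neg, T_B]
      abel
    · exact Q.mul_add _ _ _
  add_mul X Y Z := by
    ext
    · rw [Tr.mul_r, Tr.add_r, Tr.add_r (X * Z + Y * Z), Tr.add_r (X * Z), Tr.d_mul_r,
        Tr.mul_x, Tr.mul_r, Tr.mul_r, Tr.ofP_r,
        E.d_P, B_P_left]
      simp only [E.rr_pr, E.rr_add', E.add_l', E.pr_add, E.add_pr, E.pr_pr,
        B_add_left, B_P_left, E.add_P, Tr.add_x,
        E.d_pr, map_add, Q.act_add_fst, Q.act_P_fst, Q.act_add_snd]
      rw [E.swap4 (E.rr X.r Z.src), E.pr_pr, E.d_rr', E.d_l']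
      refine E.pr_of_T _ (-B Q (X.x * E.d Z.r) (E.d Y.r * Z.src) +
        B Q (X.x * Z.x) (Y.x * E.d Z.r) + Q.act X.x (E.d Y.r) (Q.H Z.src) 1) ?_
      have h1 : Q.act 1 1 (B Q (E.d Y.r) X.x) Z.src = B Q (E.d Y.r * Z.src) (X.x * Z.src) +
          (Q.act (E.d Y.r) X.x (Q.T (Q.H Z.src)) 1 - Q.act (E.d Y.r) X.x (Q.H Z.src) 1) := by
        unfold B
        rw [Q.act_act, one_mul, one_mul, one_mul, FreeMod.act_eq _ _ _ Z.src, Q.two_act,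
          Q.act_sub_mid, Q.act_add_mid, Q.act_act, one_mul]
        abel
      have h2 : B Q (E.d Y.r * Z.src) (X.x * Z.src) = B Q (E.d Y.r * Z.src) (X.x * E.d Z.r) +
          B Q (E.d Y.r * Z.src) (X.x * Z.x) := by
        rw [← B_add_right, ← Q.mul_add]; rfl
      have h3 : Q.act X.x Y.x (Q.H Z.src) 1 = Q.act X.x Y.x (Q.H (E.d Z.r)) 1 +
          Q.act X.x Y.x (Q.H Z.x) 1 + B Q (X.x * Z.x) (Y.x * E.d Z.r) := by
        rw [← act_B, ← Q.act_add_mid, ← Q.act_add_mid, ← H_add']; rfl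
      have h4 : Q.act X.src Y.src (Q.H Z.src) (1 : Tr E).src =
          Q.act (E.d X.r) (E.d Y.r) (Q.H Z.src) 1 + Q.act (E.d X.r) Y.x (Q.H Z.src) 1 +
          Q.act X.x (E.d Y.r) (Q.H Z.src) 1 + Q.act X.x Y.x (Q.H Z.src) 1 := by
        rw [Tr.src_one]
        simp only [Tr.src, Q.act_add_fst, Q.act_add_snd]
        abel
      rw [h1, h2, h4, h3, Q.T_add, Q.T_add, Q.T_neg, T_B, T_B, Q.T_act', Tr.one_x]
      abel
    · exact Q.add_mul _ _ _
  cross_eq X Y := by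
    ext
    · simp only [Tr.src_add, Tr.src_one]; exact Q.cross_eq _ _
    · exact Q.cross_eq _ _
  T_act X Y a Z := by
    ext
    · simp only [Tr.src_ofP]; exact Q.T_act _ _ _ _
    · exact Q.T_act _ _ _ _
  P_act a X := by
    ext
    · simp only [Tr.ofP_r, Tr.ofP_x, Tr.mul_r, E.rr_P, E.d_P, Q.act_P_fst, pr_zero, Tr.src_one,
        Tr.one_x]
      rw [← E.d_P, E.d_l, rr_P, ← map_add]
      congr 1
      simp only [Tr.src, Q.act_add_right, Q.act_sub_mid]
      abel
    · exact Q.P_act _ _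
  P_act_diag X a := by
    ext
    · simp only [Tr.ofP_r, Tr.mul_r, E.l_P, Tr.src_ofP, Tr.src_one, Tr.one_x]
      rw [← E.d_P a.1, ← E.d_l, l_P, ← map_add, E.d_P, Q.H_P, P_eq, P_eq, pr_pr]
      refine E.pr_of_T _ (-Q.act X.x (E.d X.r) a.1 1) ?_
      rw [Q.T_neg, Q.T_act']
      simp only [Tr.src, Q.act_add_fst, Q.act_add_snd, Q.act_add_mid, Q.act_sub_mid]
      abel
    · exact Q.P_act_diag _ _
  H_mul X Y := by
    ext
    · simp only [Tr.src_mul, Tr.src_one]; exact Q.H_mul _ _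
    · exact Q.H_mul _ _

end CrossedSquareRing

namespace SquareRing

section FiberProduct

variable {A A' B : SquareRing.{u}} (φ : A.Hom B) (ψ : A'.Hom B)

/-- The additive group of pairs of elements with the same image. -/
def fiberSub : AddSubgroup (A.e × A'.e) where
  carrier := {q | φ.e q.1 = ψ.e q.2}
  zero_mem' := φ.map_zero.trans ψ.map_zero.symm
  add_mem' {q q'} h h' := by
    change φ.e (q.1 + q'.1) = ψ.e (q.2 + q'.2)
    rw [φ.map_add, ψ.map_add]; exact congrArg₂ _ h h'
  neg_mem' {q} h := by
    change φ.e (-q.1) = ψ.e (-q.2)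
    have h1 : φ.e (-q.1) + φ.e q.1 = 0 := by rw [← φ.map_add, neg_add_cancel, φ.map_zero]
    have h2 : ψ.e (-q.2) + ψ.e q.2 = 0 := by rw [← ψ.map_add, neg_add_cancel, ψ.map_zero]
    rw [eq_neg_of_add_eq_zero_left h1, eq_neg_of_add_eq_zero_left h2]
    exact congrArg _ h

/-- The multiplicative monoid of pairs of elements with the same image. -/
def fiberMonoid : Submonoid (A.e × A'.e) where
  carrier := {q | φ.e q.1 = ψ.e q.2}
  one_mem' := φ.map_one.trans ψ.map_one.symm
  mul_mem' {q q'} h h' := by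
    change φ.e (q.1 * q'.1) = ψ.e (q.2 * q'.2)
    rw [φ.map_mul, ψ.map_mul]; exact congrArg₂ _ h h'

/-- The fiber product of two square rings over a third one. -/
def fiberProd : SquareRing.{u} where
  e := fiberSub φ ψ
  monoid := inferInstanceAs (Monoid (fiberMonoid φ ψ))
  ee := (φ.ee.comp (AddMonoidHom.fst A.ee A'.ee)).eqLocus (ψ.ee.comp (AddMonoidHom.snd A.ee A'.ee))
  P :=
    { toFun := fun a => ⟨(A.P a.1.1, A'.P a.1.2),
        (φ.map_P _).trans ((congrArg B.P a.2).trans (ψ.map_P _).symm)⟩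
      map_zero' := Subtype.ext (Prod.ext A.P.map_zero A'.P.map_zero)
      map_add' := fun a b => Subtype.ext (Prod.ext (A.P.map_add _ _) (A'.P.map_add _ _)) }
  H x := ⟨(A.H x.1.1, A'.H x.1.2),
    (φ.map_H _).trans ((congrArg B.H x.2).trans (ψ.map_H _).symm)⟩
  cross_add_left x x' y :=
    Subtype.ext (Prod.ext (A.cross_add_left _ _ _) (A'.cross_add_left _ _ _))
  cross_add_right x y y' :=
    Subtype.ext (Prod.ext (A.cross_add_right _ _ _) (A'.cross_add_right _ _ _))
  cross_P_left a y := Subtype.ext (Prod.ext (A.cross_P_left _ _) (A'.cross_P_left _ _))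
  P_cross x y := Subtype.ext (Prod.ext (A.P_cross _ _) (A'.P_cross _ _))
  P_H_P a := Subtype.ext (Prod.ext (A.P_H_P _) (A'.P_H_P _))
  act x y a z := ⟨(A.act x.1.1 y.1.1 a.1.1 z.1.1, A'.act x.1.2 y.1.2 a.1.2 z.1.2), by
    change φ.ee (A.act x.1.1 y.1.1 a.1.1 z.1.1) = ψ.ee (A'.act x.1.2 y.1.2 a.1.2 z.1.2)
    rw [φ.map_act, ψ.map_act]
    have hx : φ.e x.1.1 = ψ.e x.1.2 := x.2
    have hy : φ.e y.1.1 = ψ.e y.1.2 := y.2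
    have hz : φ.e z.1.1 = ψ.e z.1.2 := z.2
    have ha : φ.ee a.1.1 = ψ.ee a.1.2 := a.2
    rw [hx, hy, hz, ha]⟩
  act_add_fst _ _ _ _ _ := Subtype.ext (Prod.ext (A.act_add_fst _ _ _ _ _) (A'.act_add_fst _ _ _ _ _))
  act_add_snd _ _ _ _ _ := Subtype.ext (Prod.ext (A.act_add_snd _ _ _ _ _) (A'.act_add_snd _ _ _ _ _))
  act_add_mid _ _ _ _ _ := Subtype.ext (Prod.ext (A.act_add_mid _ _ _ _ _) (A'.act_add_mid _ _ _ _ _))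
  act_add_right _ _ _ _ _ :=
    Subtype.ext (Prod.ext (A.act_add_right _ _ _ _ _) (A'.act_add_right _ _ _ _ _))
  act_P_fst _ _ _ _ := Subtype.ext (Prod.ext (A.act_P_fst _ _ _ _) (A'.act_P_fst _ _ _ _))
  act_P_snd _ _ _ _ := Subtype.ext (Prod.ext (A.act_P_snd _ _ _ _) (A'.act_P_snd _ _ _ _))
  act_P_right _ _ _ _ := Subtype.ext (Prod.ext (A.act_P_right _ _ _ _) (A'.act_P_right _ _ _ _))
  act_one _ := Subtype.ext (Prod.ext (A.act_one _) (A'.act_one _))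
  act_act _ _ _ _ _ _ _ :=
    Subtype.ext (Prod.ext (A.act_act _ _ _ _ _ _ _) (A'.act_act _ _ _ _ _ _ _))
  mul_add _ _ _ := Subtype.ext (Prod.ext (A.mul_add _ _ _) (A'.mul_add _ _ _))
  add_mul _ _ _ := Subtype.ext (Prod.ext (A.add_mul _ _ _) (A'.add_mul _ _ _))
  cross_eq _ _ := Subtype.ext (Prod.ext (A.cross_eq _ _) (A'.cross_eq _ _))
  T_act _ _ _ _ := Subtype.ext (Prod.ext (A.T_act _ _ _ _) (A'.T_act _ _ _ _))
  P_act _ _ := Subtype.ext (Prod.ext (A.P_act _ _) (A'.P_act _ _))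
  P_act_diag _ _ := Subtype.ext (Prod.ext (A.P_act_diag _ _) (A'.P_act_diag _ _))
  H_mul _ _ := Subtype.ext (Prod.ext (A.H_mul _ _) (A'.H_mul _ _))

/-- The first projection of a fiber product. -/
def fiberFst : (fiberProd φ ψ).Hom A where
  e x := x.1.1
  ee := ((AddMonoidHom.fst A.ee A'.ee).comp (AddSubgroup.subtype _))
  map_add _ _ := rfl
  map_one := rfl
  map_mul _ _ := rfl
  map_P _ := rfl
  map_H _ := rfl
  map_act _ _ _ _ := rfl

/-- The second projection of a fiber product. -/
def fiberSnd : (fiberProd φ ψ).Hom A' where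
  e x := x.1.2
  ee := ((AddMonoidHom.snd A.ee A'.ee).comp (AddSubgroup.subtype _))
  map_add _ _ := rfl
  map_one := rfl
  map_mul _ _ := rfl
  map_P _ := rfl
  map_H _ := rfl
  map_act _ _ _ _ := rfl

end FiberProduct

end SquareRing

namespace CrossedSquareRing

variable {Q : SquareRing.{u}} (E : CrossedSquareRing Q)

/-- The source of tracks. -/
def srcHom : E.trackRing.Hom Q where
  e X := X.src
  ee := AddMonoidHom.fst Q.ee Q.ee
  map_add X Y := Tr.src_add X Y
  map_one := Tr.src_one
  map_mul X Y := Tr.src_mul X Y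
  map_P a := Tr.src_ofP a
  map_H _ := rfl
  map_act _ _ _ _ := rfl

/-- The target of tracks. -/
def tgtHom : E.trackRing.Hom Q where
  e X := X.x
  ee := AddMonoidHom.snd Q.ee Q.ee
  map_add _ _ := rfl
  map_one := rfl
  map_mul _ _ := rfl
  map_P _ := rfl
  map_H _ := rfl
  map_act _ _ _ _ := rfl

/-- The identity tracks. -/
def zeroHom : Q.Hom E.trackRing where
  e x := ⟨0, x⟩
  ee := (AddMonoidHom.id Q.ee).prod (AddMonoidHom.id Q.ee)
  map_add x y := by
    refine Tr.ext ?_ rfl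
    change (0 : E.C1) = 0 + 0 + E.P (B Q (E.d 0) x)
    simp [B_zero_left]
  map_one := rfl
  map_mul x y := by
    refine Tr.ext ?_ rfl
    change (0 : E.C1) = E.rr 0 _ + E.l x 0 + E.P (Q.act (E.d 0) x _ 1)
    simp [E.zero_rr, E.l_zero]
  map_P a := by
    refine Tr.ext ?_ rfl
    change (0 : E.C1) = E.P (a - a)
    simp
  map_H x := by
    change (Q.H x, Q.H x) = (Q.H (E.d 0 + x), Q.H x)
    simp
  map_act x y a z := by
    change (Q.act x y a z, Q.act x y a z) =
      (Q.act (E.d 0 + x) (E.d 0 + y) a (E.d 0 + z), Q.act x y a z)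
    simp

/-- The square ring of composable pairs of tracks. -/
abbrev pairRing : SquareRing.{u} := SquareRing.fiberProd E.tgtHom E.srcHom

namespace Tr

variable {E}

/-- The vertical composite of a track `X` and a track `Y` that starts at the target of `X`. -/
def comp (X Y : Tr E) : Tr E := ⟨X.r + Y.r, Y.x⟩

theorem src_comp {X Y : Tr E} (h : X.x = Y.src) : (X.comp Y).src = X.src := by
  change E.d (X.r + Y.r) + Y.x = E.d X.r + X.x
  rw [h, map_add, add_assoc]; rfl

theorem src_inv (X : Tr E) : (⟨-X.r, X.src⟩ : Tr E).src = X.x := by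
  change E.d (-X.r) + (E.d X.r + X.x) = X.x
  rw [← add_assoc, ← map_add, neg_add_cancel, map_zero, zero_add]

theorem comp_add {X X' Y Y' : Tr E} (hX : X.x = X'.src) :
    (X + Y).comp (X' + Y') = X.comp X' + Y.comp Y' := by
  refine Tr.ext ?_ rfl
  change (X + Y).r + (X' + Y').r =
    X.r + X'.r + (Y.r + Y'.r) + E.P (B Q (E.d (Y.r + Y'.r)) X'.x)
  rw [E.swap4 X.r, add_r, add_r, map_add, hX, add_P]
  simp only [E.pr_add, E.add_pr, E.pr_pr, B_add_left, src, B_add_right]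
  exact E.pr_congr _ (by abel)

theorem comp_mul {X X' Y Y' : Tr E} (hX : X.x = X'.src) (hY : Y.x = Y'.src) :
    (X * Y).comp (X' * Y') = X.comp X' * Y.comp Y' := by
  refine Tr.ext ?_ rfl
  change (X * Y).r + (X' * Y').r = E.rr (X.r + X'.r) (Y.comp Y').src + E.l X'.x (Y.r + Y'.r) +
    E.P (Q.act (E.d (X.r + X'.r)) X'.x (Q.H (Y.comp Y').src) 1)
  have h0 : Y.src = E.d Y.r + Y'.src := by rw [← hY]; rfl
  have h1 : E.rr X'.r Y.src = E.rr X'.r (E.d Y.r) + E.rr X'.r Y'.src := by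
    rw [h0, E.rr_add]
  have h2 : E.l X'.src Y.r = E.pr (E.rr X'.r (E.d Y.r) + E.l X'.x Y.r)
      (Q.act (E.d X'.r) X'.x (Q.H (E.d Y.r)) 1) := by
    rw [← E.d_l, ← E.add_l']; rfl
  have h3 : Q.act (E.d X'.r) X'.x (Q.H Y.src) 1 = Q.act (E.d X'.r) X'.x (Q.H (E.d Y.r)) 1 +
      Q.act (E.d X'.r) X'.x (Q.H Y'.src) 1 + B Q (E.d X'.r * Y'.src) (X'.x * E.d Y.r) := by
    rw [← act_B, ← Q.act_add_mid, ← Q.act_add_mid, ← H_add', h0]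
  have h4 : Q.act (E.d X.r) X'.src (Q.H Y.src) 1 = Q.act (E.d X.r) (E.d X'.r) (Q.H Y.src) 1 +
      Q.act (E.d X.r) X'.x (Q.H Y.src) 1 := by
    rw [← Q.act_add_snd]; rfl
  rw [src_comp hY, mul_r, mul_r, hX, h2, h4, E.l_add, E.rr_add', h1, map_add, Q.act_add_fst, h3,
    add_P]
  simp only [E.pr_add, E.add_pr, E.pr_pr]
  have h5 : E.rr X.r Y.src + (E.rr X'.r (E.d Y.r) + E.l X'.x Y.r) +
      (E.rr X'.r Y'.src + E.l X'.x Y'.r) =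
      E.pr (E.rr X.r Y.src + (E.rr X'.r (E.d Y.r) + E.rr X'.r Y'.src) +
        (E.l X'.x Y.r + E.l X'.x Y'.r)) (B Q (E.d X'.r * Y'.src) (X'.x * E.d Y.r)) := by
    rw [← add_assoc (E.rr X.r Y.src), E.swap4 _ (E.l X'.x Y.r), E.d_rr', E.d_l']
    simp only [add_assoc]
  rw [h5, E.pr_pr]
  exact E.pr_congr _ (by abel)

end Tr

/-- The vertical composition of tracks. -/
def compHom : E.pairRing.Hom E.trackRing where
  e q := Tr.comp q.1.1 q.1.2
  ee := ((AddMonoidHom.fst Q.ee Q.ee).comp (SquareRing.fiberFst E.tgtHom E.srcHom).ee).prod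
    ((AddMonoidHom.snd Q.ee Q.ee).comp (SquareRing.fiberSnd E.tgtHom E.srcHom).ee)
  map_add q q' := Tr.comp_add (E := E) q.2
  map_one := by
    refine Tr.ext ?_ rfl
    change (0 : E.C1) + 0 = 0
    simp
  map_mul q q' := Tr.comp_mul (E := E) q.2 q'.2
  map_P := by
    rintro ⟨⟨a, b⟩, h⟩
    change a.2 = b.1 at h
    refine Tr.ext ?_ rfl
    change E.P (a.1 - a.2) + E.P (b.1 - b.2) = E.P (a.1 - b.2)
    rw [← map_add, h]; simp
  map_H := by
    rintro ⟨⟨X, X'⟩, hX⟩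
    change X.x = X'.src at hX
    change (Q.H X.src, Q.H X'.x) = (Q.H (Tr.comp X X').src, Q.H X'.x)
    rw [Tr.src_comp hX]
  map_act := by
    rintro ⟨⟨X, X'⟩, hX⟩ ⟨⟨Y, Y'⟩, hY⟩ ⟨⟨a, b⟩, h⟩ ⟨⟨Z, Z'⟩, hZ⟩
    change X.x = X'.src at hX
    change Y.x = Y'.src at hY
    change Z.x = Z'.src at hZ
    refine Prod.ext ?_ rfl
    change Q.act X.src Y.src a.1 Z.src = Q.act (Tr.comp X X').src
      (Tr.comp Y Y').src a.1 (Tr.comp Z Z').src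
    rw [Tr.src_comp hX, Tr.src_comp hY, Tr.src_comp hZ]

end CrossedSquareRing

section Tracks

open BWCoh

universe v w

variable {C K : Type w} [Category.{v} C] [Category.{v} K]

/-- A linear track extension `0 → D → T_1 ⇉ K → C → 0` of a category `C` by a bifunctor `D` with
given underlying category `T_0 = K` and given functor `p : K ⥤ C`, which is meant to be the identity
on objects and surjective on morphisms. The track category `T` is an internal groupoid in the
category of categories which is discrete on objects: `Tr a b` is the set of all tracks between
morphisms from `a` to `b`. These are the morphisms of the category `T_1`, with composition `hcomp`
and with the functors `src, tgt : T_1 → K`, `zero : K → T_1` (`zero f` is the identity track of `f`).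
`vcomp α β` is the composite `β + α` of `α : f ⇒ g` and `β : g ⇒ h`. -/
structure TrackExt (p : K ⥤ C) (D : Cᵒᵖ ⥤ C ⥤ AddCommGrpCat.{u}) where
  Tr : K → K → Type u
  src : ∀ {a b : K}, Tr a b → (a ⟶ b)
  tgt : ∀ {a b : K}, Tr a b → (a ⟶ b)
  zero : ∀ {a b : K}, (a ⟶ b) → Tr a b
  hcomp : ∀ {a b c : K}, Tr a b → Tr b c → Tr a c
  vcomp : ∀ {a b : K} (α β : Tr a b), tgt α = src β → Tr a b
  src_zero : ∀ {a b : K} (f : a ⟶ b), src (zero f) = f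
  tgt_zero : ∀ {a b : K} (f : a ⟶ b), tgt (zero f) = f
  src_hcomp : ∀ {a b c : K} (α : Tr a b) (β : Tr b c), src (hcomp α β) = src α ≫ src β
  tgt_hcomp : ∀ {a b c : K} (α : Tr a b) (β : Tr b c), tgt (hcomp α β) = tgt α ≫ tgt β
  src_vcomp : ∀ {a b : K} (α β : Tr a b) (h : tgt α = src β), src (vcomp α β h) = src α
  tgt_vcomp : ∀ {a b : K} (α β : Tr a b) (h : tgt α = src β), tgt (vcomp α β h) = tgt β
  hcomp_assoc : ∀ {a b c d : K} (α : Tr a b) (β : Tr b c) (γ : Tr c d),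
    hcomp (hcomp α β) γ = hcomp α (hcomp β γ)
  zero_id_hcomp : ∀ {a b : K} (α : Tr a b), hcomp (zero (𝟙 a)) α = α
  hcomp_zero_id : ∀ {a b : K} (α : Tr a b), hcomp α (zero (𝟙 b)) = α
  zero_comp : ∀ {a b c : K} (f : a ⟶ b) (g : b ⟶ c), zero (f ≫ g) = hcomp (zero f) (zero g)
  vcomp_assoc : ∀ {a b : K} (α β γ : Tr a b) (h : tgt α = src β) (h' : tgt β = src γ),
    vcomp (vcomp α β h) γ ((tgt_vcomp α β h).trans h') =
      vcomp α (vcomp β γ h') (h.trans (src_vcomp β γ h').symm)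
  zero_vcomp : ∀ {a b : K} (α : Tr a b), vcomp (zero (src α)) α (tgt_zero _) = α
  vcomp_zero : ∀ {a b : K} (α : Tr a b), vcomp α (zero (tgt α)) (src_zero _).symm = α
  exists_inv : ∀ {a b : K} (α : Tr a b), ∃ (β : Tr a b) (h : tgt α = src β) (h' : tgt β = src α),
    vcomp α β h = zero (src α) ∧ vcomp β α h' = zero (tgt α)
  interchange : ∀ {a b c : K} (α β : Tr a b) (α' β' : Tr b c) (h : tgt α = src β)
    (h' : tgt α' = src β'), hcomp (vcomp α β h) (vcomp α' β' h') =
      vcomp (hcomp α α') (hcomp β β') (by rw [tgt_hcomp, src_hcomp, h, h'])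
  /-- `p` identifies `C` with the homotopy category of `T`. -/
  map_eq_iff : ∀ {a b : K} (f g : a ⟶ b), p.map f = p.map g ↔ ∃ α : Tr a b, src α = f ∧ tgt α = g
  /-- The isomorphisms from `D (p a, p b)` to the group of tracks `f ⇒ f`. -/
  τ : ∀ {a b : K}, (a ⟶ b) → Coef D (p.obj a) (p.obj b) → Tr a b
  src_τ : ∀ {a b : K} (f : a ⟶ b) (x : Coef D (p.obj a) (p.obj b)), src (τ f x) = f
  tgt_τ : ∀ {a b : K} (f : a ⟶ b) (x : Coef D (p.obj a) (p.obj b)), tgt (τ f x) = f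
  τ_injective : ∀ {a b : K} (f : a ⟶ b), Function.Injective (τ f)
  τ_surjective : ∀ {a b : K} (f : a ⟶ b) (α : Tr a b), src α = f → tgt α = f → ∃ x, τ f x = α
  τ_add : ∀ {a b : K} (f : a ⟶ b) (x y : Coef D (p.obj a) (p.obj b)),
    τ f (x + y) = vcomp (τ f x) (τ f y) ((tgt_τ f x).trans (src_τ f y).symm)
  τ_conj : ∀ {a b : K} (ξ : Tr a b) (x : Coef D (p.obj a) (p.obj b)),
    vcomp (τ (src ξ) x) ξ (tgt_τ _ _) = vcomp ξ (τ (tgt ξ) x) (src_τ _ _).symm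
  τ_push : ∀ {a b c : K} (f : a ⟶ b) (h : b ⟶ c) (x : Coef D (p.obj a) (p.obj b)),
    hcomp (τ f x) (zero h) = τ (f ≫ h) (push D (p.map h) x)
  τ_pull : ∀ {a b c : K} (e : a ⟶ b) (f : b ⟶ c) (x : Coef D (p.obj b) (p.obj c)),
    hcomp (zero e) (τ f x) = τ (e ≫ f) (pull D (p.map e) x)

namespace TrackExt

variable {p : K ⥤ C} {D : Cᵒᵖ ⥤ C ⥤ AddCommGrpCat.{u}} (T : TrackExt p D)

/-- Choices which determine a cochain of a linear track extension: a morphism `s α` of `K` over each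
morphism `α` of `C`, a track `η f : f ⇒ s (p f)` for each morphism `f` of `K`, and a track
`μ α β : s α ≫ s β ⇒ s (α ≫ β)` for all composable morphisms `α`, `β` of `C`. -/
structure Choice where
  s : ∀ {a b : K}, (p.obj a ⟶ p.obj b) → (a ⟶ b)
  map_s : ∀ {a b : K} (α : p.obj a ⟶ p.obj b), p.map (s α) = α
  η : ∀ {a b : K}, (a ⟶ b) → T.Tr a b
  src_η : ∀ {a b : K} (f : a ⟶ b), T.src (η f) = f
  tgt_η : ∀ {a b : K} (f : a ⟶ b), T.tgt (η f) = s (p.map f)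
  μ : ∀ {a b c : K}, (p.obj a ⟶ p.obj b) → (p.obj b ⟶ p.obj c) → T.Tr a c
  src_μ : ∀ {a b c : K} (α : p.obj a ⟶ p.obj b) (β : p.obj b ⟶ p.obj c),
    T.src (μ α β) = s α ≫ s β
  tgt_μ : ∀ {a b c : K} (α : p.obj a ⟶ p.obj b) (β : p.obj b ⟶ p.obj c),
    T.tgt (μ α β) = s (α ≫ β)

/-- `c` is the cochain determined by the choices `S`: for composable `f`, `g` in `K`, the value
`c (f, g)` measures the difference between the two tracks `f ≫ g ⇒ s (p (f ≫ g))` given by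
`η f`, `η g`, `μ (p f, p g)` and by `η (f ≫ g)`. -/
def IsCochainOf (S : T.Choice) (c : Cochain2 (res D p)) : Prop :=
  ∀ (a b d : K) (f : a ⟶ b) (g : b ⟶ d),
    T.vcomp (T.hcomp (S.η f) (S.η g)) (S.μ (p.map f) (p.map g))
        (by rw [T.tgt_hcomp, S.tgt_η, S.tgt_η, S.src_μ]) =
      T.vcomp (T.τ (f ≫ g) (c a b d f g)) (S.η (f ≫ g)) (by rw [T.tgt_τ, S.src_η])

/-- The track extension `T` represents the class `x` in `H^3 (C, K; D)`: the class `x` is the class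
of the cochain determined by some choices. -/
def Represents (x : RelH3 D p) : Prop :=
  ∃ (S : T.Choice) (c : Cochain2 (res D p)) (hc : (c : Rel2 D p) ∈ (rd2 D p).ker),
    T.IsCochainOf S c ∧ x = ((⟨(c : Rel2 D p), hc⟩ : (rd2 D p).ker) : RelH3 D p)

end TrackExt

end Tracks

section Extensions

variable {Q : SquareRing.{u}} {R : Type u} [Ring R] (p : Q.Hom (SquareRing.ofRing R))
  (M : Type u) [AddCommGroup M] [Module R M] [Module Rᵐᵒᵖ M] [SMulCommClass R Rᵐᵒᵖ M]

/-- A crossed square ring extension `0 → M → C_(1) → Q → R → 0` of `R` by `M` with `C_(0) = Q` and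
with the given map `p : Q → R`: an exact sequence in which `C_(1) → Q` is a crossed square ring and
`ι` is compatible with the actions of `Q` on `M` via `p` and on `C_(1)`. -/
structure CrossedExt extends CrossedSquareRing Q where
  ι : M →+ C1
  ι_injective : Function.Injective ι
  range_ι : ∀ r : C1, d r = 0 ↔ ∃ m, ι m = r
  range_d : ∀ x : Q.e, p.e x = 0 ↔ ∃ r, d r = x
  ι_smul : ∀ (x : Q.e) (m : M), ι ((show R from p.e x) • m) = l x (ι m)
  ι_op_smul : ∀ (m : M) (x : Q.e), ι (MulOpposite.op (show R from p.e x) • m) = rr (ι m) x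

namespace CrossedExt

variable {p M}

/-- Morphisms of crossed square ring extensions which are the identity on `Q`, `M` and `R`. -/
@[ext] structure Hom (E E' : CrossedExt p M) where
  f : E.C1 →+ E'.C1
  f_P : ∀ a, f (E.P a) = E'.P a
  d_f : ∀ r, E'.d (f r) = E.d r
  f_l : ∀ x r, f (E.l x r) = E'.l x (f r)
  f_rr : ∀ r x, f (E.rr r x) = E'.rr (f r) x
  f_ι : ∀ m, f (E.ι m) = E'.ι m

instance : Category.{u} (CrossedExt p M) where
  Hom := Hom
  id E := ⟨AddMonoidHom.id _, fun _ => rfl, fun _ => rfl, fun _ _ => rfl, fun _ _ => rfl,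
    fun _ => rfl⟩
  comp g h := ⟨h.f.comp g.f, fun a => by simp [g.f_P, h.f_P], fun r => by simp [g.d_f, h.d_f],
    fun x r => by simp [g.f_l, h.f_l], fun r x => by simp [g.f_rr, h.f_rr],
    fun m => by simp [g.f_ι, h.f_ι]⟩

end CrossedExt

/-- The third relative Mac Lane cohomology `HML^3 (R, Q; M) = H^3 (mod-R, mod-Q; D_M)`. -/
abbrev HML3 : Type u := BWCoh.RelH3 (matBifunctor R M) (ModSq.toRing p)

namespace CrossedExt

variable {p M} (E : CrossedExt p M)

open CrossedSquareRing RightModule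

/-- A pair of composable matrices of tracks. -/
def pair {n : ℕ} (v w : FreeMod E.trackRing n) (h : v.map E.tgtHom = w.map E.srcHom) :
    FreeMod E.pairRing n :=
  ⟨fun i => ⟨(v.e i, w.e i), congrArg (fun u => FreeMod.e u i) h⟩,
    fun i j hij => ⟨(v.ee i j hij, w.ee i j hij), congrArg (fun u => FreeMod.ee u i j hij) h⟩⟩

theorem pair_lift {m n : ℕ} (v w : Fin m → FreeMod E.trackRing n)
    (h : ∀ k, (v k).map E.tgtHom = (w k).map E.srcHom) (v' w' : FreeMod E.trackRing m)
    (h' : v'.map E.tgtHom = w'.map E.srcHom)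
    (h'' : (lift v v').map E.tgtHom = (lift w w').map E.srcHom) :
    lift (fun k => E.pair (v k) (w k) (h k)) (E.pair v' w' h') =
      E.pair (lift v v') (lift w w') h'' := by
  have h1 := FreeMod.map_lift (SquareRing.fiberFst E.tgtHom E.srcHom)
    (fun k => E.pair (v k) (w k) (h k)) (E.pair v' w' h')
  have h2 := FreeMod.map_lift (SquareRing.fiberSnd E.tgtHom E.srcHom)
    (fun k => E.pair (v k) (w k) (h k)) (E.pair v' w' h')
  refine FreeMod.ext' (fun i => Subtype.ext (Prod.ext ?_ ?_))
    (fun i j hij => Subtype.ext (Prod.ext ?_ ?_))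
  · exact congrArg (fun u => FreeMod.e u i) h1
  · exact congrArg (fun u => FreeMod.e u i) h2
  · exact congrArg (fun u => FreeMod.ee u i j hij) h1
  · exact congrArg (fun u => FreeMod.ee u i j hij) h2

theorem d_ι (m : M) : E.d (E.ι m) = 0 := (E.range_ι _).2 ⟨m, rfl⟩

theorem ι_comm (m : M) (r : E.C1) : E.ι m + r = r + E.ι m := by
  rw [E.swap, d_ι, B_zero_right, map_zero, add_zero]

theorem osum_r {n : ℕ} (X : Fin n → Tr E.toCrossedSquareRing) (m : Fin n → M)
    (h : ∀ j, (X j).r = E.ι (m j)) : (osum X).r = E.ι (∑ j, m j) := by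
  induction n with
  | zero => simp only [osum_zero, Finset.univ_eq_empty, Finset.sum_empty, map_zero]; rfl
  | succ n ih =>
    rw [osum_succ, Fin.sum_univ_succ, map_add, ← h, ← ih _ _ (fun j => h j.succ), Tr.add_r,
      ih _ _ (fun j => h j.succ), d_ι, B_zero_left, E.pr_zero]

theorem lift_r {m n : ℕ} (f : Fin m → FreeMod E.trackRing n) (g : FreeMod E.trackRing m)
    (hf : ∀ k, (f k).map E.srcHom = (f k).map E.tgtHom) (hg : g.map E.srcHom = g.map E.tgtHom)
    (i : Fin n) (x : Fin m → M)
    (h : ∀ j, Tr.r (E := E.toCrossedSquareRing) ((f j).e i * g.e j) = E.ι (x j)) :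
    Tr.r (E := E.toCrossedSquareRing) ((lift f g).e i) = E.ι (∑ j, x j) := by
  set z : ∀ k l : Fin m, k < l → Q.ee × Q.ee :=
    fun k l h => E.trackRing.act ((f k).e i) ((f l).e i) (g.ee k l h) 1 with hz
  have hc : (psum z).1 = (psum z).2 := by
    rw [map_psum Prod.fst rfl (fun _ _ => rfl), map_psum Prod.snd rfl (fun _ _ => rfl)]
    congr 1; funext k l hkl
    have h1 : Tr.src ((f k).e i) = Tr.x ((f k).e i) := congrFun (congrArg FreeMod.e (hf k)) i
    have h2 : Tr.src ((f l).e i) = Tr.x ((f l).e i) := congrFun (congrArg FreeMod.e (hf l)) i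
    have h3 : (g.ee k l hkl).1 = (g.ee k l hkl).2 :=
      congrFun (congrFun (congrFun (congrArg FreeMod.ee hg) k) l) hkl
    change Q.act (Tr.src ((f k).e i)) (Tr.src ((f l).e i)) (g.ee k l hkl).1
      (1 : Tr E.toCrossedSquareRing).src = Q.act _ _ (g.ee k l hkl).2 1
    rw [h1, h2, h3, Tr.src_one]
  rw [FreeMod.lift_e]
  have h0 : E.P ((psum z).1 - (psum z).2) = 0 := by rw [hc, sub_self, map_zero]
  refine (Tr.add_r (E := E.toCrossedSquareRing) _ (Tr.ofP E.toCrossedSquareRing (psum z))).trans ?_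
  rw [Tr.ofP_r, h0, map_zero, B_zero_left, E.pr_zero, add_zero]
  exact E.osum_r _ x h

theorem ext_tracks {n : ℕ} {v w : FreeMod E.trackRing n} (hs : v.map E.srcHom = w.map E.srcHom)
    (ht : v.map E.tgtHom = w.map E.tgtHom)
    (hr : ∀ i, Tr.r (E := E.toCrossedSquareRing) (v.e i) =
      Tr.r (E := E.toCrossedSquareRing) (w.e i)) : v = w :=
  FreeMod.ext' (fun i => Tr.ext (hr i) (congrFun (congrArg FreeMod.e ht) i)) (fun i j hij => Prod.ext
    (congrFun (congrFun (congrFun (congrArg FreeMod.ee hs) i) j) hij)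
    (congrFun (congrFun (congrFun (congrArg FreeMod.ee ht) i) j) hij))

/-- The track given by a matrix with entries in `M`, from a column of a morphism to itself. -/
def loop {n : ℕ} (v : FreeMod Q n) (x : Fin n → M) : FreeMod E.trackRing n :=
  ⟨fun i => ⟨E.ι (x i), v.e i⟩, fun i j hij => (v.ee i j hij, v.ee i j hij)⟩

theorem loop_src {n : ℕ} (v : FreeMod Q n) (x : Fin n → M) : (E.loop v x).map E.srcHom = v :=
  FreeMod.ext' (fun i => (congrArg (· + v.e i) (E.d_ι _)).trans (zero_add _)) (fun i j hij => rfl)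

theorem zero_src {n : ℕ} (v : FreeMod Q n) : (v.map E.zeroHom).map E.srcHom = v :=
  FreeMod.ext' (fun i => show E.d 0 + v.e i = v.e i by simp) (fun i j hij => rfl)

theorem loop_push {m n : ℕ} (h : Fin m → FreeMod Q n) (v : FreeMod Q m) (x : Fin m → M) :
    lift (fun k => (h k).map E.zeroHom) (E.loop v x) =
      E.loop (lift h v) (fun i => ∑ j, (show R from p.e ((h j).e i)) • x j) := by
  refine E.ext_tracks ?_ ?_ fun i => E.lift_r _ _ (fun k => E.zero_src _) (E.loop_src _ _) i _ ?_
  · rw [FreeMod.map_lift, loop_src, loop_src]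
    simp only [zero_src]
  · exact FreeMod.map_lift _ _ _
  · intro j
    rw [E.ι_smul]
    change E.pr (E.rr 0 _ + E.l _ _) (Q.act (E.d 0) _ _ 1) = _
    rw [E.zero_rr, map_zero, Q.act_zero_fst, E.pr_zero, zero_add]; rfl

theorem loop_pull {m n : ℕ} (v : Fin m → FreeMod Q n) (x : Fin m → Fin n → M) (e : FreeMod Q m) :
    lift (fun k => E.loop (v k) (x k)) (e.map E.zeroHom) =
      E.loop (lift v e)
        (fun i => ∑ j, MulOpposite.op (show R from p.e (e.e j)) • x j i) := by
  refine E.ext_tracks ?_ ?_ fun i => E.lift_r _ _ (fun k => E.loop_src _ _) (E.zero_src _) i _ ?_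
  · rw [FreeMod.map_lift, loop_src, zero_src]
    simp only [loop_src]
  · exact FreeMod.map_lift _ _ _
  · intro j
    rw [E.ι_op_smul]
    change E.pr (E.rr (E.ι (x j i)) (E.d 0 + e.e j) + E.l _ 0) (Q.act (E.d (E.ι _)) _ _ 1) = _
    rw [E.l_zero, d_ι, Q.act_zero_fst, E.pr_zero, add_zero, map_zero, zero_add]

/-- The linear track extension of `mod-R` by `D_M` with underlying category `mod-Q` given by a crossed
square ring extension. Its category of tracks is the category of finitely generated free modules
over the square ring of tracks. Thus a track `(f_i^k, f_{ij}^k) ⇒ (g_i^k, g_{ij}^k)` is a matrix of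
elements `h_i^k` of `C_1` such that `f_i^k = d h_i^k + g_i^k`. -/
def tracks : TrackExt (ModSq.toRing p) (matBifunctor R M) where
  Tr a b := Fin a.rank → FreeMod E.trackRing b.rank
  src α := fun k => (α k).map E.srcHom
  tgt α := fun k => (α k).map E.tgtHom
  zero f := fun k => FreeMod.map E.zeroHom (f k)
  hcomp α β := fun k => lift β (α k)
  vcomp α β h := fun k => (E.pair (α k) (β k) (congrFun h k)).map E.compHom
  src_zero f := funext fun k => FreeMod.ext'
    (fun i => show E.d 0 + (f k).e i = (f k).e i by simp) (fun i j hij => rfl)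
  tgt_zero f := rfl
  src_hcomp α β := funext fun k => FreeMod.map_lift _ _ _
  tgt_hcomp α β := funext fun k => FreeMod.map_lift _ _ _
  src_vcomp α β h := funext fun k => FreeMod.ext'
    (fun i => Tr.src_comp (congrArg (fun u => FreeMod.e u i) (congrFun h k))) (fun i j hij => rfl)
  tgt_vcomp α β h := rfl
  hcomp_assoc α β γ := funext fun k => lift_lift γ β (α k)
  zero_id_hcomp α := funext fun k => by
    change lift α (FreeMod.map E.zeroHom (FreeMod.gen Q k)) = α k
    rw [FreeMod.map_gen, FreeMod.lift_gen]
  hcomp_zero_id α := funext fun k => by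
    change lift (fun j => FreeMod.map E.zeroHom (FreeMod.gen Q j)) (α k) = α k
    simp only [FreeMod.map_gen]
    exact FreeMod.gen_lift _
  zero_comp f g := funext fun k => FreeMod.map_lift _ _ _
  vcomp_assoc α β γ h h' := funext fun k => FreeMod.ext'
    (fun i => Tr.ext (add_assoc _ _ _) rfl) (fun i j hij => rfl)
  zero_vcomp α := funext fun k => FreeMod.ext'
    (fun i => Tr.ext (zero_add _) rfl) (fun i j hij => rfl)
  vcomp_zero α := funext fun k => FreeMod.ext'
    (fun i => Tr.ext (add_zero _) rfl) (fun i j hij => rfl)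
  exists_inv α := by
    refine ⟨fun k => ⟨fun i => ⟨-((α k).e i).r, ((α k).e i).src⟩,
      fun i j hij => (((α k).ee i j hij).2, ((α k).ee i j hij).1)⟩, ?_, rfl, ?_, ?_⟩
    · exact funext fun k => FreeMod.ext' (fun i => (Tr.src_inv _).symm) (fun i j hij => rfl)
    · exact funext fun k => FreeMod.ext'
        (fun i => Tr.ext (add_neg_cancel _) rfl) (fun i j hij => rfl)
    · exact funext fun k => FreeMod.ext'
        (fun i => Tr.ext (neg_add_cancel _) rfl) (fun i j hij => rfl)
  interchange α β α' β' h h' := funext fun k => by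
    refine (FreeMod.map_lift E.compHom _ _).symm.trans (congrArg (FreeMod.map E.compHom) ?_)
    exact E.pair_lift _ _ (congrFun h') _ _ _ _
  map_eq_iff {a b} f g := by
    have hp : ∀ (r : E.C1) (x : Q.e), p.e (E.d r + x) = p.e x := fun r x => by
      rw [p.map_add, (E.range_d _).2 ⟨r, rfl⟩]
      exact zero_add (M := R) _
    constructor
    · intro h
      have h1 : ∀ k i, ∃ r, E.d r = (f k).e i - (g k).e i := fun k i => by
        refine (E.range_d _).1 ?_
        have h2 : p.e ((f k).e i) = p.e ((g k).e i) := congrFun (congrFun h i) k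
        have h3 := p.map_add ((f k).e i - (g k).e i) ((g k).e i)
        rw [sub_add_cancel, h2] at h3
        exact (right_eq_add (M := R)).1 h3
      choose r hr using h1
      refine ⟨fun k => ⟨fun i => ⟨r k i, (g k).e i⟩,
        fun i j hij => ((f k).ee i j hij, (g k).ee i j hij)⟩, ?_, rfl⟩
      refine funext fun k => FreeMod.ext' (fun i => ?_) (fun i j hij => rfl)
      change E.d (r k i) + (g k).e i = (f k).e i
      rw [hr, sub_add_cancel]
    · rintro ⟨α, rfl, rfl⟩
      exact Matrix.ext fun i k => hp _ _
  τ {a b} f x := fun k => E.loop (f k) fun i => (show Matrix (Fin b.rank) (Fin a.rank) M from x) i k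
  src_τ f x := funext fun k => E.loop_src _ _
  tgt_τ f x := rfl
  τ_injective {a b} f x y h := by
    refine Matrix.ext fun i k => E.ι_injective ?_
    exact congrArg Tr.r (congrFun (congrArg FreeMod.e (congrFun h k)) i)
  τ_surjective {a b} f α h h' := by
    have h1 : ∀ k i, ∃ m, E.ι m = ((α k).e i).r := fun k i => by
      refine (E.range_ι _).1 ?_
      have h2 : E.d ((α k).e i).r + ((α k).e i).x = (f k).e i :=
        congrFun (congrArg FreeMod.e (congrFun h k)) i
      have h3 : ((α k).e i).x = (f k).e i := congrFun (congrArg FreeMod.e (congrFun h' k)) i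
      rw [h3] at h2
      exact add_eq_right.1 h2
    choose m hm using h1
    refine ⟨(show Matrix (Fin b.rank) (Fin a.rank) M from Matrix.of fun i k => m k i), ?_⟩
    refine funext fun k => FreeMod.ext' (fun i => Tr.ext (hm k i) ?_)
      (fun i j hij => Prod.ext ?_ ?_)
    · exact (congrFun (congrArg FreeMod.e (congrFun h' k)) i).symm
    · exact (congrFun (congrFun (congrFun (congrArg FreeMod.ee (congrFun h k)) i) j) hij).symm
    · exact (congrFun (congrFun (congrFun (congrArg FreeMod.ee (congrFun h' k)) i) j) hij).symm
  τ_add f x y := funext fun k => FreeMod.ext'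
    (fun i => Tr.ext (E.ι.map_add _ _) rfl) (fun i j hij => rfl)
  τ_conj ξ x := funext fun k => FreeMod.ext'
    (fun i => Tr.ext (E.ι_comm _ _) rfl) (fun i j hij => rfl)
  τ_push f h x := funext fun k => E.loop_push _ _ _
  τ_pull e f x := funext fun k => E.loop_pull _ _ _

end CrossedExt

end Extensions

/-! Let `T` be a linear track extension of `C` with underlying category `K`. Tracks `f ⇒ g` exist
exactly when `f` and `g` have the same image in `C`, and they then form a torsor under `D`. A
trivialization `κ` of all these torsors turns vertical composition into addition, and horizontal
composition into push plus pull plus an error term. The predicate `IsCoord T c κ` says that this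
error is the difference of the values of a 2-cochain `c` at the sources and at the targets.
Associativity of horizontal composition makes the coboundary of `c` depend only on images in `C`,
which is the relative cocycle condition. Two trivializations differ by a 1-cochain, and `c` is then
determined up to its coboundary and up to cochains coming from `C`. Hence `TrackExt.represents_iff`:
`T` represents the class of `c` if and only if it has coordinates for `c`. The theorem becomes a
statement about coordinates on `E.tracks`. Groupoid: a morphism of extensions is bijective by the
five lemma. Coordinates pull back along it, so the class is constant on components. Injectivity
(`exists_hom_of_coord`): if two extensions have coordinates for the same `c`, matching source,
target and coordinate gives an isomorphism of their track categories. Multiplication, addition and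
`P` on tracks of rank one are all horizontal composites with tracks that this isomorphism preserves,
so its restriction to tracks with target zero is a morphism of extensions. Surjectivity
(`isCoord_crossedExt`): a relative cocycle `c` defines a category `TrackCat` of triples (source,
target, coordinate) with composition twisted by `c`. Its object of rank `n` is still a coproduct of
`n` copies of the object of rank one, so the operations of free `Q`-modules carry over to tracks.
Identities between them are checked on generators, where source, target and projections decide them.
The tracks with target zero from rank one to rank one form the required `C1`. A comparison functor
`val` from its tracks to `TrackCat` supplies the coordinates for `c`. -/

section CochainClasses

open BWCoh

universe v w

variable {C K : Type w} [Category.{v} C] [Category.{v} K] {p : K ⥤ C}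
  {D : Cᵒᵖ ⥤ C ⥤ AddCommGrpCat.{u}}

/-! ### Relative cochains and equality of relative classes -/

namespace BWCoh

/-- The values of a `1`-cochain, in terms of the bifunctor on `C`. -/
def ev1 (t : Cochain1 (res D p)) {a b : K} (f : a ⟶ b) : Coef D (p.obj a) (p.obj b) := t a b f

/-- The values of a `2`-cochain, in terms of the bifunctor on `C`. -/
def ev2 (c : Cochain2 (res D p)) {a b d : K} (f : a ⟶ b) (g : b ⟶ d) :
    Coef D (p.obj a) (p.obj d) := c a b d f g

/-- The values of a `3`-cochain, in terms of the bifunctor on `C`. -/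
def ev3 (c : Cochain3 (res D p)) {a b d e : K} (f : a ⟶ b) (g : b ⟶ d) (h : d ⟶ e) :
    Coef D (p.obj a) (p.obj e) := c a b d e f g h

theorem ev2_sub (c c' : Cochain2 (res D p)) {a b d : K} (f : a ⟶ b) (g : b ⟶ d) :
    ev2 (c - c') f g = ev2 c f g - ev2 c' f g := rfl

theorem ev2_d1 (t : Cochain1 (res D p)) {a b d : K} (f : a ⟶ b) (g : b ⟶ d) :
    ev2 (d1 (res D p) t) f g =
      push D (p.map g) (ev1 t f) - ev1 t (f ≫ g) + pull D (p.map f) (ev1 t g) := rfl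

theorem ev3_d2 (c : Cochain2 (res D p)) {a b d e : K} (f : a ⟶ b) (g : b ⟶ d) (h : d ⟶ e) :
    ev3 (d2 (res D p) c) f g h = push D (p.map h) (ev2 c f g) - ev2 c f (g ≫ h) +
      ev2 c (f ≫ g) h - pull D (p.map f) (ev2 c g h) := rfl

theorem push_comp {a b b' b'' : C} (g : b ⟶ b') (g' : b' ⟶ b'') (x : Coef D a b) :
    push D (g ≫ g') x = push D g' (push D g x) := by
  simp [push]

theorem pull_comp {a a' a'' b : C} (f : a'' ⟶ a') (f' : a' ⟶ a) (x : Coef D a b) :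
    pull D (f ≫ f') x = pull D f (pull D f' x) := by
  simp [pull]

theorem push_pull {a a' b b' : C} (f : a' ⟶ a) (g : b ⟶ b') (x : Coef D a b) :
    push D g (pull D f x) = pull D f (push D g x) :=
  (congrArg (fun φ => φ.hom x) ((D.map f.op).naturality g)).symm

/-- A `2`-cochain on `K` whose values depend only on the images of the morphisms in `C`. -/
def Descends2 (c : Cochain2 (res D p)) : Prop :=
  ∀ ⦃a b d : K⦄ (f f' : a ⟶ b) (g g' : b ⟶ d), p.map f = p.map f' → p.map g = p.map g' →
    ev2 c f g = ev2 c f' g'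

/-- A `3`-cochain on `K` whose values depend only on the images of the morphisms in `C`. -/
def Descends3 (c : Cochain3 (res D p)) : Prop :=
  ∀ ⦃a b d e : K⦄ (f f' : a ⟶ b) (g g' : b ⟶ d) (h h' : d ⟶ e), p.map f = p.map f' →
    p.map g = p.map g' → p.map h = p.map h' → ev3 c f g h = ev3 c f' g' h'

theorem mem_ker_rd2 (c : Cochain2 (res D p)) :
    (c : Rel2 D p) ∈ (rd2 D p).ker ↔ d2 (res D p) c ∈ (res3 D p).range := by
  rw [AddMonoidHom.mem_ker, rd2, QuotientAddGroup.map_mk, QuotientAddGroup.eq_zero_iff]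

/-- The class in the third relative cohomology of a relative cocycle. -/
def relClass (c : Cochain2 (res D p)) (hc : d2 (res D p) c ∈ (res3 D p).range) : RelH3 D p :=
  ((⟨(c : Rel2 D p), (mem_ker_rd2 c).2 hc⟩ : (rd2 D p).ker) : RelH3 D p)

theorem relClass_eq_iff {c c' : Cochain2 (res D p)} (hc : d2 (res D p) c ∈ (res3 D p).range)
    (hc' : d2 (res D p) c' ∈ (res3 D p).range) : relClass c hc = relClass c' hc' ↔
      ∃ t : Cochain1 (res D p), c' - c - d1 (res D p) t ∈ (res2 D p).range := by
  rw [relClass, relClass, QuotientAddGroup.eq, AddSubgroup.mem_addSubgroupOf]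
  change (-(c : Rel2 D p) + (c' : Rel2 D p)) ∈ _ ↔ _
  have h : -(c : Rel2 D p) + (c' : Rel2 D p) = ((c' - c : Cochain2 (res D p)) : Rel2 D p) := by
    rw [← QuotientAddGroup.mk_neg, ← QuotientAddGroup.mk_add]
    congr 1; abel
  rw [h]
  constructor
  · rintro ⟨t, ht⟩
    obtain ⟨t, rfl⟩ := QuotientAddGroup.mk_surjective t
    refine ⟨t, ?_⟩
    rw [rd1, QuotientAddGroup.map_mk, QuotientAddGroup.eq] at ht
    convert ht using 1; abel
  · rintro ⟨t, ht⟩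
    refine ⟨(t : Rel1 D p), ?_⟩
    rw [rd1, QuotientAddGroup.map_mk, QuotientAddGroup.eq]
    convert ht using 1; abel

theorem exists_relClass (x : RelH3 D p) : ∃ c hc, x = relClass c hc := by
  obtain ⟨⟨y, hy⟩, rfl⟩ := QuotientAddGroup.mk_surjective x
  obtain ⟨c, rfl⟩ := QuotientAddGroup.mk_surjective y
  exact ⟨c, (mem_ker_rd2 c).1 hy, rfl⟩

end BWCoh

/-! ### Coordinates on a linear track extension and the class they compute -/

namespace TrackExt

variable (T : TrackExt p D)

theorem map_src {a b : K} (α : T.Tr a b) : p.map (T.src α) = p.map (T.tgt α) :=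
  (T.map_eq_iff _ _).2 ⟨α, rfl, rfl⟩

variable {T}

/-- The proof argument of `vcomp` depends on both tracks, so a factor cannot be rewritten in place;
this lemma transports that proof. -/
theorem vcomp_congr {a b : K} {α α' β β' : T.Tr a b} (hα : α = α') (hβ : β = β')
    (h : T.tgt α = T.src β) : T.vcomp α β h = T.vcomp α' β' (by rw [← hα, ← hβ, h]) := by
  subst hα hβ; rfl

theorem vcomp_zero' {a b : K} (α : T.Tr a b) {f : a ⟶ b} (h : T.tgt α = T.src (T.zero f)) :
    T.vcomp α (T.zero f) h = α := by
  rw [T.src_zero] at h; subst h; exact T.vcomp_zero α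

theorem zero_vcomp' {a b : K} (α : T.Tr a b) {f : a ⟶ b} (h : T.tgt (T.zero f) = T.src α) :
    T.vcomp (T.zero f) α h = α := by
  rw [T.tgt_zero] at h; subst h; exact T.zero_vcomp α

theorem vcomp_right_cancel {a b : K} {α β γ : T.Tr a b} (hα : T.tgt α = T.src γ)
    (hβ : T.tgt β = T.src γ) (h : T.vcomp α γ hα = T.vcomp β γ hβ) : α = β := by
  obtain ⟨δ, h1, h2, h3, h4⟩ := T.exists_inv γ
  have key : ∀ (α : T.Tr a b) (hα : T.tgt α = T.src γ),
      T.vcomp (T.vcomp α γ hα) δ ((T.tgt_vcomp _ _ _).trans h1) = α := fun α hα => by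
    rw [T.vcomp_assoc α γ δ hα h1, vcomp_congr rfl h3, vcomp_zero']
  rw [← key α hα, ← key β hβ]
  exact vcomp_congr h rfl _

/-- The track `τ f 0` is idempotent for vertical composition, and an idempotent in a groupoid is an
identity. -/
theorem τ_zero {a b : K} (f : a ⟶ b) : T.τ f 0 = T.zero f := by
  refine vcomp_right_cancel (γ := T.τ f 0) (by rw [T.tgt_τ, T.src_τ])
    (by rw [T.tgt_zero, T.src_τ]) ?_
  rw [← T.τ_add, add_zero, zero_vcomp']

/-- The torsor property: `γ` followed by the inverse of `δ` is an automorphism of the common source,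
hence of the form `τ f x`. The morphism `f` is kept apart from `T.src δ` so that no cast of
coefficients is needed. -/
theorem exists_τ_vcomp {a b : K} {γ δ : T.Tr a b} {f : a ⟶ b} (hf : f = T.src δ)
    (hs : T.src γ = T.src δ)
    (ht : T.tgt γ = T.tgt δ) : ∃ x, γ = T.vcomp (T.τ f x) δ ((T.tgt_τ _ _).trans hf) := by
  obtain ⟨ε, h1, h2, h3, h4⟩ := T.exists_inv δ
  obtain ⟨x, hx⟩ := T.τ_surjective f (T.vcomp γ ε (ht.trans h1))
    ((T.src_vcomp _ _ _).trans (hs.trans hf.symm)) ((T.tgt_vcomp _ _ _).trans (h2.trans hf.symm))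
  refine ⟨x, ?_⟩
  rw [vcomp_congr hx rfl, T.vcomp_assoc γ ε δ _ h2, vcomp_congr rfl h4, vcomp_zero']

/-- Coordinates of tracks adapted to a cochain `c`: a track `f ⇒ g` is described by an element of
the coefficients, and the composition of tracks is twisted by the cochain. -/
structure IsCoord (T : TrackExt p D) (c : Cochain2 (res D p))
    (κ : ∀ a b : K, T.Tr a b → Coef D (p.obj a) (p.obj b)) : Prop where
  vcomp : ∀ {a b : K} (α β : T.Tr a b) (h : T.tgt α = T.src β),
    κ a b (T.vcomp α β h) = κ a b α + κ a b β
  τ : ∀ {a b : K} (f : a ⟶ b) (x : Coef D (p.obj a) (p.obj b)), κ a b (T.τ f x) = x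
  hcomp : ∀ {a b d : K} (α : T.Tr a b) (β : T.Tr b d), κ a d (T.hcomp α β) =
    push D (p.map (T.src β)) (κ a b α) + pull D (p.map (T.src α)) (κ b d β) +
      (ev2 c (T.src α) (T.src β) - ev2 c (T.tgt α) (T.tgt β))

namespace IsCoord

variable {c c' : Cochain2 (res D p)} {κ κ' : ∀ a b : K, T.Tr a b → Coef D (p.obj a) (p.obj b)}

theorem zero (h : T.IsCoord c κ) {a b : K} (f : a ⟶ b) : κ a b (T.zero f) = 0 := by
  rw [← τ_zero, h.τ]

/-- Parallel tracks differ by some `τ x`, and coordinates see exactly this `x`. Together with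
`exists_track`, this says that the tracks between two fixed morphisms with equal image are in
bijection with the coefficients. -/
theorem ext (hκ : T.IsCoord c κ) {a b : K} {α β : T.Tr a b} (hs : T.src α = T.src β)
    (ht : T.tgt α = T.tgt β) (hx : κ a b α = κ a b β) : α = β := by
  obtain ⟨x, h⟩ := exists_τ_vcomp rfl hs ht
  have h1 : x = 0 := by
    rw [h, hκ.vcomp, hκ.τ] at hx
    exact add_eq_right.1 hx
  rw [h, h1, vcomp_congr (τ_zero _) rfl, zero_vcomp']

theorem exists_track (hκ : T.IsCoord c κ) {a b : K} (f g : a ⟶ b) (h : p.map f = p.map g)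
    (x : Coef D (p.obj a) (p.obj b)) : ∃ α, T.src α = f ∧ T.tgt α = g ∧ κ a b α = x := by
  obtain ⟨α, hf, hg⟩ := (T.map_eq_iff f g).1 h
  refine ⟨T.vcomp (T.τ f (x - κ a b α)) α (by rw [T.tgt_τ, hf]), ?_, ?_, ?_⟩
  · rw [T.src_vcomp, T.src_τ]
  · rw [T.tgt_vcomp, hg]
  · rw [hκ.vcomp, hκ.τ, sub_add_cancel]

/-- The coboundary of the cochain of a track extension depends only on the images in `C`. -/
theorem descends3 (hκ : T.IsCoord c κ) : Descends3 (d2 (res D p) c) := by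
  intro a b d e f f' g g' h h' hf hg hh
  obtain ⟨α, rfl, rfl, -⟩ := hκ.exists_track f f' hf 0
  obtain ⟨β, rfl, rfl, -⟩ := hκ.exists_track g g' hg 0
  obtain ⟨γ, rfl, rfl, -⟩ := hκ.exists_track h h' hh 0
  -- Expand both bracketings in coordinates. The terms in `κ` cancel, and what remains is the
  -- difference of the values of `d2 c` at the sources and at the targets.
  have h1 := congrArg (κ a e) (T.hcomp_assoc α β γ)
  simp only [hκ.hcomp, T.src_hcomp, T.tgt_hcomp, map_add, map_sub] at h1
  rw [p.map_comp, p.map_comp, pull_comp, push_comp, push_pull] at h1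
  rw [ev3_d2, ev3_d2, ← T.map_src α, ← T.map_src γ]
  rw [← sub_eq_zero] at h1 ⊢
  rw [← h1]; abel

/-- Two coordinate systems of a track extension differ by a `1`-cochain. -/
theorem exists_diff (hs : ∀ {a b : K} (α : p.obj a ⟶ p.obj b), ∃ f, p.map f = α)
    (hκ : T.IsCoord c κ) (hκ' : T.IsCoord c' κ') : ∃ t : Cochain1 (res D p),
      Descends2 (c' - c - d1 (res D p) t) := by
  choose s hs using @hs
  -- Normalize: connect every `f` to a fixed lift of its image by the track of `κ`-coordinate zero.
  -- The function `u f = κ' (η f)` is then the potential by which `κ'` and `κ` differ.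
  have h1 : ∀ (a b : K) (f : a ⟶ b), ∃ η, T.src η = f ∧ T.tgt η = s (p.map f) ∧ κ a b η = 0 :=
    fun a b f => hκ.exists_track f _ (hs _).symm 0
  choose η hη hη' hη0 using h1
  have h2 : ∀ {a b : K} (α : T.Tr a b), κ' a b α =
      κ a b α + κ' a b (η a b (T.src α)) - κ' a b (η a b (T.tgt α)) := fun {a b} α => by
    have e : T.vcomp α (η a b (T.tgt α)) (hη _ _ _).symm =
        T.vcomp (T.τ (T.src α) (κ a b α)) (η a b (T.src α)) (by rw [T.tgt_τ, hη]) := by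
      refine hκ.ext ?_ ?_ ?_
      · rw [T.src_vcomp, T.src_vcomp, T.src_τ]
      · rw [T.tgt_vcomp, T.tgt_vcomp, hη', hη', T.map_src]
      · rw [hκ.vcomp, hκ.vcomp, hη0, hη0, hκ.τ]
    have e' := congrArg (κ' a b) e
    rw [hκ'.vcomp, hκ'.vcomp, hκ'.τ] at e'
    rw [← e']; abel
  -- The sign comes from `κ' α = κ α + u (src α) - u (tgt α)`: substituted into the two composition
  -- formulas, it makes `c' - c + d1 u` descend, so the cochain sought is `-u`.
  refine ⟨fun a b f => - (show Coef D _ _ from κ' a b (η a b f)), ?_⟩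
  intro a b d f f' g g' hf hg
  obtain ⟨α, rfl, rfl, -⟩ := hκ.exists_track f f' hf 0
  obtain ⟨β, rfl, rfl, -⟩ := hκ.exists_track g g' hg 0
  have h3 := h2 (T.hcomp α β)
  rw [hκ'.hcomp, hκ.hcomp, h2 α, h2 β, T.src_hcomp, T.tgt_hcomp] at h3
  simp only [map_add, map_sub] at h3
  have e1 : ∀ {a b : K} (f : a ⟶ b), ev1 (p := p) (D := D)
      (fun a b f => - (show Coef D _ _ from κ' a b (η a b f))) f = - κ' a b (η a b f) :=
    fun f => rfl
  simp only [ev2_sub, ev2_d1, e1]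
  rw [← T.map_src α, ← T.map_src β]
  simp only [map_neg]
  rw [← sub_eq_zero] at h3 ⊢
  rw [← h3]; abel

/-- Change of coordinates along a `1`-cochain. -/
theorem change (hκ : T.IsCoord c κ) (t : Cochain1 (res D p))
    (h : Descends2 (c' - c - d1 (res D p) t)) :
    T.IsCoord c' (fun a b α => κ a b α - (ev1 t (T.src α) - ev1 t (T.tgt α))) where
  vcomp α β h := by
    rw [hκ.vcomp, T.src_vcomp, T.tgt_vcomp, h]; abel
  τ f x := by
    rw [hκ.τ, T.src_τ, T.tgt_τ]; abel
  hcomp {a b d} α β := by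
    have h1 := h (T.src α) (T.tgt α) (T.src β) (T.tgt β) (T.map_src α) (T.map_src β)
    simp only [ev2_sub, ev2_d1] at h1
    rw [← T.map_src α, ← T.map_src β] at h1
    rw [hκ.hcomp, T.src_hcomp, T.tgt_hcomp]
    simp only [map_sub]
    rw [← sub_eq_zero] at h1 ⊢
    rw [← neg_eq_zero, ← h1]; abel

end IsCoord

theorem Choice.exists_cochain (S : T.Choice) : ∃ c, T.IsCochainOf S c := by
  have h : ∀ (a b d : K) (f : a ⟶ b) (g : b ⟶ d), ∃ x,
      T.vcomp (T.hcomp (S.η f) (S.η g)) (S.μ (p.map f) (p.map g))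
        (by rw [T.tgt_hcomp, S.tgt_η, S.tgt_η, S.src_μ]) =
      T.vcomp (T.τ (f ≫ g) x) (S.η (f ≫ g)) (by rw [T.tgt_τ, S.src_η]) := fun a b d f g => by
    refine exists_τ_vcomp (S.src_η _).symm ?_ ?_
    · rw [T.src_vcomp, T.src_hcomp, S.src_η, S.src_η, S.src_η]
    · rw [T.tgt_vcomp, S.tgt_μ, S.tgt_η, p.map_comp]
  choose c hc using h
  exact ⟨c, hc⟩

/-- The choices which define the cochain of a track extension define coordinates. -/
theorem Choice.exists_coord {S : T.Choice} {c : Cochain2 (res D p)} (hc : T.IsCochainOf S c) :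
    ∃ κ, T.IsCoord c κ := by
  -- The coordinate of `α : f ⇒ g` is the failure of `α` to commute with `η`: it is the `x` with `α
  -- · η g = τ f x · η f`.
  have h : ∀ (a b : K) (α : T.Tr a b), ∃ x, T.vcomp α (S.η (T.tgt α)) (S.src_η _).symm =
      T.vcomp (T.τ (T.src α) x) (S.η (T.src α)) (by rw [T.tgt_τ, S.src_η]) := fun a b α => by
    refine exists_τ_vcomp (S.src_η _).symm ?_ ?_
    · rw [T.src_vcomp, S.src_η]
    · rw [T.tgt_vcomp, S.tgt_η, S.tgt_η, T.map_src]
  choose κ hκ using h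
  -- This equation determines the coordinate, so each property of `κ` reduces to verifying one
  -- equation of this shape. The equalities of `f` and `g` with source and target are left free for
  -- later substitution.
  have uniq : ∀ {a b : K} (α : T.Tr a b) (f : a ⟶ b) (hf : T.src α = f)
      (g : a ⟶ b) (hg : T.tgt α = g) (x : Coef D (p.obj a) (p.obj b)),
      T.vcomp α (S.η g) (by rw [S.src_η, hg]) = T.vcomp (T.τ f x) (S.η f)
        (by rw [T.tgt_τ, S.src_η]) → κ a b α = x := by
    rintro a b α _ rfl _ rfl x hx
    rw [hκ] at hx
    exact T.τ_injective _ (vcomp_right_cancel _ _ hx)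
  refine ⟨κ, ⟨?_, ?_, ?_⟩⟩
  · intro a b α β h
    refine uniq _ _ (T.src_vcomp _ _ _) _ (T.tgt_vcomp _ _ _) _ ?_
    have e2 : T.vcomp β (S.η (T.tgt β)) (S.src_η _).symm = T.vcomp (T.τ (T.tgt α) (κ a b β))
        (S.η (T.tgt α)) (by rw [T.tgt_τ, S.src_η]) := by
      rw [hκ]; congr 1 <;> rw [h]
    -- By `τ_conj` the automorphism belonging to `β` slides to the left past `α`, where it joins the
    -- one belonging to `α`.
    rw [T.vcomp_assoc α β _ h (S.src_η _).symm, vcomp_congr rfl e2,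
      ← T.vcomp_assoc _ _ _ (by rw [T.src_τ]) (by rw [T.tgt_τ, S.src_η]),
      vcomp_congr (T.τ_conj α (κ a b β)).symm rfl,
      T.vcomp_assoc _ _ _ (T.tgt_τ _ _) (by rw [S.src_η]), vcomp_congr rfl (hκ _ _ α),
      ← T.vcomp_assoc _ _ _ (by rw [T.tgt_τ, T.src_τ]) (by rw [T.tgt_τ, S.src_η])]
    refine vcomp_congr ?_ rfl _
    rw [← T.τ_add, add_comm]
  · intro a b f x
    exact uniq _ _ (T.src_τ _ _) _ (T.tgt_τ _ _) _ rfl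
  · intro a b d α β
    have e0 : ∀ (f : a ⟶ b) (g : b ⟶ d),
        T.vcomp (T.hcomp (S.η f) (S.η g)) (S.μ (p.map f) (p.map g))
          (by rw [T.tgt_hcomp, S.tgt_η, S.tgt_η, S.src_μ]) =
        T.vcomp (T.τ (f ≫ g) (ev2 c f g)) (S.η (f ≫ g)) (by rw [T.tgt_τ, S.src_η]) :=
      hc a b d
    -- A horizontal composite of two automorphisms splits, by interchange with identity tracks, into
    -- its push part and its pull part.
    have e1 : T.hcomp (T.τ (T.src α) (κ a b α)) (T.τ (T.src β) (κ b d β)) =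
        T.τ (T.src α ≫ T.src β) (push D (p.map (T.src β)) (κ a b α) +
          pull D (p.map (T.src α)) (κ b d β)) := by
      rw [T.τ_add, ← vcomp_congr (T.τ_push _ _ _) (T.τ_pull _ _ _)
        (by rw [T.tgt_hcomp, T.src_hcomp, T.tgt_τ, T.src_τ, T.tgt_zero, T.src_zero]),
        ← T.interchange _ _ _ _ (by rw [T.tgt_τ, T.src_zero]) (by rw [T.tgt_zero, T.src_τ]),
        vcomp_zero', zero_vcomp']
    -- `(α η) (β η) μ` computed in two ways
    have hm : T.tgt (T.hcomp (S.η (T.tgt α)) (S.η (T.tgt β))) =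
        T.src (S.μ (p.map (T.tgt α)) (p.map (T.tgt β))) := by
      rw [T.tgt_hcomp, S.tgt_η, S.tgt_η, S.src_μ]
    have hm' : T.tgt (T.hcomp (S.η (T.src α)) (S.η (T.src β))) =
        T.src (S.μ (p.map (T.tgt α)) (p.map (T.tgt β))) := by
      rw [T.tgt_hcomp, S.tgt_η, S.tgt_η, S.src_μ, T.map_src, T.map_src]
    have i1 : T.tgt (T.hcomp α β) = T.src (T.hcomp (S.η (T.tgt α)) (S.η (T.tgt β))) := by
      rw [T.tgt_hcomp, T.src_hcomp, S.src_η, S.src_η]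
    have i2 : T.tgt (T.hcomp (T.τ (T.src α) (κ a b α)) (T.τ (T.src β) (κ b d β))) =
        T.src (T.hcomp (S.η (T.src α)) (S.η (T.src β))) := by
      rw [T.tgt_hcomp, T.src_hcomp, S.src_η, S.src_η, T.tgt_τ, T.tgt_τ]
    have e2 : T.vcomp (T.hcomp α β) (T.hcomp (S.η (T.tgt α)) (S.η (T.tgt β))) i1 =
        T.vcomp (T.hcomp (T.τ (T.src α) (κ a b α)) (T.τ (T.src β) (κ b d β)))
          (T.hcomp (S.η (T.src α)) (S.η (T.src β))) i2 := by
      rw [← T.interchange _ _ _ _ (S.src_η _).symm (S.src_η _).symm,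
        ← T.interchange _ _ _ _ (by rw [T.tgt_τ, S.src_η]) (by rw [T.tgt_τ, S.src_η]), hκ, hκ]
    have e3 : T.vcomp (T.vcomp (T.hcomp α β) (T.hcomp (S.η (T.tgt α)) (S.η (T.tgt β))) i1)
        (S.μ (p.map (T.tgt α)) (p.map (T.tgt β))) ((T.tgt_vcomp _ _ _).trans hm) =
        T.vcomp (T.vcomp (T.hcomp (T.τ (T.src α) (κ a b α)) (T.τ (T.src β) (κ b d β)))
          (T.hcomp (S.η (T.src α)) (S.η (T.src β))) i2)
        (S.μ (p.map (T.tgt α)) (p.map (T.tgt β))) ((T.tgt_vcomp _ _ _).trans hm') :=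
      vcomp_congr e2 rfl _
    have e4 : T.vcomp (T.hcomp (S.η (T.src α)) (S.η (T.src β)))
        (S.μ (p.map (T.tgt α)) (p.map (T.tgt β))) hm' =
        T.vcomp (T.τ (T.src α ≫ T.src β) (ev2 c (T.src α) (T.src β)))
          (S.η (T.src α ≫ T.src β)) (by rw [T.tgt_τ, S.src_η]) := by
      rw [← e0]; exact vcomp_congr rfl (by rw [T.map_src, T.map_src]) _
    have j1 : T.tgt (T.hcomp α β) =
        T.src (T.τ (T.tgt α ≫ T.tgt β) (ev2 c (T.tgt α) (T.tgt β))) := by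
      rw [T.tgt_hcomp, T.src_τ]
    rw [T.vcomp_assoc _ _ _ i1 hm, T.vcomp_assoc _ _ _ i2 hm', vcomp_congr rfl (e0 _ _),
      vcomp_congr rfl e4, ← T.vcomp_assoc _ _ _ j1 (by rw [T.tgt_τ, S.src_η]),
      vcomp_congr e1 rfl, ← T.vcomp_assoc _ _ _ (by rw [T.tgt_τ, T.src_τ])
        (by rw [T.tgt_τ, S.src_η]), vcomp_congr (T.τ_add _ _ _).symm rfl] at e3
    -- The value of `c` at the targets arises as an automorphism after `α * β`; conjugation brings
    -- it to the source, where all the automorphisms can be added.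
    have e5 : T.vcomp (T.hcomp α β) (T.τ (T.tgt α ≫ T.tgt β) (ev2 c (T.tgt α) (T.tgt β))) j1 =
        T.vcomp (T.τ (T.src α ≫ T.src β) (ev2 c (T.tgt α) (T.tgt β))) (T.hcomp α β)
          (by rw [T.tgt_τ, T.src_hcomp]) := by
      have := T.τ_conj (T.hcomp α β) (ev2 c (T.tgt α) (T.tgt β))
      simp only [T.src_hcomp, T.tgt_hcomp] at this
      exact this.symm
    have e6 := hκ _ _ (T.hcomp α β)
    simp only [T.src_hcomp, T.tgt_hcomp] at e6
    rw [vcomp_congr e5 rfl, T.vcomp_assoc _ _ _ _ (by rw [T.tgt_hcomp, S.src_η]),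
      vcomp_congr rfl e6, ← T.vcomp_assoc _ _ _ (by rw [T.tgt_τ, T.src_τ])
        (by rw [T.tgt_τ, S.src_η]), vcomp_congr (T.τ_add _ _ _).symm rfl] at e3
    have e7 := T.τ_injective _ (vcomp_right_cancel _ _ e3)
    rw [← add_sub_assoc, ← e7, add_sub_cancel_left]

/-- This replaces the choices in the definition of the class by coordinates for one given
representative. Choices with cochain `c'` yield coordinates for `c'`, and a change by a 1-cochain
makes them coordinates for `c`. Conversely, coordinates guarantee that choices can be made, and the
resulting cochain is cohomologous to `c` by `exists_diff`. -/
theorem represents_iff (hs : ∀ {a b : K} (α : p.obj a ⟶ p.obj b), ∃ f, p.map f = α)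
    (h2 : ∀ c : Cochain2 (res D p), Descends2 c ↔ c ∈ (res2 D p).range)
    {c : Cochain2 (res D p)} (hc : d2 (res D p) c ∈ (res3 D p).range) :
    T.Represents (relClass c hc) ↔ ∃ κ, T.IsCoord c κ := by
  constructor
  · rintro ⟨S, c', hc', hS, h⟩
    obtain ⟨κ, hκ⟩ := Choice.exists_coord hS
    obtain ⟨t, ht⟩ := (relClass_eq_iff ((mem_ker_rd2 c').1 hc') hc).1 h.symm
    exact ⟨_, hκ.change t ((h2 _).2 ht)⟩
  · rintro ⟨κ, hκ⟩
    have hs' := @hs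
    choose s hs using @hs
    have h1 : ∀ {a b : K} (f : a ⟶ b), ∃ η, T.src η = f ∧ T.tgt η = s (p.map f) ∧ κ a b η = 0 :=
      fun f => hκ.exists_track f _ (hs _).symm 0
    have h3 : ∀ {a b d : K} (α : p.obj a ⟶ p.obj b) (β : p.obj b ⟶ p.obj d), ∃ μ,
        T.src μ = s α ≫ s β ∧ T.tgt μ = s (α ≫ β) ∧ κ a d μ = 0 :=
      fun α β => hκ.exists_track _ _ (by rw [p.map_comp, hs, hs, hs]) 0
    choose η hη hη' hη0 using @h1
    choose μ hμ hμ' hμ0 using @h3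
    let S : T.Choice := ⟨s, hs, η, hη, hη', μ, hμ, hμ'⟩
    obtain ⟨c', hS⟩ := S.exists_cochain
    have hS' := hS
    obtain ⟨κ', hκ'⟩ := Choice.exists_coord hS
    obtain ⟨t, ht⟩ := IsCoord.exists_diff hs' hκ hκ'
    rw [h2] at ht
    -- The cochain of the choices is `c` plus a coboundary plus a cochain restricted from `C`, so
    -- its coboundary again comes from `C`; `h5` is the identity `d2 ∘ d1 = 0`.
    have hc' : d2 (res D p) c' ∈ (res3 D p).range := by
      obtain ⟨b, hb⟩ := ht
      have h4 : c' = c + d1 (res D p) t + res2 D p b := by rw [hb]; abel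
      have h5 : d2 (res D p) (d1 (res D p) t) = 0 := by
        funext a b d e f g h
        change ev3 (d2 (res D p) (d1 (res D p) t)) f g h = (0 : Coef D (p.obj a) (p.obj e))
        simp only [ev3_d2, ev2_d1, map_add, map_sub, p.map_comp, push_comp, pull_comp, push_pull,
          Category.assoc]
        abel
      rw [h4, map_add, map_add, h5, add_zero, d2_res2]
      exact add_mem hc ⟨_, rfl⟩
    exact ⟨S, c', (mem_ker_rd2 c').2 hc', hS', (relClass_eq_iff hc hc').2 ⟨t, ht⟩⟩

/-- Every linear track extension represents a unique class. -/
theorem existsUnique_represents (hs : ∀ {a b : K} (α : p.obj a ⟶ p.obj b), ∃ f, p.map f = α)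
    (h2 : ∀ c : Cochain2 (res D p), Descends2 c ↔ c ∈ (res2 D p).range)
    (h3 : ∀ c : Cochain3 (res D p), Descends3 c → c ∈ (res3 D p).range) (T : TrackExt p D) :
    ∃! x, T.Represents x := by
  have hs0 := @hs
  choose s hs' using @hs
  have h1 : ∀ {a b : K} (f : a ⟶ b), ∃ η, T.src η = f ∧ T.tgt η = s (p.map f) :=
    fun f => (T.map_eq_iff _ _).1 (hs' _).symm
  have h4 : ∀ {a b d : K} (α : p.obj a ⟶ p.obj b) (β : p.obj b ⟶ p.obj d), ∃ μ,
      T.src μ = s α ≫ s β ∧ T.tgt μ = s (α ≫ β) :=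
    fun α β => (T.map_eq_iff _ _).1 (by rw [p.map_comp, hs', hs', hs'])
  choose η hη hη' using @h1
  choose μ hμ hμ' using @h4
  obtain ⟨c, hS⟩ := Choice.exists_cochain (T := T) ⟨s, hs', η, hη, hη', μ, hμ, hμ'⟩
  obtain ⟨κ, hκ⟩ := Choice.exists_coord hS
  -- The relative cocycle condition is supplied by the associativity of horizontal composition.
  have hc := h3 _ hκ.descends3
  refine ⟨relClass c hc, (represents_iff hs0 h2 hc).2 ⟨κ, hκ⟩, fun y hy => ?_⟩
  obtain ⟨c', hc', rfl⟩ := exists_relClass y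
  obtain ⟨κ', hκ'⟩ := (represents_iff hs0 h2 hc').1 hy
  -- A second represented class has coordinates of its own on the same `T`, and two coordinate
  -- systems have cohomologous cochains.
  obtain ⟨t, ht⟩ := hκ'.exists_diff hs0 hκ
  exact (relClass_eq_iff hc' hc).2 ⟨t, (h2 _).1 ht⟩

end TrackExt

end CochainClasses

/-! ### Cochains on `mod-Q` that come from `mod-R` -/

section Extensions

variable {Q : SquareRing.{u}} {R : Type u} [Ring R] (p : Q.Hom (SquareRing.ofRing R))

namespace ModSq

open BWCoh

theorem toRing_map_eq_iff {y x : ModSq Q} (f g : y ⟶ x) :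
    (toRing p).map f = (toRing p).map g ↔ ∀ k i, p.e ((f k).e i) = p.e ((g k).e i) :=
  ⟨fun h k i => congrFun (congrFun h i) k, fun h => Matrix.ext fun i k => h k i⟩

variable {p}

theorem toRing_map_surjective (hp : Function.Surjective p.e) {y x : ModSq Q}
    (α : (toRing p).obj y ⟶ (toRing p).obj x) : ∃ f : y ⟶ x, (toRing p).map f = α := by
  choose s hs using hp
  exact ⟨fun k => ⟨fun i => s ((α : Matrix (Fin x.rank) (Fin y.rank) R) i k), fun _ _ _ => 0⟩,
    Matrix.ext fun i k => hs _⟩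

variable {D : (ModRing R)ᵒᵖ ⥤ ModRing R ⥤ AddCommGrpCat.{u}}

/-- The functor to `mod-R` is bijective on objects and full, so a cochain whose values depend only
on images is evaluated on chosen lifts to give a cochain on `mod-R`. -/
theorem descends2_iff (hp : Function.Surjective p.e) (c : Cochain2 (res D (toRing p))) :
    Descends2 c ↔ c ∈ (res2 D (toRing p)).range := by
  constructor
  · intro h
    have hs : ∀ {a b : ModRing R} (α : a ⟶ b),
        ∃ f : (⟨a.rank⟩ : ModSq Q) ⟶ ⟨b.rank⟩, (toRing p).map f = α :=
      fun {a b} α => toRing_map_surjective (y := ⟨a.rank⟩) (x := ⟨b.rank⟩) hp α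
    choose s hs using @hs
    refine ⟨fun a b d α β => ev2 c (s α) (s β), ?_⟩
    funext a b d f g
    exact h _ _ _ _ (hs ((toRing p).map f)) (hs ((toRing p).map g))
  · rintro ⟨t, rfl⟩ a b d f f' g g' hf hg
    change t _ _ _ ((toRing p).map f) ((toRing p).map g) = t _ _ _ ((toRing p).map f')
      ((toRing p).map g')
    rw [hf, hg]

theorem descends3_iff (hp : Function.Surjective p.e) (c : Cochain3 (res D (toRing p))) :
    Descends3 c ↔ c ∈ (res3 D (toRing p)).range := by
  constructor
  · intro h
    have hs : ∀ {a b : ModRing R} (α : a ⟶ b),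
        ∃ f : (⟨a.rank⟩ : ModSq Q) ⟶ ⟨b.rank⟩, (toRing p).map f = α :=
      fun {a b} α => toRing_map_surjective (y := ⟨a.rank⟩) (x := ⟨b.rank⟩) hp α
    choose s hs using @hs
    refine ⟨fun a b d e α β γ => ev3 c (s α) (s β) (s γ), ?_⟩
    funext a b d e f g h'
    exact h _ _ _ _ _ _ (hs ((toRing p).map f)) (hs ((toRing p).map g)) (hs ((toRing p).map h'))
  · rintro ⟨t, rfl⟩ a b d e f f' g g' k k' hf hg hk
    change t _ _ _ _ ((toRing p).map f) ((toRing p).map g) ((toRing p).map k) =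
      t _ _ _ _ ((toRing p).map f') ((toRing p).map g') ((toRing p).map k')
    rw [hf, hg, hk]

end ModSq

variable {p} {M : Type u} [AddCommGroup M] [Module R M] [Module Rᵐᵒᵖ M] [SMulCommClass R Rᵐᵒᵖ M]

/-! ### Morphisms of extensions: invertibility and pullback of coordinates -/

namespace CrossedExt

set_option linter.unusedSectionVars false

open BWCoh CrossedSquareRing RightModule

section Morphism

variable {E E' : CrossedExt p M} (f : CrossedExt.Hom E E')

/-- The five lemma: both rows are exact, and the map is the identity on `M` and on `Q`. -/
theorem Hom.bijective : Function.Bijective f.f := by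
  constructor
  · refine (injective_iff_map_eq_zero f.f).2 fun r hr => ?_
    have h1 : E.d r = 0 := by rw [← f.d_f, hr, map_zero]
    obtain ⟨m, rfl⟩ := (E.range_ι r).1 h1
    rw [f.f_ι, ← E'.ι.map_zero] at hr
    rw [E'.ι_injective hr, map_zero]
  · intro r
    have h1 : p.e (E'.d r) = 0 := (E'.range_d _).2 ⟨r, rfl⟩
    obtain ⟨s, hs⟩ := (E.range_d _).1 h1
    have h2 : E'.d (r - f.f s) = 0 := by rw [map_sub, f.d_f, hs, sub_self]
    obtain ⟨m, hm⟩ := (E'.range_ι _).1 h2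
    refine ⟨E.ι m + s, ?_⟩
    rw [map_add, f.f_ι, hm, sub_add_cancel]

/-- The inverse of a morphism of crossed square ring extensions. -/
noncomputable def Hom.inv : CrossedExt.Hom E' E :=
  let e := AddEquiv.ofBijective f.f f.bijective
  have h : ∀ r, f.f (e.symm r) = r := e.apply_symm_apply
  { f := e.symm.toAddMonoidHom
    f_P := fun a => f.bijective.1 ((h _).trans (f.f_P a).symm)
    d_f := fun r => (f.d_f _).symm.trans (congrArg E'.d (h r))
    f_l := fun x r => f.bijective.1
      ((h _).trans ((congrArg (E'.l x) (h r)).symm.trans (f.f_l x _).symm))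
    f_rr := fun r x => f.bijective.1
      ((h _).trans ((congrArg (fun r => E'.rr r x) (h r)).symm.trans (f.f_rr _ x).symm))
    f_ι := fun m => f.bijective.1 ((h _).trans (f.f_ι m).symm) }

theorem isIso (f : E ⟶ E') : IsIso f := by
  let g : CrossedExt.Hom E E' := f
  refine ⟨(Hom.inv g : E' ⟶ E), ?_, ?_⟩
  · exact CrossedExt.Hom.ext (AddMonoidHom.ext fun r =>
      (AddEquiv.ofBijective g.f g.bijective).symm_apply_apply r)
  · exact CrossedExt.Hom.ext (AddMonoidHom.ext fun r =>
      (AddEquiv.ofBijective g.f g.bijective).apply_symm_apply r)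

/-- The morphism between the square rings of tracks induced by a morphism of extensions. -/
def Hom.trackHom : E.trackRing.Hom E'.trackRing where
  e X := ⟨f.f (Tr.r X), Tr.x X⟩
  ee := AddMonoidHom.id _
  map_add X Y := Tr.ext (by
    change f.f (Tr.r X + Tr.r Y + E.P (B Q (E.d (Tr.r Y)) (Tr.x X))) =
      f.f (Tr.r X) + f.f (Tr.r Y) + E'.P (B Q (E'.d (f.f (Tr.r Y))) (Tr.x X))
    rw [map_add, map_add, f.f_P, f.d_f]) rfl
  map_one := Tr.ext (map_zero f.f) rfl
  map_mul X Y := Tr.ext (by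
    change f.f (E.rr (Tr.r X) (E.d (Tr.r Y) + Tr.x Y) + E.l (Tr.x X) (Tr.r Y) +
      E.P (Q.act (E.d (Tr.r X)) (Tr.x X) (Q.H (E.d (Tr.r Y) + Tr.x Y)) 1)) =
      E'.rr (f.f (Tr.r X)) (E'.d (f.f (Tr.r Y)) + Tr.x Y) + E'.l (Tr.x X) (f.f (Tr.r Y)) +
      E'.P (Q.act (E'.d (f.f (Tr.r X))) (Tr.x X) (Q.H (E'.d (f.f (Tr.r Y)) + Tr.x Y)) 1)
    rw [map_add, map_add, f.f_P, f.d_f, f.f_rr, f.f_l, f.d_f]) rfl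
  map_P a := Tr.ext (f.f_P _) rfl
  map_H X := by
    change (Q.H (E.d (Tr.r X) + Tr.x X), Q.H (Tr.x X)) =
      (Q.H (E'.d (f.f (Tr.r X)) + Tr.x X), Q.H (Tr.x X))
    rw [f.d_f]
  map_act X Y a Z := by
    change (Q.act (E.d (Tr.r X) + Tr.x X) (E.d (Tr.r Y) + Tr.x Y) a.1 (E.d (Tr.r Z) + Tr.x Z), _) =
      (Q.act (E'.d (f.f (Tr.r X)) + Tr.x X) (E'.d (f.f (Tr.r Y)) + Tr.x Y) a.1
        (E'.d (f.f (Tr.r Z)) + Tr.x Z), _)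
    rw [f.d_f, f.d_f, f.d_f]; rfl

variable {c : Cochain2 (res (matBifunctor R M) (ModSq.toRing p))}

/-- Coordinates can be pulled back along a morphism of extensions. -/
theorem Hom.exists_coord (f : CrossedExt.Hom E E') (h : ∃ κ, E'.tracks.IsCoord c κ) :
    ∃ κ, E.tracks.IsCoord c κ := by
  obtain ⟨κ, hκ⟩ := h
  -- Applying `f` to every entry is a map of track extensions over `mod-Q` that fixes the
  -- automorphisms `τ`, so composing `κ` with it gives coordinates on the tracks of `E`.
  let F : ∀ {a b : ModSq Q}, E.tracks.Tr a b → E'.tracks.Tr a b :=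
    fun α k => (α k).map f.trackHom
  have hsrc : ∀ {a b : ModSq Q} (α : E.tracks.Tr a b), E'.tracks.src (F α) = E.tracks.src α :=
    fun α => funext fun k => FreeMod.ext'
      (fun i => congrArg (· + Tr.x ((α k).e i)) (f.d_f _)) (fun _ _ _ => rfl)
  have htgt : ∀ {a b : ModSq Q} (α : E.tracks.Tr a b), E'.tracks.tgt (F α) = E.tracks.tgt α :=
    fun α => rfl
  refine ⟨fun a b α => κ a b (F α), ⟨fun {a b} α β h => ?_, fun {a b} g x => ?_,
    fun {a b d} α β => ?_⟩⟩
  · rw [← hκ.vcomp (F α) (F β) (by rw [hsrc, htgt, h])]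
    congr 1
    exact funext fun k => FreeMod.ext' (fun i => Tr.ext (map_add f.f _ _) rfl) (fun _ _ _ => rfl)
  · refine Eq.trans (congrArg (κ a b) ?_) (hκ.τ g x)
    exact funext fun k => FreeMod.ext' (fun i => Tr.ext (f.f_ι _) rfl) (fun _ _ _ => rfl)
  · have h1 : F (E.tracks.hcomp α β) = E'.tracks.hcomp (F α) (F β) :=
      funext fun k => FreeMod.map_lift f.trackHom β (α k)
    change κ a d (F (E.tracks.hcomp α β)) = _
    rw [h1, hκ.hcomp, hsrc, hsrc, htgt, htgt]

end Morphism

end CrossedExt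

end Extensions

/-! ### Free modules of rank one and two, projections and generating brackets -/

namespace FreeMod

open RightModule

variable {Q : SquareRing.{u}} {n : ℕ}

theorem lift_fin_one {M : Type u} [AddGroup M] [RightModule Q M] (f : Fin 1 → M)
    (g : FreeMod Q 1) : lift f g = sm (f 0) (g.e 0) := by
  rw [lift_eq, psum_eq_sum, osum_succ]
  simp

theorem lift_gen_add_gen {M : Type u} [AddGroup M] [RightModule Q M] (f : Fin n → M)
    (i j : Fin n) : lift f (gen Q i + gen Q j) = f i + f j := by
  rw [lift_add, lift_gen, lift_gen]

theorem lift_br_gen {M : Type u} [AddGroup M] [RightModule Q M] (f : Fin n → M)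
    (i j : Fin n) (a : Q.ee) : lift f (br (gen Q i) (gen Q j) a) = br (f i) (f j) a := by
  rw [lift_br, lift_gen, lift_gen]

/-- The element of the free module of rank one given by an element of `Q`. -/
def single (x : Q.e) : FreeMod Q 1 := ⟨fun _ => x, fun _ _ _ => 0⟩

theorem ext_one {v w : FreeMod Q 1} (h : v.e 0 = w.e 0) : v = w :=
  ext' (fun i => by rw [Subsingleton.elim i 0, h])
    (fun i j hij => absurd hij (by rw [Subsingleton.elim i j]; exact lt_irrefl _))

theorem single_e (v : FreeMod Q 1) : single (v.e 0) = v := ext_one rfl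

/-- The projections from the free module of rank `n` to the free module of rank one. -/
def proj (Q : SquareRing.{u}) (i : Fin n) : Fin n → FreeMod Q 1 :=
  fun j => single (if j = i then 1 else 0)

theorem lift_proj (i : Fin n) (v : FreeMod Q n) : lift (proj Q i) v = single (v.e i) := by
  refine ext_one ?_
  rw [lift_e, osum_single i]
  -- In a pair `k < l` at most one index is `i`, so every bracket term contains a zero entry of the
  -- projection.
  · rw [psum_eq_sum, Finset.sum_eq_zero]
    · simp [proj, single]
    · intro k _
      refine Finset.sum_eq_zero fun l _ => ?_
      split_ifs with hkl
      · by_cases hk : k = i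
        · have : l ≠ i := by rw [← hk]; exact hkl.ne'
          simp [proj, single, this]
        · simp [proj, single, hk]
      · rfl
  · intro k hk
    simp [proj, single, hk]

theorem map_single {A B : SquareRing.{u}} (φ : A.Hom B) (x : A.e) :
    (single x).map φ = single (φ.e x) :=
  ext_one rfl

theorem map_add {A B : SquareRing.{u}} (φ : A.Hom B) (v w : FreeMod A n) :
    (v + w).map φ = v.map φ + w.map φ :=
  ext' (fun i => φ.map_add _ _) (fun i j h => by
    simp [map, φ.map_act, φ.map_H_two, φ.map_one])

theorem map_proj {A B : SquareRing.{u}} (φ : A.Hom B) (i j : Fin n) :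
    (proj A i j).map φ = proj B i j := by
  rw [proj, map_single, proj, apply_ite φ.e, φ.map_one, φ.map_zero]

theorem lift_single_single (x y : Q.e) :
    lift (fun _ : Fin 1 => single x) (single y) = single (x * y) := by
  rw [lift_fin_one]; exact ext_one rfl

/-- The bracket of the two generators of rank two has `a` as its only nontrivial component, by this
and `br_gen_e`. Elements of `Q.ee` thereby appear as morphisms from rank one to rank two, which is
how `P` is expressed through composition. -/
theorem br_gen_ee (a : Q.ee) : (br (gen Q (0 : Fin 2)) (gen Q 1) a).ee 0 1 Fin.zero_lt_one = a := by
  simp [br, bracket, gen, Q.act_one]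

theorem br_gen_e (a : Q.ee) (i : Fin 2) : (br (gen Q (0 : Fin 2)) (gen Q 1) a).e i = 0 := by
  fin_cases i <;> simp [br, bracket, gen]

theorem ext_two {v w : FreeMod Q 2} (h : ∀ i, v.e i = w.e i)
    (h' : v.ee 0 1 Fin.zero_lt_one = w.ee 0 1 Fin.zero_lt_one) : v = w := by
  refine ext' h (fun i j hij => ?_)
  have hi : i = 0 := by omega
  have hj : j = 1 := by omega
  subst hi hj
  exact h'

end FreeMod

/-! ### Recovering a morphism of extensions from equal coordinates -/

section Extensions

variable {Q : SquareRing.{u}} {R : Type u} [Ring R] {p : Q.Hom (SquareRing.ofRing R)}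
  {M : Type u} [AddCommGroup M] [Module R M] [Module Rᵐᵒᵖ M] [SMulCommClass R Rᵐᵒᵖ M]

namespace CrossedExt

open BWCoh CrossedSquareRing RightModule FreeMod

variable {E E' : CrossedExt p M} {c : Cochain2 (res (matBifunctor R M) (ModSq.toRing p))}

/-- The track between endomorphisms of the object of rank one given by a single track. -/
def mat (E : CrossedExt p M) (X : E.trackRing.e) : E.tracks.Tr ⟨1⟩ ⟨1⟩ := fun _ => single X

/-- Matrix entries are composites with identity tracks. A map that respects horizontal composition
and identity tracks is therefore determined, entry by entry, by its effect in rank one. -/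
theorem mat_entry {a b : ModSq Q} (α : E.tracks.Tr a b) (k : Fin a.rank) (i : Fin b.rank) :
    E.tracks.hcomp (E.tracks.hcomp (E.tracks.zero (a := ⟨1⟩) (fun _ => gen Q k)) α)
      (E.tracks.zero (b := ⟨1⟩) (proj Q i)) = E.mat ((α k).e i) := by
  funext l
  change lift (fun j => (proj Q i j).map E.zeroHom) (lift α ((gen Q k).map E.zeroHom)) = _
  simp only [map_proj, map_gen]
  exact (congrArg (lift (proj E.trackRing i)) (lift_gen α k)).trans (lift_proj i (α k))

/-- The track from the object of rank two to the object of rank one given by two single tracks. -/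
def row (E : CrossedExt p M) (X Y : E.trackRing.e) : E.tracks.Tr ⟨2⟩ ⟨1⟩ :=
  fun k => single (if k = 0 then X else Y)

/-- Addition of tracks is a horizontal composition, so every map compatible with `hcomp` and
identity tracks is additive once its effect on rows is known. -/
theorem zero_add_row (E : CrossedExt p M) (X Y : E.trackRing.e) :
    E.tracks.hcomp (E.tracks.zero (a := ⟨1⟩) (b := ⟨2⟩) (fun _ => gen Q 0 + gen Q 1))
      (E.row X Y) = E.mat (X + Y) := funext fun _ => by
  have e1 : (gen Q (0 : Fin 2) + gen Q 1).map E.zeroHom =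
      gen E.trackRing 0 + gen E.trackRing 1 := by
    rw [FreeMod.map_add, map_gen, map_gen]
  change lift (E.row X Y) ((gen Q 0 + gen Q 1).map E.zeroHom) = _
  rw [e1]
  exact (lift_gen_add_gen (Q := E.trackRing) (E.row X Y) 0 1).trans (ext_one rfl)

/-- The track between brackets of the two generators given by a pair of elements of `Q.ee`. -/
def brTrack (E : CrossedExt p M) (a : E.trackRing.ee) : E.tracks.Tr ⟨1⟩ ⟨2⟩ :=
  fun _ => br (gen E.trackRing (0 : Fin 2)) (gen E.trackRing 1) a

/-- The same device for `P`: the bracket track composed with the row of two units is `P a`. -/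
theorem brTrack_row (E : CrossedExt p M) (a : E.trackRing.ee) :
    E.tracks.hcomp (E.brTrack a) (E.row 1 1) = E.mat (E.trackRing.P a) := funext fun _ => by
  refine (lift_br_gen (Q := E.trackRing) (E.row 1 1) 0 1 a).trans (ext_one ?_)
  change E.trackRing.P (E.trackRing.act 1 1 a 1) = _
  rw [E.trackRing.act_one]; rfl

/-- Two extensions whose track extensions have coordinates for the same cochain are isomorphic. -/
theorem exists_hom_of_coord (hE : ∃ κ, E.tracks.IsCoord c κ) (hE' : ∃ κ, E'.tracks.IsCoord c κ) :
    Nonempty (CrossedExt.Hom E E') := by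
  obtain ⟨κ, hκ⟩ := hE
  obtain ⟨κ', hκ'⟩ := hE'
  -- `F α` is the only track of `E'` with the source, target and coordinate of `α`. Since the
  -- coordinate rules involve nothing but these data and the common cochain `c`, compatibility with
  -- each operation follows by comparing coordinates.
  have h1 : ∀ {a b : ModSq Q} (α : E.tracks.Tr a b), ∃ β, E'.tracks.src β = E.tracks.src α ∧
      E'.tracks.tgt β = E.tracks.tgt α ∧ κ' a b β = κ a b α :=
    fun α => hκ'.exists_track _ _ (E.tracks.map_src α) _
  choose F hsrc htgt hF using @h1
  have F_zero : ∀ {a b : ModSq Q} (f : a ⟶ b), F (E.tracks.zero f) = E'.tracks.zero f :=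
    fun f => hκ'.ext ((hsrc _).trans (by rw [E.tracks.src_zero, E'.tracks.src_zero]))
      ((htgt _).trans (by rw [E.tracks.tgt_zero, E'.tracks.tgt_zero]))
      (by rw [hF, hκ.zero, hκ'.zero])
  have F_τ : ∀ {a b : ModSq Q} (f : a ⟶ b) x, F (E.tracks.τ f x) = E'.tracks.τ f x :=
    fun f x => hκ'.ext ((hsrc _).trans (by rw [E.tracks.src_τ, E'.tracks.src_τ]))
      ((htgt _).trans (by rw [E.tracks.tgt_τ, E'.tracks.tgt_τ]))
      (by rw [hF, hκ.τ, hκ'.τ])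
  have F_hcomp : ∀ {a b d : ModSq Q} (α : E.tracks.Tr a b) (β : E.tracks.Tr b d),
      F (E.tracks.hcomp α β) = E'.tracks.hcomp (F α) (F β) :=
    fun α β => hκ'.ext
      ((hsrc _).trans (by rw [E.tracks.src_hcomp, E'.tracks.src_hcomp, hsrc, hsrc]))
      ((htgt _).trans (by rw [E.tracks.tgt_hcomp, E'.tracks.tgt_hcomp, htgt, htgt]))
      (by rw [hF, hκ.hcomp, hκ'.hcomp, hF, hF, hsrc, hsrc, htgt, htgt])
  -- `G` is the restriction of `F` to endomorphisms of rank one; by `mat_entry` it controls all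
  -- entries of `F α`.
  let G : E.trackRing.e → E'.trackRing.e := fun X => ((F (E.mat X)) 0).e 0
  have F_mat : ∀ X, F (E.mat X) = E'.mat (G X) := fun X => funext fun k => by
    rw [Subsingleton.elim k 0]
    exact (single_e _).symm
  have F_e : ∀ {a b : ModSq Q} (α : E.tracks.Tr a b) k i, (F α k).e i = G ((α k).e i) := by
    intro a b α k i
    have h := congrArg F (mat_entry α k i)
    rw [F_hcomp, F_hcomp, F_zero, F_zero, mat_entry, F_mat] at h
    exact congrFun (congrArg FreeMod.e (congrFun h 0)) 0
  -- The `ee` components of a track are pairs formed from its source and its target, which `F`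
  -- preserves.
  have F_ee : ∀ {a b : ModSq Q} (α : E.tracks.Tr a b) k i j hij,
      (F α k).ee i j hij = (α k).ee i j hij := by
    intro a b α k i j hij
    refine Prod.ext ?_ ?_
    · exact congrFun (congrFun (congrFun (congrArg FreeMod.ee (congrFun (hsrc α) k)) i) j) hij
    · exact congrFun (congrFun (congrFun (congrArg FreeMod.ee (congrFun (htgt α) k)) i) j) hij
  have G_src : ∀ X, Tr.src (G X) = Tr.src X := fun X =>
    congrFun (congrArg FreeMod.e (congrFun (hsrc (E.mat X)) 0)) 0
  have G_x : ∀ X, Tr.x (G X) = Tr.x X := fun X =>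
    congrFun (congrArg FreeMod.e (congrFun (htgt (E.mat X)) 0)) 0
  have G_of : ∀ {X : E.trackRing.e} {Y : E'.trackRing.e}, F (E.mat X) = E'.mat Y → G X = Y :=
    fun h => congrFun (congrArg FreeMod.e (congrFun h 0)) 0
  have G_zero : ∀ x, G (E.zeroHom.e x) = E'.zeroHom.e x := fun x => by
    refine G_of ?_
    have h := F_zero (a := ⟨1⟩) (b := ⟨1⟩) (fun _ => single x)
    exact h
  have G_mul : ∀ X Y, G (X * Y) = G X * G Y := fun X Y => by
    refine G_of ?_
    have h := F_hcomp (E.mat Y) (E.mat X)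
    rw [F_mat, F_mat] at h
    have e : ∀ (E : CrossedExt p M) (X Y : E.trackRing.e),
        E.tracks.hcomp (E.mat Y) (E.mat X) = E.mat (X * Y) :=
      fun E X Y => funext fun _ => lift_single_single X Y
    rwa [e, e] at h
  have F_row : ∀ X Y, F (E.row X Y) = E'.row (G X) (G Y) := fun X Y => funext fun k => by
    refine ext_one ?_
    rw [F_e]
    exact apply_ite G _ _ _
  have G_add : ∀ X Y, G (X + Y) = G X + G Y := fun X Y => by
    refine G_of ?_
    have h := F_hcomp (E.tracks.zero (a := ⟨1⟩) (b := ⟨2⟩) (fun _ => gen Q 0 + gen Q 1)) (E.row X Y)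
    rw [zero_add_row, F_zero, F_row, zero_add_row] at h
    exact h
  have G_P : ∀ a, G (Tr.ofP _ a) = Tr.ofP _ a := fun a => by
    refine G_of ?_
    -- The entries of a bracket track are zero and its `ee` component is preserved, so `F` fixes it.
    have e1 : F (E.brTrack a) = E'.brTrack a := funext fun k => ext_two (fun i => by
      refine (F_e (E.brTrack a) k i).trans ?_
      refine (congrArg G (br_gen_e (Q := E.trackRing) a i)).trans ?_
      refine Eq.trans ?_ (br_gen_e (Q := E'.trackRing) a i).symm
      exact (congrArg G E.zeroHom.map_zero).symm.trans ((G_zero 0).trans E'.zeroHom.map_zero)) (by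
      refine (F_ee (E.brTrack a) k 0 1 Fin.zero_lt_one).trans ?_
      exact (br_gen_ee (Q := E.trackRing) a).trans (br_gen_ee (Q := E'.trackRing) a).symm)
    have e2 : G 1 = 1 := (congrArg G E.zeroHom.map_one).symm.trans
      ((G_zero 1).trans E'.zeroHom.map_one)
    exact (congrArg F (brTrack_row E a)).symm.trans ((F_hcomp _ _).trans ((congrArg₂ _ e1
      ((F_row 1 1).trans (congrArg₂ _ e2 e2))).trans (brTrack_row E' a)))
  -- `C1` sits among the tracks as those with target zero, and `Q` as the identity tracks. By
  -- `e_add`, `e_l` and `e_rr`, the operations of the track ring on these two kinds of elements are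
  -- the sum and the two actions of the extension.
  let f : E.C1 → E'.C1 := fun r => Tr.r (G (⟨r, 0⟩ : Tr _))
  have G_f : ∀ r, G (⟨r, 0⟩ : Tr _) = (⟨f r, 0⟩ : Tr _) := fun r => Tr.ext rfl (G_x _)
  have f_of : ∀ {r : E.C1} {s : E'.C1}, G (⟨r, 0⟩ : Tr _) = (⟨s, 0⟩ : Tr _) → f r = s :=
    fun h => congrArg Tr.r h
  have d_f : ∀ r, E'.d (f r) = E.d r := fun r => by
    have h := G_src (⟨r, 0⟩ : Tr _)
    rw [G_f] at h
    simpa [Tr.src] using h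
  have e_add : ∀ (E : CrossedExt p M) (r s : E.C1),
      ((⟨r, 0⟩ : Tr E.toCrossedSquareRing) + ⟨s, 0⟩ : Tr E.toCrossedSquareRing) = ⟨r + s, 0⟩ :=
    fun E r s => Tr.ext (by
      change r + s + E.P (B Q (E.d s) 0) = r + s
      rw [B_zero_right, map_zero, add_zero]) (add_zero _)
  have e_l : ∀ (E : CrossedExt p M) (x : Q.e) (r : E.C1), ((⟨0, x⟩ : Tr E.toCrossedSquareRing) *
      (⟨r, 0⟩ : Tr E.toCrossedSquareRing)) = ⟨E.l x r, 0⟩ :=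
    fun E x r => Tr.ext (by
      rw [Tr.mul_r]
      simp [E.zero_rr, E.pr_zero]) (Q.mul_zero x)
  have e_rr : ∀ (E : CrossedExt p M) (r : E.C1) (x : Q.e), ((⟨r, 0⟩ : Tr E.toCrossedSquareRing) *
      (⟨0, x⟩ : Tr E.toCrossedSquareRing)) = ⟨E.rr r x, 0⟩ :=
    fun E r x => Tr.ext (by
      rw [Tr.mul_r]
      simp [E.l_zero, E.pr_zero, Tr.src]) (Q.zero_mul x)
  refine ⟨⟨AddMonoidHom.mk' f fun r s => f_of ?_, fun a => f_of ?_, d_f, fun x r => f_of ?_,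
    fun r x => f_of ?_, fun m => f_of ?_⟩⟩
  · rw [← e_add, ← e_add, ← G_f, ← G_f]
    exact G_add _ _
  · have h := G_P (a, 0)
    have e : ∀ E : CrossedExt p M, Tr.ofP E.toCrossedSquareRing (a, 0) = ⟨E.P a, 0⟩ :=
      fun E => Tr.ext (congrArg E.P (sub_zero a)) Q.P.map_zero
    rwa [e, e] at h
  · rw [← e_l]
    refine (G_mul _ _).trans ?_
    rw [G_f]
    exact (congrArg (fun Y : E'.trackRing.e => Y * (show E'.trackRing.e from
      (⟨f r, 0⟩ : Tr _))) (G_zero x)).trans (e_l E' x _)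
  · rw [← e_rr]
    refine (G_mul _ _).trans ?_
    rw [G_f]
    exact (congrArg (fun Y : E'.trackRing.e => (show E'.trackRing.e from
      (⟨f r, 0⟩ : Tr _)) * Y) (G_zero x)).trans (e_rr E' _ x)
  -- Inside the tracks, `ι m` is the automorphism `τ` of zero given by the `1 × 1` matrix `m`.
  · refine G_of ?_
    exact F_τ (a := ⟨1⟩) (b := ⟨1⟩) (fun _ => single 0) (Matrix.of fun _ _ => m)

end CrossedExt

end Extensions

/-! ### The category of tracks twisted by a cochain -/

section CochainTracks

open BWCoh

universe v w

variable {C K : Type w} [Category.{v} C] [Category.{v} K] {p : K ⥤ C}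
  {D : Cᵒᵖ ⥤ C ⥤ AddCommGrpCat.{u}}

/-- The category of tracks given by a `2`-cochain `c` on `K` whose coboundary comes from `C`. It has
the same objects as `K`. -/
structure TrackCat (c : Cochain2 (res D p)) (hc : Descends3 (d2 (res D p) c)) : Type w where
  obj : K

namespace TrackCat

variable {c : Cochain2 (res D p)} {hc : Descends3 (d2 (res D p) c)}

/-- A track `s ⇒ t` between morphisms of `K` with the same image in `C`. -/
@[ext] structure Hom (a b : TrackCat c hc) : Type (max u v) where
  s : a.obj ⟶ b.obj
  t : a.obj ⟶ b.obj
  h : p.map s = p.map t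
  x : Coef D (p.obj a.obj) (p.obj b.obj)

theorem push_id {a b : C} (x : Coef D a b) : push D (𝟙 b) x = x := by simp [push]

theorem pull_id {a b : C} (x : Coef D a b) : pull D (𝟙 a) x = x := by simp [pull]

-- In `d2 c` evaluated at two identities and `f`, everything cancels except the push of `c (𝟙, 𝟙)`
-- and the term `- c (𝟙, f)`. Hence `c (𝟙, f)` depends only on the image of `f`, which makes the
-- identity with coordinate zero a unit although `c` is not normalized.
include hc in
theorem ev2_id_left {a b : K} {f g : a ⟶ b} (h : p.map f = p.map g) :
    ev2 c (𝟙 a) f = ev2 c (𝟙 a) g := by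
  have h1 := hc (𝟙 a) (𝟙 a) (𝟙 a) (𝟙 a) f g rfl rfl h
  rw [ev3_d2, ev3_d2] at h1
  simpa [h, pull_id] using h1

include hc in
theorem ev2_id_right {a b : K} {f g : a ⟶ b} (h : p.map f = p.map g) :
    ev2 c f (𝟙 b) = ev2 c g (𝟙 b) := by
  have h1 := hc f g (𝟙 b) (𝟙 b) (𝟙 b) (𝟙 b) h rfl rfl
  rw [ev3_d2, ev3_d2] at h1
  simpa [h, push_id] using h1

/-- Composition is the formula that `IsCoord` demands of horizontal composition. Its associativity
is equivalent to `d2 c` agreeing on the sources and the targets, and this is what `hc` provides. -/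
instance : Category (TrackCat c hc) where
  Hom := Hom
  id a := ⟨𝟙 a.obj, 𝟙 a.obj, rfl, 0⟩
  comp α β := ⟨α.s ≫ β.s, α.t ≫ β.t, by rw [p.map_comp, p.map_comp, α.h, β.h],
    push D (p.map β.s) α.x + pull D (p.map α.s) β.x + (ev2 c α.s β.s - ev2 c α.t β.t)⟩
  id_comp {a b} α := Hom.ext (Category.id_comp _) (Category.id_comp _) (by
    rw [ev2_id_left (hc := hc) α.h]
    simp [pull_id])
  comp_id {a b} α := Hom.ext (Category.comp_id _) (Category.comp_id _) (by
    rw [ev2_id_right (hc := hc) α.h]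
    simp [push_id])
  assoc {a b d e} α β γ := Hom.ext (Category.assoc _ _ _) (Category.assoc _ _ _) (by
    have h1 := hc α.s α.t β.s β.t γ.s γ.t α.h β.h γ.h
    rw [ev3_d2, ev3_d2, ← α.h, ← γ.h] at h1
    simp only [map_add, map_sub, p.map_comp, push_comp, pull_comp, push_pull]
    rw [← sub_eq_zero] at h1 ⊢
    rw [← h1]; abel)

variable {a b d : TrackCat c hc}

theorem hom_ext {α β : a ⟶ b} (hs : α.s = β.s) (ht : α.t = β.t) (hx : α.x = β.x) : α = β :=
  Hom.ext hs ht hx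

@[simp] theorem comp_s (α : a ⟶ b) (β : b ⟶ d) : (α ≫ β).s = α.s ≫ β.s := rfl
@[simp] theorem comp_t (α : a ⟶ b) (β : b ⟶ d) : (α ≫ β).t = α.t ≫ β.t := rfl
theorem comp_x (α : a ⟶ b) (β : b ⟶ d) : (α ≫ β).x = push D (p.map β.s) α.x +
    pull D (p.map α.s) β.x + (ev2 c α.s β.s - ev2 c α.t β.t) := rfl

/-- The track `f ⇒ f` given by an element of the coefficients. -/
def loop (f : a.obj ⟶ b.obj) (x : Coef D (p.obj a.obj) (p.obj b.obj)) : a ⟶ b :=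
  (⟨f, f, rfl, x⟩ : Hom a b)

/-- The identity tracks. -/
def z (f : a.obj ⟶ b.obj) : a ⟶ b := loop f 0

@[simp] theorem z_s (f : a.obj ⟶ b.obj) : (z f : a ⟶ b).s = f := rfl
@[simp] theorem z_t (f : a.obj ⟶ b.obj) : (z f : a ⟶ b).t = f := rfl
@[simp] theorem z_x (f : a.obj ⟶ b.obj) : (z f : a ⟶ b).x = 0 := rfl

theorem loop_z (f : a.obj ⟶ b.obj) (x : Coef D (p.obj a.obj) (p.obj b.obj))
    (g : b.obj ⟶ d.obj) : (loop f x : a ⟶ b) ≫ (z g : b ⟶ d) =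
      loop (f ≫ g) (push D (p.map g) x) :=
  hom_ext rfl rfl (by simp [comp_x, z, loop])

theorem z_loop (f : a.obj ⟶ b.obj) (g : b.obj ⟶ d.obj)
    (x : Coef D (p.obj b.obj) (p.obj d.obj)) : (z f : a ⟶ b) ≫ (loop g x : b ⟶ d) =
      loop (f ≫ g) (pull D (p.map f) x) :=
  hom_ext rfl rfl (by simp [comp_x, z, loop])

theorem z_comp_x (f : a.obj ⟶ b.obj) (β : b ⟶ d) : ((z f : a ⟶ b) ≫ β).x =
    pull D (p.map f) β.x + (ev2 c f β.s - ev2 c f β.t) := by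
  rw [comp_x, z_x, map_zero, zero_add]; rfl

theorem comp_z_x (α : a ⟶ b) (g : b.obj ⟶ d.obj) : (α ≫ (z g : b ⟶ d)).x =
    push D (p.map g) α.x + (ev2 c α.s g - ev2 c α.t g) := by
  rw [comp_x, z_x, map_zero, add_zero]; rfl

theorem z_comp (f : a.obj ⟶ b.obj) (g : b.obj ⟶ d.obj) :
    (z (f ≫ g) : a ⟶ d) = (z f : a ⟶ b) ≫ z g := by
  rw [z, z, loop_z, map_zero]

/-- The vertical composition of tracks. -/
def vcomp (α β : a ⟶ b) (h : α.t = β.s) : a ⟶ b :=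
  (⟨α.s, β.t, α.h.trans ((congrArg p.map h).trans β.h), α.x + β.x⟩ : Hom a b)

/-- The correction terms telescope: the value of `c` at the middle morphisms occurs once with each
sign. Push and pull agree for both factors because sources and targets have equal images. -/
theorem vcomp_comp_vcomp (α β : a ⟶ b) (h : α.t = β.s) (α' β' : b ⟶ d) (h' : α'.t = β'.s) :
    vcomp α β h ≫ vcomp α' β' h' = vcomp (α ≫ α') (β ≫ β') (by rw [comp_t, comp_s, h, h']) :=
  hom_ext rfl rfl (by
    have h1 : p.map α.s = p.map β.s := α.h.trans (congrArg p.map h)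
    have h2 : p.map α'.s = p.map β'.s := α'.h.trans (congrArg p.map h')
    simp only [comp_x, vcomp, map_add, h, h', ← h1, ← h2]
    abel)

theorem vcomp_z (α : a ⟶ b) {f : a.obj ⟶ b.obj} (h : α.t = f) : vcomp α (z f) h = α :=
  hom_ext rfl h.symm (add_zero _)

theorem z_vcomp (α : a ⟶ b) {f : a.obj ⟶ b.obj} (h : f = α.s) : vcomp (z f) α h = α :=
  hom_ext h rfl (zero_add _)

theorem comp_vcomp_z (f : a.obj ⟶ b.obj) (α β : b ⟶ d) (h : α.t = β.s) :
    (z f : a ⟶ b) ≫ vcomp α β h = vcomp (z f ≫ α) (z f ≫ β) (by simp [h]) := by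
  have := vcomp_comp_vcomp (z f : a ⟶ b) (z f) rfl α β h
  rwa [vcomp_z (z f) (f := f) rfl] at this

theorem vcomp_comp_z (α β : a ⟶ b) (h : α.t = β.s) (f : b.obj ⟶ d.obj) :
    vcomp α β h ≫ (z f : b ⟶ d) = vcomp (α ≫ z f) (β ≫ z f) (by simp [h]) := by
  have := vcomp_comp_vcomp α β h (z f : b ⟶ d) (z f) rfl
  rwa [vcomp_z (z f) (f := f) rfl] at this

/-- The two ways of composing two tracks horizontally. -/
theorem comp_eq_vcomp (α : a ⟶ b) (β : b ⟶ d) :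
    α ≫ β = vcomp (α ≫ z β.s) (z α.t ≫ β) rfl := by
  have := vcomp_comp_vcomp α (z α.t) rfl (z β.s) β rfl
  rwa [vcomp_z _ rfl, z_vcomp _ rfl] at this

theorem comp_eq_vcomp' (α : a ⟶ b) (β : b ⟶ d) :
    α ≫ β = vcomp (z α.s ≫ β) (α ≫ z β.t) rfl := by
  have := vcomp_comp_vcomp (z α.s) α rfl β (z β.t) rfl
  rwa [vcomp_z _ rfl, z_vcomp _ rfl] at this

end TrackCat

end CochainTracks

/-! ### Coproducts in the twisted category and the additive structure on tracks -/

section TrackModules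

open BWCoh RightModule FreeMod

variable {Q : SquareRing.{u}} {R : Type u} [Ring R] {p : Q.Hom (SquareRing.ofRing R)}
  {M : Type u} [AddCommGroup M] [Module R M] [Module Rᵐᵒᵖ M] [SMulCommClass R Rᵐᵒᵖ M]
  (c : Cochain2 (res (matBifunctor R M) (ModSq.toRing p))) (hc : Descends3 (d2 _ c))

namespace TrackCat

/-- The free module of rank `n`, as an object of the category of tracks. -/
abbrev ob (n : ℕ) : TrackCat c hc := ⟨⟨n⟩⟩

/-- The tracks between elements of the free module of rank `n`. -/
abbrev Vec (n : ℕ) : Type u := ob c hc 1 ⟶ ob c hc n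

variable {c hc} {k m n : ℕ}

/-- The entries of an element of the coefficients. -/
def entry (m n : ℕ) (x : Matrix (Fin n) (Fin m) M) (i : Fin n) (j : Fin m) : M := x i j

theorem entry_ext {x y : Matrix (Fin n) (Fin m) M} (h : ∀ i j, entry m n x i j = entry m n y i j) :
    x = y :=
  Matrix.ext h

/-- The inclusions of the summands of a free module. -/
def inc (i : Fin n) : Vec c hc n := z fun _ => gen Q i

/-- The projections to the summands of a free module. -/
def prj (i : Fin n) : ob c hc n ⟶ ob c hc 1 := z (proj Q i)

theorem push_proj (x : Coef (matBifunctor R M) (⟨m⟩ : ModRing R) ⟨n⟩) (i : Fin n) (j : Fin m) :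
    entry m 1 (push (matBifunctor R M)
      ((ModSq.toRing p).map (proj Q i : (⟨n⟩ : ModSq Q) ⟶ ⟨1⟩)) x) 0 j = entry m n x i j := by
  change ∑ l, (show R from p.e (if l = i then 1 else 0)) • entry m n x l j = _
  have h : ∀ l : Fin n, (show R from p.e (if l = i then 1 else 0)) = if l = i then (1 : R) else 0 :=
    fun l => by split_ifs; exacts [p.map_one, p.map_zero]
  simp only [h]
  simp

theorem pull_gen (x : Coef (matBifunctor R M) (⟨n⟩ : ModRing R) ⟨m⟩) (i : Fin n) (j : Fin m) :
    entry 1 m (pull (matBifunctor R M) ((ModSq.toRing p).map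
      ((fun _ => gen Q i : Fin 1 → FreeMod Q n) : (⟨1⟩ : ModSq Q) ⟶ ⟨n⟩)) x) j 0 =
      entry n m x j i := by
  change ∑ l, MulOpposite.op (show R from p.e (if l = i then 1 else 0)) •
    entry n m x j l = _
  have h : ∀ l : Fin n, (show R from p.e (if l = i then 1 else 0)) = if l = i then (1 : R) else 0 :=
    fun l => by split_ifs; exacts [p.map_one, p.map_zero]
  simp only [h]
  simp [apply_ite MulOpposite.op, ite_smul]

theorem comp_proj (f : (⟨m⟩ : ModSq Q) ⟶ ⟨n⟩) (i : Fin n) :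
    f ≫ (proj Q i : (⟨n⟩ : ModSq Q) ⟶ ⟨1⟩) = fun k => single ((f k).e i) :=
  funext fun k => lift_proj i (f k)

theorem gen_comp (f : (⟨n⟩ : ModSq Q) ⟶ ⟨m⟩) (i : Fin n) :
    ((fun _ => gen Q i : Fin 1 → FreeMod Q n) : (⟨1⟩ : ModSq Q) ⟶ ⟨n⟩) ≫ f = fun _ => f i :=
  funext fun _ => lift_gen f i

/-- Projections detect the coordinate row by row, but they forget the `ee` components of source and
target, so these equalities have to be assumed. -/
theorem hom_ext_prj {α β : ob c hc m ⟶ ob c hc n} (hs : α.s = β.s) (ht : α.t = β.t)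
    (h : ∀ i, α ≫ prj i = β ≫ prj i) : α = β := by
  refine hom_ext hs ht (entry_ext (m := m) (n := n) fun i j => ?_)
  have h1 := congrArg (fun γ : ob c hc m ⟶ ob c hc 1 => γ.x) (h i)
  simp only [comp_x, prj, z_x, map_zero, add_zero, z_s, z_t, hs, ht, add_left_inj] at h1
  exact (push_proj (p := p) α.x i j).symm.trans
    ((congrArg (entry m 1 · 0 j) h1).trans (push_proj (p := p) β.x i j))

/-- Restrictions to the summands determine source and target as well as the coordinate. With
`exists_tuple` this makes rank `n` the coproduct of `n` copies of rank one. -/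
theorem hom_ext_inc {α β : ob c hc n ⟶ ob c hc m} (h : ∀ i, inc i ≫ α = inc i ≫ β) : α = β := by
  have hs : α.s = β.s := funext fun i => by
    have h1 := congrArg (fun γ : Vec c hc m => γ.s) (h i)
    simp only [comp_s, inc, z_s] at h1
    erw [gen_comp, gen_comp] at h1
    exact congrFun h1 0
  have ht : α.t = β.t := funext fun i => by
    have h1 := congrArg (fun γ : Vec c hc m => γ.t) (h i)
    simp only [comp_t, inc, z_t] at h1
    erw [gen_comp, gen_comp] at h1
    exact congrFun h1 0
  refine hom_ext hs ht (entry_ext (m := n) (n := m) fun j i => ?_)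
  have h1 := congrArg (fun γ : Vec c hc m => γ.x) (h i)
  simp only [comp_x, inc, z_x, map_zero, zero_add, z_s, z_t, hs, ht, add_left_inj] at h1
  exact (pull_gen (p := p) α.x i j).symm.trans
    ((congrArg (entry 1 m · j 0) h1).trans (pull_gen (p := p) β.x i j))

theorem exists_tuple (α : Fin n → Vec c hc m) :
    ∃ β : ob c hc n ⟶ ob c hc m, ∀ i, inc i ≫ β = α i := by
  let s : (⟨n⟩ : ModSq Q) ⟶ ⟨m⟩ := fun i => (α i).s 0
  let t : (⟨n⟩ : ModSq Q) ⟶ ⟨m⟩ := fun i => (α i).t 0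
  have h : (ModSq.toRing p).map s = (ModSq.toRing p).map t :=
    (ModSq.toRing_map_eq_iff p _ _).2 fun i j => (ModSq.toRing_map_eq_iff p _ _).1 (α i).h 0 j
  let g : Fin n → ((⟨1⟩ : ModSq Q) ⟶ ⟨n⟩) := fun i _ => gen Q i
  -- Composition with an inclusion adds a correction by `c`; the columns are shifted beforehand to
  -- compensate for it.
  let x : Matrix (Fin m) (Fin n) M := Matrix.of fun j i =>
    entry 1 m ((α i).x - (ev2 c (g i) s - ev2 c (g i) t)) j 0
  refine ⟨(⟨s, t, h, x⟩ : Hom (ob c hc n) (ob c hc m)), fun i => hom_ext ?_ ?_ ?_⟩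
  · refine (gen_comp s i).trans (funext fun k => ?_)
    rw [Subsingleton.elim k 0]
  · refine (gen_comp t i).trans (funext fun k => ?_)
    rw [Subsingleton.elim k 0]
  · have h1 : pull (matBifunctor R M) ((ModSq.toRing p).map (g i)) x =
        (α i).x - (ev2 c (g i) s - ev2 c (g i) t) := by
      refine entry_ext (m := 1) (n := m) fun j k => ?_
      rw [Subsingleton.elim k 0]
      exact pull_gen (p := p) x i j
    exact (z_comp_x _ _).trans (eq_sub_iff_add_eq.1 h1)

/-- Here the correction by `c` is removed row by row. Source and target are prescribed in advance,
since the projections do not determine them. -/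
theorem exists_of_prj (f g : (⟨m⟩ : ModSq Q) ⟶ ⟨n⟩) (α : Fin n → (ob c hc m ⟶ ob c hc 1))
    (hs : ∀ i, (α i).s = fun k => single ((f k).e i))
    (ht : ∀ i, (α i).t = fun k => single ((g k).e i)) :
    ∃ β : ob c hc m ⟶ ob c hc n, β.s = f ∧ β.t = g ∧ ∀ i, β ≫ prj i = α i := by
  have h : (ModSq.toRing p).map f = (ModSq.toRing p).map g :=
    (ModSq.toRing_map_eq_iff p _ _).2 fun k i => by
      have := (ModSq.toRing_map_eq_iff p _ _).1 (α i).h k 0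
      rw [hs, ht] at this
      exact this
  let q : Fin n → ((⟨n⟩ : ModSq Q) ⟶ ⟨1⟩) := fun i => proj Q i
  let x : Matrix (Fin n) (Fin m) M := Matrix.of fun i k =>
    entry m 1 ((α i).x - (ev2 c f (q i) - ev2 c g (q i))) 0 k
  refine ⟨(⟨f, g, h, x⟩ : Hom (ob c hc m) (ob c hc n)), rfl, rfl, fun i => hom_ext ?_ ?_ ?_⟩
  · exact (comp_proj f i).trans (hs i).symm
  · exact (comp_proj g i).trans (ht i).symm
  · have h1 : push (matBifunctor R M) ((ModSq.toRing p).map (q i)) x =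
        (α i).x - (ev2 c f (q i) - ev2 c g (q i)) := by
      refine entry_ext (m := m) (n := 1) fun j k => ?_
      rw [Subsingleton.elim j 0]
      exact push_proj (p := p) x i k
    exact (comp_z_x _ _).trans (eq_sub_iff_add_eq.1 h1)

/-- The track from rank `n` to rank `m` with given restrictions to the summands. -/
noncomputable def tup (α : Fin n → Vec c hc m) : ob c hc n ⟶ ob c hc m := (exists_tuple α).choose

@[simp] theorem inc_tup (α : Fin n → Vec c hc m) (i : Fin n) : inc i ≫ tup α = α i :=
  (exists_tuple α).choose_spec i

@[simp] theorem inc_tup_assoc (α : Fin n → Vec c hc m) (i : Fin n) (β : ob c hc m ⟶ ob c hc k) :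
    inc i ≫ tup α ≫ β = α i ≫ β := by
  rw [← Category.assoc, inc_tup]

theorem tup_comp (α : Fin n → Vec c hc m) (β : ob c hc m ⟶ ob c hc k) :
    tup α ≫ β = tup (fun i => α i ≫ β) :=
  hom_ext_inc fun i => by simp

/-- The source of a track, as an element of the free module. -/
def sv (α : Vec c hc n) : FreeMod Q n := α.s 0

/-- The target of a track, as an element of the free module. -/
def tv (α : Vec c hc n) : FreeMod Q n := α.t 0

theorem vec_s (α : Vec c hc n) : α.s = fun _ => sv α :=
  funext fun k => by rw [Subsingleton.elim k 0]; rfl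
theorem vec_t (α : Vec c hc n) : α.t = fun _ => tv α :=
  funext fun k => by rw [Subsingleton.elim k 0]; rfl

theorem tup_s (α : Fin n → Vec c hc m) : (tup α).s = fun i => sv (α i) := funext fun i => by
  have h := congrArg sv (inc_tup α i)
  rw [← h]
  exact (lift_gen (Q := Q) _ i).symm

theorem tup_t (α : Fin n → Vec c hc m) : (tup α).t = fun i => tv (α i) := funext fun i => by
  have h := congrArg tv (inc_tup α i)
  rw [← h]
  exact (lift_gen (Q := Q) _ i).symm

/-- The operations on the tracks given by the elements of free modules. -/
noncomputable def op (w : FreeMod Q n) (α : Fin n → Vec c hc m) : Vec c hc m :=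
  (z (fun _ => w) : Vec c hc n) ≫ tup α

@[simp] theorem op_gen (α : Fin n → Vec c hc m) (i : Fin n) : op (gen Q i) α = α i := inc_tup α i

/-- Composites of operations are operations, because `z` is a functor and `tup` is the coproduct
pairing. Every identity valid in the free modules thus becomes an identity between tracks. -/
theorem op_lift (v : Fin n → FreeMod Q m) (w : FreeMod Q n) (α : Fin m → Vec c hc k) :
    op (lift v w) α = op w (fun i => op (v i) α) := by
  have h1 : (z (fun _ => lift v w) : Vec c hc m) =
      (z (fun _ => w) : Vec c hc n) ≫ (z v : ob c hc n ⟶ ob c hc m) :=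
    z_comp (a := ob c hc 1) (b := ob c hc n) (d := ob c hc m) (fun _ => w) v
  have h2 : (z v : ob c hc n ⟶ ob c hc m) ≫ tup α = tup (fun i => op (v i) α) :=
    hom_ext_inc fun i => by
      rw [inc_tup, ← Category.assoc, op, inc, ← z_comp]
      congr 2
      exact gen_comp v i
  rw [op, h1, Category.assoc, h2]; rfl

theorem op_comp (w : FreeMod Q n) (α : Fin n → Vec c hc m) (β : ob c hc m ⟶ ob c hc k) :
    op w α ≫ β = op w (fun i => α i ≫ β) := by
  rw [op, Category.assoc, tup_comp]; rfl

theorem sv_op (w : FreeMod Q n) (α : Fin n → Vec c hc m) :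
    sv (op w α) = lift (fun i => sv (α i)) w := by
  rw [← tup_s]; rfl

theorem tv_op (w : FreeMod Q n) (α : Fin n → Vec c hc m) :
    tv (op w α) = lift (fun i => tv (α i)) w := by
  rw [← tup_t]; rfl

theorem op_inc (w : FreeMod Q n) : op w inc = (z (fun _ => w) : Vec c hc n) := by
  have h : tup (inc : Fin n → Vec c hc n) = 𝟙 _ := hom_ext_inc fun i => by simp
  rw [op, h, Category.comp_id]

/-- Sum and negative are the operations belonging to the corresponding elements of free modules of
rank two and one; zero is an identity track. -/
noncomputable instance : Add (Vec c hc n) :=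
  ⟨fun α β => op (gen Q (0 : Fin 2) + gen Q 1) ![α, β]⟩
noncomputable instance : Zero (Vec c hc n) := ⟨z fun _ => 0⟩
noncomputable instance : Neg (Vec c hc n) := ⟨fun α => op (-gen Q (0 : Fin 1)) ![α]⟩

/-- Both sides factor through the free module of rank zero, where they are the nullary operation on
the empty family. -/
theorem op_zero (α : Fin n → Vec c hc m) : op (0 : FreeMod Q n) α = 0 := by
  have h := op_lift (n := 0) (k := m) (fun i => i.elim0) (0 : FreeMod Q 0) α
  rw [lift_zero] at h
  have h' := op_lift (n := 0) (fun i => i.elim0) (0 : FreeMod Q 0) (inc : Fin m → Vec c hc m)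
  rw [lift_zero, op_inc] at h'
  rw [h]
  refine Eq.trans ?_ h'.symm
  congr 1
  exact funext fun i => i.elim0

theorem op_add (v w : FreeMod Q n) (α : Fin n → Vec c hc m) :
    op (v + w) α = op v α + op w α := by
  have h := op_lift ![v, w] (gen Q (0 : Fin 2) + gen Q 1) α
  rw [lift_gen_add_gen] at h
  refine h.trans (congrArg (op _) (funext fun i => ?_))
  fin_cases i <;> rfl

theorem op_neg (v : FreeMod Q n) (α : Fin n → Vec c hc m) : op (-v) α = -op v α := by
  have h := op_lift ![v] (-gen Q (0 : Fin 1)) α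
  have h1 : lift (Q := Q) ![v] (-gen Q (0 : Fin 1)) = -v := by
    rw [eq_neg_iff_add_eq_zero]
    have h2 := lift_gen (Q := Q) ![v] 0
    rw [Matrix.cons_val_zero] at h2
    refine (congrArg (_ + ·) h2.symm).trans ?_
    rw [← lift_add, neg_add_cancel, lift_zero]
  rw [h1] at h
  refine h.trans (congrArg (op _) (funext fun i => ?_))
  fin_cases i; rfl

/-- Each group law is the law for the generators of a free module of rank three or one, applied as
an operation. -/
noncomputable instance : AddGroup (Vec c hc n) := AddGroup.ofLeftAxioms
  (fun α β γ => by
    have h := congrArg (fun w => op w ![α, β, γ])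
      (add_assoc (gen Q (0 : Fin 3)) (gen Q 1) (gen Q 2))
    simpa [op_add] using h)
  (fun α => by
    have h : op (0 + gen Q (0 : Fin 1)) ![α] = op (gen Q 0) ![α] := by rw [zero_add]
    rwa [op_add, op_zero, op_gen] at h)
  (fun α => by
    have h : op (-gen Q (0 : Fin 1) + gen Q 0) ![α] = op 0 ![α] := by rw [neg_add_cancel]
    rwa [op_add, op_neg, op_zero, op_gen] at h)

theorem add_comp (α β : Vec c hc n) (γ : ob c hc n ⟶ ob c hc m) :
    (α + β) ≫ γ = α ≫ γ + β ≫ γ := by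
  refine (op_comp _ _ _).trans (congrArg (op _) (funext fun i => ?_))
  fin_cases i <;> rfl

theorem zero_comp (γ : ob c hc n ⟶ ob c hc m) : (0 : Vec c hc n) ≫ γ = 0 := by
  have h := add_comp (0 : Vec c hc n) 0 γ
  rw [add_zero] at h
  exact left_eq_add.1 h

theorem sv_add (α β : Vec c hc n) : sv (α + β) = sv α + sv β :=
  (sv_op _ _).trans (lift_gen_add_gen _ _ _)
theorem tv_add (α β : Vec c hc n) : tv (α + β) = tv α + tv β :=
  (tv_op _ _).trans (lift_gen_add_gen _ _ _)
theorem sv_zero : sv (0 : Vec c hc n) = 0 := rfl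
theorem tv_zero : tv (0 : Vec c hc n) = 0 := rfl

theorem z_add (v w : FreeMod Q n) : (z (fun _ => v + w) : Vec c hc n) =
    z (fun _ => v) + z (fun _ => w) := by
  rw [← op_inc, op_add, op_inc, op_inc]

end TrackCat

end TrackModules

/-! ### Brackets of tracks and multiplication by scalars -/

section TrackModules

open BWCoh RightModule FreeMod

variable {Q : SquareRing.{u}} {R : Type u} [Ring R] {p : Q.Hom (SquareRing.ofRing R)}
  {M : Type u} [AddCommGroup M] [Module R M] [Module Rᵐᵒᵖ M] [SMulCommClass R Rᵐᵒᵖ M]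
  {c : Cochain2 (res (matBifunctor R M) (ModSq.toRing p))} {hc : Descends3 (d2 _ c)}

namespace TrackCat

variable {k m n : ℕ}

theorem sv_comp (X : Vec c hc 1) (α : Vec c hc n) : sv (X ≫ α) = sm (sv α) ((sv X).e 0) := by
  refine Eq.trans ?_ (lift_fin_one (Q := Q) (fun _ => sv α) (sv X))
  rw [← vec_s α]; rfl

theorem tv_comp (X : Vec c hc 1) (α : Vec c hc n) : tv (X ≫ α) = sm (tv α) ((tv X).e 0) := by
  refine Eq.trans ?_ (lift_fin_one (Q := Q) (fun _ => tv α) (tv X))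
  rw [← vec_t α]; rfl

/-- The test used for the universal identities below: source and target are compared in free
`Q`-modules, and the coordinate is compared after projection to rank one. -/
theorem vec_ext {α β : Vec c hc n} (hs : sv α = sv β) (ht : tv α = tv β)
    (h : ∀ i, α ≫ prj i = β ≫ prj i) : α = β :=
  hom_ext_prj (by rw [vec_s, vec_s, hs]) (by rw [vec_t, vec_t, ht]) h

theorem z_single_zero : (z (fun _ => single 0) : Vec c hc 1) = 0 :=
  congrArg z (funext fun _ => ext_one rfl)

theorem z_single_one : (z (fun _ => single 1) : Vec c hc 1) = 𝟙 _ :=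
  congrArg z (funext fun k => ext_one (by rw [Subsingleton.elim k 0]; rfl))

theorem inc_prj (i j : Fin n) :
    (inc i : Vec c hc n) ≫ prj j = if i = j then 𝟙 _ else 0 := by
  rw [inc, prj, ← z_comp, ← z_single_zero, ← z_single_one, gen_comp]
  unfold proj
  split_ifs <;> rfl

@[simp] theorem inc_prj_self (i : Fin n) : (inc i : Vec c hc n) ≫ prj i = 𝟙 _ := by
  rw [inc_prj, if_pos rfl]

theorem inc_prj_of_ne {i j : Fin n} (h : i ≠ j) : (inc i : Vec c hc n) ≫ prj j = 0 := by
  rw [inc_prj, if_neg h]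

theorem vec_zero_ext {α β : ob c hc m ⟶ ob c hc 0} (hs : α.s = β.s) (ht : α.t = β.t) : α = β :=
  hom_ext_prj hs ht fun i => i.elim0

-- Precomposition by a scalar is not additive, so the argument passes through rank zero instead:
-- zero factors through it, and all tracks into rank zero coincide.
@[simp] theorem comp_zero (X : Vec c hc 1) : X ≫ (0 : Vec c hc n) = 0 := by
  have h1 : (0 : Vec c hc n) = (0 : Vec c hc 0) ≫ z (fun i => i.elim0) := (zero_comp _).symm
  have h2 : X ≫ (0 : Vec c hc 0) = 0 :=
    vec_zero_ext (funext fun k => FreeMod.ext' (fun i => i.elim0) fun i => i.elim0)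
      (funext fun k => FreeMod.ext' (fun i => i.elim0) fun i => i.elim0)
  rw [h1, ← Category.assoc, h2]

/-- Both generating brackets have zero entries, so zero projections may be prescribed. By `vec_ext`
the resulting track is unique; it serves as the universal bracket. -/
theorem exists_brk (a b : Q.ee) : ∃ θ : Vec c hc 2, sv θ = br (gen Q 0) (gen Q 1) a ∧
    tv θ = br (gen Q 0) (gen Q 1) b ∧ ∀ i, θ ≫ prj i = 0 := by
  obtain ⟨θ, h1, h2, h3⟩ := exists_of_prj (c := c) (hc := hc) (m := 1) (n := 2)
    (fun _ => br (gen Q 0) (gen Q 1) a) (fun _ => br (gen Q 0) (gen Q 1) b) (fun _ => 0)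
    (fun i => by
      simp only [br_gen_e]; rw [← z_single_zero]; rfl)
    (fun i => by
      simp only [br_gen_e]; rw [← z_single_zero]; rfl)
  exact ⟨θ, congrFun h1 0, congrFun h2 0, h3⟩

/-- The track `[e 0, e 1]_a ⇒ [e 0, e 1]_b` with trivial projections. -/
noncomputable def brk (ab : Q.ee × Q.ee) : Vec c hc 2 := (exists_brk ab.1 ab.2).choose

theorem sv_brk (a : Q.ee × Q.ee) : sv (brk a : Vec c hc 2) = br (gen Q 0) (gen Q 1) a.1 :=
  (exists_brk (c := c) (hc := hc) a.1 a.2).choose_spec.1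
theorem tv_brk (a : Q.ee × Q.ee) : tv (brk a : Vec c hc 2) = br (gen Q 0) (gen Q 1) a.2 :=
  (exists_brk (c := c) (hc := hc) a.1 a.2).choose_spec.2.1
theorem brk_prj (a : Q.ee × Q.ee) (i : Fin 2) : (brk a : Vec c hc 2) ≫ prj i = 0 :=
  (exists_brk (c := c) (hc := hc) a.1 a.2).choose_spec.2.2 i

/-- The bracket of tracks. -/
noncomputable def vbr (α β : Vec c hc n) (a : Q.ee × Q.ee) : Vec c hc n := brk a ≫ tup ![α, β]

theorem vbr_comp (α β : Vec c hc n) (a : Q.ee × Q.ee) (γ : ob c hc n ⟶ ob c hc m) :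
    vbr α β a ≫ γ = vbr (α ≫ γ) (β ≫ γ) a := by
  rw [vbr, Category.assoc, tup_comp, vbr]
  congr 2
  funext i; fin_cases i <;> rfl

theorem sv_vbr (α β : Vec c hc n) (a : Q.ee × Q.ee) : sv (vbr α β a) = br (sv α) (sv β) a.1 := by
  have h : sv (vbr α β a) = lift (tup ![α, β]).s (sv (brk a : Vec c hc 2)) := rfl
  rw [h, sv_brk, tup_s]
  exact lift_br_gen _ _ _ _

theorem tv_vbr (α β : Vec c hc n) (a : Q.ee × Q.ee) : tv (vbr α β a) = br (tv α) (tv β) a.2 := by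
  have h : tv (vbr α β a) = lift (tup ![α, β]).t (tv (brk a : Vec c hc 2)) := rfl
  rw [h, tv_brk, tup_t]
  exact lift_br_gen _ _ _ _

-- When one argument is zero the pairing factors through a projection, and the universal bracket has
-- zero projections.
@[simp] theorem vbr_zero_right (α : Vec c hc n) (a : Q.ee × Q.ee) : vbr α 0 a = 0 := by
  have h : tup ![α, 0] = prj 0 ≫ α := hom_ext_inc fun i => by
    rw [inc_tup, ← Category.assoc]
    fin_cases i
    · change α = (inc 0 ≫ prj 0) ≫ α
      rw [inc_prj_self, Category.id_comp]
    · change 0 = (inc 1 ≫ prj 0) ≫ α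
      rw [inc_prj_of_ne (by decide), zero_comp]
  rw [vbr, h, ← Category.assoc, brk_prj, zero_comp]

@[simp] theorem vbr_zero_left (α : Vec c hc n) (a : Q.ee × Q.ee) : vbr 0 α a = 0 := by
  have h : tup ![0, α] = prj 1 ≫ α := hom_ext_inc fun i => by
    rw [inc_tup, ← Category.assoc]
    fin_cases i
    · change 0 = (inc 0 ≫ prj 1) ≫ α
      rw [inc_prj_of_ne (by decide), zero_comp]
    · change α = (inc 1 ≫ prj 1) ≫ α
      rw [inc_prj_self, Category.id_comp]
  rw [vbr, h, ← Category.assoc, brk_prj, zero_comp]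

theorem inc_tup_two (α β : Vec c hc n) :
    inc 0 ≫ tup ![α, β] = α ∧ inc 1 ≫ tup ![α, β] = β := ⟨inc_tup _ _, inc_tup _ _⟩

theorem inc_tup_three (α β γ : Vec c hc n) : inc 0 ≫ tup ![α, β, γ] = α ∧
    inc 1 ≫ tup ![α, β, γ] = β ∧ inc 2 ≫ tup ![α, β, γ] = γ :=
  ⟨inc_tup _ _, inc_tup _ _, inc_tup _ _⟩

/-- The sources and targets of a scalar. -/
def se (X : Vec c hc 1) : Q.e := (sv X).e 0
def te (X : Vec c hc 1) : Q.e := (tv X).e 0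

/-- The value of `H` on a scalar. -/
def vH (X : Vec c hc 1) : Q.ee × Q.ee := (Q.H (se X), Q.H (te X))

/-- The action of scalars on pairs. -/
def vact (X Y : Vec c hc 1) (a : Q.ee × Q.ee) (Z : Vec c hc 1) : Q.ee × Q.ee :=
  (Q.act (se X) (se Y) a.1 (se Z), Q.act (te X) (te Y) a.2 (te Z))

/-- The pattern for the identities below: it suffices to treat the generators `inc 0`, `inc 1`, and
then compose with a pairing. For generators, source and target satisfy the identity in the free
`Q`-module, and each projection sends at least one generator to zero, so the brackets vanish there.
-/
theorem scalar_add (X : Vec c hc 1) (α β : Vec c hc n) :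
    X ≫ (α + β) = X ≫ α + X ≫ β + vbr α β (vH X) := by
  have h : X ≫ ((inc 0 : Vec c hc 2) + inc 1) = X ≫ inc 0 + X ≫ inc 1 +
      vbr (inc 0) (inc 1) (vH X) := by
    refine vec_ext ?_ ?_ fun i => ?_
    · simp only [sv_comp, sv_add, sv_vbr]; exact add_sm _ _ _
    · simp only [tv_comp, tv_add, tv_vbr]; exact add_sm _ _ _
    · fin_cases i <;> simp [add_comp, vbr_comp, inc_prj]
  have h1 := congrArg (· ≫ tup ![α, β]) h
  simpa only [Category.assoc, add_comp, vbr_comp, inc_tup_two] using h1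

theorem vbr_T (α β : Vec c hc n) (a : Q.ee × Q.ee) :
    vbr α β (Q.T a.1, Q.T a.2) = vbr β α a := by
  have h : vbr (inc 0 : Vec c hc 2) (inc 1) (Q.T a.1, Q.T a.2) = vbr (inc 1) (inc 0) a := by
    refine vec_ext ?_ ?_ fun i => ?_
    · simp only [sv_vbr]; exact br_T _ _ _
    · simp only [tv_vbr]; exact br_T _ _ _
    · fin_cases i <;> simp [vbr_comp, inc_prj]
  have h1 := congrArg (· ≫ tup ![α, β]) h
  simpa only [Category.assoc, add_comp, vbr_comp, inc_tup_two] using h1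

theorem vbr_scalar (X Y : Vec c hc 1) (α β : Vec c hc n) (a : Q.ee × Q.ee) :
    vbr (X ≫ α) (Y ≫ β) a = vbr α β (vact X Y a (𝟙 _)) := by
  have h : vbr (X ≫ (inc 0 : Vec c hc 2)) (Y ≫ inc 1) a =
      vbr (inc 0) (inc 1) (vact X Y a (𝟙 _)) := by
    refine vec_ext ?_ ?_ fun i => ?_
    · simp only [sv_vbr, sv_comp]; exact br_sm _ _ _ _ _
    · simp only [tv_vbr, tv_comp]; exact br_sm _ _ _ _ _
    · fin_cases i <;> simp [vbr_comp, inc_prj]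
  have h1 := congrArg (· ≫ tup ![α, β]) h
  simpa only [Category.assoc, add_comp, vbr_comp, inc_tup_two] using h1

theorem scalar_vbr (X : Vec c hc 1) (α β : Vec c hc n) (a : Q.ee × Q.ee) :
    X ≫ vbr α β a = vbr α β (vact (𝟙 _) (𝟙 _) a X) := by
  have h : X ≫ vbr (inc 0 : Vec c hc 2) (inc 1) a = vbr (inc 0) (inc 1)
      (vact (𝟙 _) (𝟙 _) a X) := by
    refine vec_ext ?_ ?_ fun i => ?_
    · simp only [sv_vbr, sv_comp]; exact sm_br _ _ _ _
    · simp only [tv_vbr, tv_comp]; exact sm_br _ _ _ _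
    · fin_cases i <;> simp [vbr_comp, inc_prj]
  have h1 := congrArg (· ≫ tup ![α, β]) h
  simpa only [Category.assoc, add_comp, vbr_comp, inc_tup_two] using h1

theorem vbr_vbr (α β γ : Vec c hc n) (a b : Q.ee × Q.ee) : vbr (vbr α β a) γ b = 0 := by
  have h : vbr (vbr (inc 0 : Vec c hc 3) (inc 1) a) (inc 2) b = 0 := by
    refine vec_ext ?_ ?_ fun i => ?_
    · simp only [sv_vbr, sv_zero]; exact br_br _ _ _ _ _
    · simp only [tv_vbr, tv_zero]; exact br_br _ _ _ _ _
    · fin_cases i <;> simp [vbr_comp, inc_prj, zero_comp]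
  have h1 := congrArg (· ≫ tup ![α, β, γ]) h
  simpa only [Category.assoc, zero_comp, vbr_comp, inc_tup_three] using h1

theorem vbr_add_left (α β γ : Vec c hc n) (a : Q.ee × Q.ee) :
    vbr (α + β) γ a = vbr α γ a + vbr β γ a := by
  have h : vbr ((inc 0 : Vec c hc 3) + inc 1) (inc 2) a =
      vbr (inc 0) (inc 2) a + vbr (inc 1) (inc 2) a := by
    refine vec_ext ?_ ?_ fun i => ?_
    · simp only [sv_vbr, sv_add]; exact br_add_left _ _ _ _
    · simp only [tv_vbr, tv_add]; exact br_add_left _ _ _ _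
    · fin_cases i <;> simp [vbr_comp, add_comp, inc_prj]
  have h1 := congrArg (· ≫ tup ![α, β, γ]) h
  simpa only [Category.assoc, add_comp, vbr_comp, inc_tup_three] using h1

theorem vbr_add_right (α β γ : Vec c hc n) (a : Q.ee × Q.ee) :
    vbr α (β + γ) a = vbr α β a + vbr α γ a := by
  rw [← vbr_T (β + γ), vbr_add_left, vbr_T, vbr_T]

theorem vbr_add (α β : Vec c hc n) (a b : Q.ee × Q.ee) :
    vbr α β (a + b) = vbr α β a + vbr α β b := by
  have h : vbr (inc 0 : Vec c hc 2) (inc 1) (a + b) =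
      vbr (inc 0) (inc 1) a + vbr (inc 0) (inc 1) b := by
    refine vec_ext ?_ ?_ fun i => ?_
    · simp only [sv_vbr, sv_add]; exact br_add _ _ _ _
    · simp only [tv_vbr, tv_add]; exact br_add _ _ _ _
    · fin_cases i <;> simp [vbr_comp, add_comp, inc_prj]
  have h1 := congrArg (· ≫ tup ![α, β]) h
  simpa only [Category.assoc, add_comp, vbr_comp, inc_tup_two] using h1

theorem vbr_central (α β γ : Vec c hc n) (a : Q.ee × Q.ee) :
    vbr α β a + γ = γ + vbr α β a := by
  have h : vbr (inc 0 : Vec c hc 3) (inc 1) a + inc 2 = inc 2 + vbr (inc 0) (inc 1) a := by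
    refine vec_ext ?_ ?_ fun i => ?_
    · simp only [sv_vbr, sv_add]; exact br_central _ _ _ _
    · simp only [tv_vbr, tv_add]; exact br_central _ _ _ _
    · fin_cases i <;> simp [vbr_comp, add_comp, inc_prj]
  have h1 := congrArg (· ≫ tup ![α, β, γ]) h
  simpa only [Category.assoc, add_comp, vbr_comp, inc_tup_three] using h1

theorem vec_swap (α β : Vec c hc n) :
    α + β = β + α + vbr β α (Q.H (1 + 1), Q.H (1 + 1)) := by
  have h : (inc 1 : Vec c hc 2) + inc 0 = inc 0 + inc 1 +
      vbr (inc 0) (inc 1) (Q.H (1 + 1), Q.H (1 + 1)) := by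
    refine vec_ext ?_ ?_ fun i => ?_
    · simp only [sv_vbr, sv_add]; exact RightModule.add_swap _ _
    · simp only [tv_vbr, tv_add]; exact RightModule.add_swap _ _
    · fin_cases i <;> simp [vbr_comp, add_comp, inc_prj]
  have h1 := congrArg (· ≫ tup ![β, α]) h
  simpa only [Category.assoc, add_comp, vbr_comp, inc_tup_two] using h1

/-- Identity tracks respect brackets: the identity track of a generating bracket has zero
projections, like the universal bracket of the pair `(a, a)`. -/
theorem z_br (v w : FreeMod Q n) (a : Q.ee) : (z (fun _ => br v w a) : Vec c hc n) =
    vbr (z fun _ => v) (z fun _ => w) (a, a) := by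
  have h : (z (fun _ => br (gen Q 0) (gen Q 1) a) : Vec c hc 2) = vbr (inc 0) (inc 1) (a, a) := by
    refine vec_ext ?_ ?_ fun i => ?_
    · rw [sv_vbr]; rfl
    · rw [tv_vbr]; rfl
    · have h1 : (z (fun _ => br (gen Q 0) (gen Q 1) a) : Vec c hc 2) ≫ prj i = 0 := by
        rw [prj, ← z_comp, comp_proj, ← z_single_zero]
        simp only [br_gen_e]
      rw [h1]
      fin_cases i <;> simp [vbr_comp, inc_prj]
  have h1 := congrArg (· ≫ tup ![(z fun _ => v : Vec c hc n), z fun _ => w]) h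
  simp only [vbr_comp, inc_tup_two] at h1
  rw [← h1]
  have h2 := op_lift (c := c) (hc := hc) ![v, w] (br (gen Q 0) (gen Q 1) a) inc
  rw [op_inc, lift_br_gen] at h2
  refine h2.trans (congrArg (op _) (funext fun i => ?_))
  fin_cases i <;> exact op_inc _

end TrackCat

end TrackModules

/-! ### The square ring of tracks and its modules -/

section TrackModules

open BWCoh RightModule FreeMod

variable {Q : SquareRing.{u}} {R : Type u} [Ring R] {p : Q.Hom (SquareRing.ofRing R)}
  {M : Type u} [AddCommGroup M] [Module R M] [Module Rᵐᵒᵖ M] [SMulCommClass R Rᵐᵒᵖ M]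
  (c : Cochain2 (res (matBifunctor R M) (ModSq.toRing p))) (hc : Descends3 (d2 _ c))

namespace TrackCat

variable {k m n : ℕ}

section

variable {c hc}

@[simp] theorem se_add (X Y : Vec c hc 1) : se (X + Y) = se X + se Y := by
  rw [se, sv_add]; rfl
@[simp] theorem te_add (X Y : Vec c hc 1) : te (X + Y) = te X + te Y := by
  rw [te, tv_add]; rfl
@[simp] theorem se_comp (X Y : Vec c hc 1) : se (Y ≫ X) = se X * se Y := by
  rw [se, sv_comp]; rfl
@[simp] theorem te_comp (X Y : Vec c hc 1) : te (Y ≫ X) = te X * te Y := by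
  rw [te, tv_comp]; rfl
@[simp] theorem se_id : se (𝟙 (ob c hc 1) : Vec c hc 1) = 1 := rfl
@[simp] theorem te_id : te (𝟙 (ob c hc 1) : Vec c hc 1) = 1 := rfl
theorem se_vbr (X Y : Vec c hc 1) (a : Q.ee × Q.ee) :
    se (vbr X Y a) = Q.P (Q.act (se X) (se Y) a.1 1) := by
  rw [se, sv_vbr]; rfl
theorem te_vbr (X Y : Vec c hc 1) (a : Q.ee × Q.ee) :
    te (vbr X Y a) = Q.P (Q.act (te X) (te Y) a.2 1) := by
  rw [te, tv_vbr]; rfl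
@[simp] theorem se_vbr_id (a : Q.ee × Q.ee) : se (vbr (𝟙 (ob c hc 1)) (𝟙 _) a) = Q.P a.1 := by
  rw [se_vbr, se_id, Q.act_one]
@[simp] theorem te_vbr_id (a : Q.ee × Q.ee) : te (vbr (𝟙 (ob c hc 1)) (𝟙 _) a) = Q.P a.2 := by
  rw [te_vbr, te_id, Q.act_one]

/-- In rank one every bracket is a bracket of two identities, that is, a value of the map `P` of the
square ring `vecRing`. -/
theorem vbr_eq (X Y : Vec c hc 1) (a : Q.ee × Q.ee) :
    vbr X Y a = vbr (𝟙 _) (𝟙 _) (vact X Y a (𝟙 _)) := by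
  rw [← vbr_scalar, Category.comp_id, Category.comp_id]

end

/-- The square ring of the tracks between elements of `Q`. -/
@[reducible] noncomputable def vecRing : SquareRing.{u} where
  e := Vec c hc 1
  ee := Q.ee × Q.ee
  P := AddMonoidHom.mk' (fun a => vbr (𝟙 _) (𝟙 _) a) fun a b => vbr_add _ _ _ _
  H := vH
  cross_add_left X X' Y := Prod.ext
    (by simpa [vH] using Q.cross_add_left (se X) (se X') (se Y))
    (by simpa [vH] using Q.cross_add_left (te X) (te X') (te Y))
  cross_add_right X Y Y' := Prod.ext
    (by simpa [vH] using Q.cross_add_right (se X) (se Y) (se Y'))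
    (by simpa [vH] using Q.cross_add_right (te X) (te Y) (te Y'))
  cross_P_left a Y := Prod.ext
    (by simpa [vH] using Q.cross_P_left a.1 (se Y))
    (by simpa [vH] using Q.cross_P_left a.2 (te Y))
  P_cross X Y := by
    have h1 : vH (X + Y) - vH Y - vH X = vact Y X (Q.H (1 + 1), Q.H (1 + 1)) (𝟙 _) :=
      Prod.ext (by simpa [vH, vact] using Q.cross_eq (se X) (se Y))
        (by simpa [vH, vact] using Q.cross_eq (te X) (te Y))
    rw [h1]
    change vbr (𝟙 _) (𝟙 _) _ = _
    rw [← vbr_eq]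
    have h2 := vec_swap X Y
    calc _ = -(Y + X) + (Y + X + vbr Y X (Q.H (1 + 1), Q.H (1 + 1))) := by
          rw [← add_assoc, neg_add_cancel, zero_add]
      _ = _ := by rw [← h2]; simp [sub_eq_add_neg, add_assoc]
  P_H_P a := by
    have h1 : vH (vbr (𝟙 (ob c hc 1)) (𝟙 _) a) = a + (Q.T a.1, Q.T a.2) :=
      Prod.ext (by simp [vH, Q.H_P]) (by simp [vH, Q.H_P])
    change vbr (𝟙 _) (𝟙 _) (vH (vbr (𝟙 _) (𝟙 _) a)) = _
    rw [h1, vbr_add, vbr_T]; rfl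
  monoid :=
    -- Scalars act on a free right module by precomposition, so the product is composition in the
    -- opposite order.
    { mul := fun X Y => Y ≫ X
      one := 𝟙 _
      mul_assoc := fun X Y Z => (Category.assoc Z Y X).symm
      one_mul := fun X => Category.comp_id X
      mul_one := fun X => Category.id_comp X }
  act := vact
  act_add_fst X X' Y a Z := Prod.ext (by simpa [vact] using Q.act_add_fst _ _ _ _ _)
    (by simpa [vact] using Q.act_add_fst _ _ _ _ _)
  act_add_snd X X' Y a Z := Prod.ext (by simpa [vact] using Q.act_add_snd _ _ _ _ _)
    (by simpa [vact] using Q.act_add_snd _ _ _ _ _)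
  act_add_mid X X' Y a Z := Prod.ext (by simpa [vact] using Q.act_add_mid _ _ _ _ _)
    (by simpa [vact] using Q.act_add_mid _ _ _ _ _)
  act_add_right X X' Y a Z := Prod.ext (by simpa [vact] using Q.act_add_right _ _ _ _ _)
    (by simpa [vact] using Q.act_add_right _ _ _ _ _)
  act_P_fst b Y a Z := Prod.ext (by simpa [vact] using Q.act_P_fst _ _ _ _)
    (by simpa [vact] using Q.act_P_fst _ _ _ _)
  act_P_snd b Y a Z := Prod.ext (by simpa [vact] using Q.act_P_snd _ _ _ _)
    (by simpa [vact] using Q.act_P_snd _ _ _ _)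
  act_P_right b Y a Z := Prod.ext (by simpa [vact] using Q.act_P_right _ _ _ _)
    (by simpa [vact] using Q.act_P_right _ _ _ _)
  act_one a := Prod.ext (Q.act_one _) (Q.act_one _)
  act_act X Y X' Y' a Z' Z := by
    refine Prod.ext ?_ ?_
    · change Q.act (se X) (se Y) (Q.act (se X') (se Y') a.1 (se Z')) (se Z) =
        Q.act (se (X' ≫ X)) (se (Y' ≫ Y)) a.1 (se (Z ≫ Z'))
      rw [Q.act_act, se_comp, se_comp, se_comp]
    · change Q.act (te X) (te Y) (Q.act (te X') (te Y') a.2 (te Z')) (te Z) =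
        Q.act (te (X' ≫ X)) (te (Y' ≫ Y)) a.2 (te (Z ≫ Z'))
      rw [Q.act_act, te_comp, te_comp, te_comp]
  mul_add X Y Z := add_comp Y Z X
  add_mul X Y Z := (scalar_add Z X Y).trans (congrArg _ (vbr_eq X Y _))
  cross_eq X Y := by
    refine Prod.ext ?_ ?_
    · change Q.H (se (X + Y)) - Q.H (se Y) - Q.H (se X) =
        Q.act (se Y) (se X) (Q.H (se (𝟙 (ob c hc 1) + 𝟙 (ob c hc 1) : Vec c hc 1)))
          (se (𝟙 (ob c hc 1) : Vec c hc 1))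
      rw [se_add, se_add, se_id]; exact Q.cross_eq _ _
    · change Q.H (te (X + Y)) - Q.H (te Y) - Q.H (te X) =
        Q.act (te Y) (te X) (Q.H (te (𝟙 (ob c hc 1) + 𝟙 (ob c hc 1) : Vec c hc 1)))
          (te (𝟙 (ob c hc 1) : Vec c hc 1))
      rw [te_add, te_add, te_id]; exact Q.cross_eq _ _
  T_act X Y a Z := Prod.ext (by simpa [vH, vact] using Q.T_act _ _ _ _)
    (by simpa [vH, vact] using Q.T_act _ _ _ _)
  P_act a X := (scalar_vbr X (𝟙 _) (𝟙 _) a).symm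
  P_act_diag X a := by
    change vbr (𝟙 _) (𝟙 _) (vact X X a (𝟙 _)) = vbr (𝟙 _) (𝟙 _) a ≫ X
    rw [← vbr_eq, vbr_comp, Category.id_comp]
  H_mul X Y := by
    refine Prod.ext ?_ ?_
    · change Q.H (se (Y ≫ X)) = _
      rw [se_comp]; exact Q.H_mul _ _
    · change Q.H (te (Y ≫ X)) = _
      rw [te_comp]; exact Q.H_mul _ _

set_option maxHeartbeats 2000000 in
/-- The tracks between elements of a free module form a module over the square ring of tracks. -/
noncomputable instance : RightModule (vecRing c hc) (Vec c hc n) where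
  sm α X := X ≫ α
  br := vbr
  sm_one α := Category.id_comp α
  sm_mul α X Y := Category.assoc Y X α
  sm_add α X Y := add_comp X Y α
  add_sm α β X := scalar_add X α β
  sm_P α a := by
    change vbr (𝟙 _) (𝟙 _) a ≫ α = vbr α α a
    rw [vbr_comp, Category.id_comp]
  br_T α β a := by
    have h : (vecRing c hc).T a = (Q.T a.1, Q.T a.2) :=
      Prod.ext (by simp [SquareGroup.T, vH]) (by simp [SquareGroup.T, vH])
    rw [h, vbr_T]
  br_sm α β X Y a := vbr_scalar X Y α β a
  sm_br α β a X := scalar_vbr X α β a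
  br_br α β a γ b := vbr_vbr α β γ a b
  br_add_left α β γ a := vbr_add_left α β γ a
  br_add_right α β γ a := vbr_add_right α β γ a
  br_add α β a b := vbr_add α β a b
  br_central α β a γ := vbr_central α β γ a

variable {c hc}

end TrackCat

end TrackModules

/-! ### Identity scalars and products of tracks to zero -/

section TrackModules

open BWCoh RightModule FreeMod

variable {Q : SquareRing.{u}} {R : Type u} [Ring R] {p : Q.Hom (SquareRing.ofRing R)}
  {M : Type u} [AddCommGroup M] [Module R M] [Module Rᵐᵒᵖ M] [SMulCommClass R Rᵐᵒᵖ M]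
  (c : Cochain2 (res (matBifunctor R M) (ModSq.toRing p))) (hc : Descends3 (d2 _ c))

namespace TrackCat

variable {k m n : ℕ}

variable {c hc}

theorem sm_eq (α : Vec c hc n) (X : Vec c hc 1) : sm (Q := vecRing c hc) α X = X ≫ α := rfl

theorem br_eq (α β : Vec c hc n) (a : Q.ee × Q.ee) :
    br (Q := vecRing c hc) α β a = vbr α β a := rfl

theorem lift_comp (f : Fin n → Vec c hc m) (g : FreeMod (vecRing c hc) n)
    (γ : ob c hc m ⟶ ob c hc k) : lift f g ≫ γ = lift (fun i => f i ≫ γ) g := by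
  refine RightModule.map_lift (Q := vecRing c hc) (fun α : Vec c hc m => α ≫ γ) ?_ ?_ ?_ ?_ f g
  · exact zero_comp γ
  · exact fun α β => add_comp α β γ
  · intro α X
    rw [sm_eq, sm_eq]; exact Category.assoc X α γ
  · intro α β a
    rw [br_eq, br_eq]; exact vbr_comp α β a γ

/-- The identity track of an element of `Q`. -/
def zs (x : Q.e) : Vec c hc 1 := z fun _ => single x

@[simp] theorem se_zs (x : Q.e) : se (zs x : Vec c hc 1) = x := rfl
@[simp] theorem te_zs (x : Q.e) : te (zs x : Vec c hc 1) = x := rfl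
theorem zs_one : (zs 1 : Vec c hc 1) = 𝟙 _ := z_single_one
theorem zs_zero : (zs 0 : Vec c hc 1) = 0 := z_single_zero
theorem zs_add (x y : Q.e) : (zs (x + y) : Vec c hc 1) = zs x + zs y := by
  rw [zs, zs, zs, ← z_add]
  exact congrArg z (funext fun _ => ext_one rfl)
theorem zs_mul (x y : Q.e) : (zs (x * y) : Vec c hc 1) = zs y ≫ zs x := by
  rw [zs, zs, zs, ← z_comp]
  exact congrArg z (funext fun _ => (lift_single_single x y).symm)
theorem zs_P (a : Q.ee) : (zs (Q.P a) : Vec c hc 1) = vbr (𝟙 _) (𝟙 _) (a, a) := by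
  rw [← zs_one, zs, zs, ← z_br]
  exact congrArg z (funext fun _ => ext_one (by simp [br, bracket, single, Q.act_one]))
theorem z_s_eq (X : Vec c hc 1) : z X.s = zs (se X) :=
  congrArg z (by rw [vec_s]; exact funext fun _ => (single_e _).symm)
theorem z_t_eq (X : Vec c hc 1) : z X.t = zs (te X) :=
  congrArg z (by rw [vec_t]; exact funext fun _ => (single_e _).symm)

theorem vcomp_congr {a b : TrackCat c hc} {α α' β β' : a ⟶ b} (hα : α = α') (hβ : β = β')
    (h : α.t = β.s) : vcomp α β h = vcomp α' β' (by rw [← hα, ← hβ, h]) := by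
  subst hα hβ; rfl

/-- Splitting `X ≫ Y` vertically, the second factor composes the identity of the target of `X` with
`Y`. As that target is zero, the factor is an identity track. -/
theorem comp_eq_comp_zs (X Y : Vec c hc 1) (hX : te X = 0) : X ≫ Y = X ≫ zs (se Y) := by
  have h : z X.t ≫ Y = z (fun _ => 0) := by
    rw [z_t_eq, hX, zs_zero, zero_comp]; rfl
  rw [← z_s_eq]
  exact (comp_eq_vcomp X Y).trans ((vcomp_congr rfl h _).trans (vcomp_z _ (congrArg Hom.s h)))

theorem comp_eq_zs_comp (X Y : Vec c hc 1) (hY : te Y = 0) : X ≫ Y = zs (se X) ≫ Y := by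
  have h : X ≫ z Y.t = z (fun _ => 0) := by
    rw [z_t_eq, hY, zs_zero, comp_zero]; rfl
  rw [← z_s_eq]
  exact (comp_eq_vcomp' X Y).trans ((vcomp_congr rfl h _).trans (vcomp_z _ (congrArg Hom.s h)))

/-- The two products of tracks to zero agree. -/
theorem comp_of_te_eq_zero (X Y : Vec c hc 1) (hX : te X = 0) (hY : te Y = 0) :
    X ≫ zs (se Y) = zs (se X) ≫ Y := by
  rw [← comp_eq_comp_zs X Y hX, comp_eq_zs_comp X Y hY]

end TrackCat

end TrackModules

/-! ### The crossed square ring of tracks to zero -/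

section TrackModules

open BWCoh RightModule FreeMod

variable {Q : SquareRing.{u}} {R : Type u} [Ring R] {p : Q.Hom (SquareRing.ofRing R)}
  {M : Type u} [AddCommGroup M] [Module R M] [Module Rᵐᵒᵖ M] [SMulCommClass R Rᵐᵒᵖ M]
  (c : Cochain2 (res (matBifunctor R M) (ModSq.toRing p))) (hc : Descends3 (d2 _ c))

namespace TrackCat

variable {k m n : ℕ}

variable {c hc}

/-- The target as a homomorphism. -/
noncomputable def teHom : Vec c hc 1 →+ Q.e := AddMonoidHom.mk' te te_add

/-- The source as a homomorphism. -/
noncomputable def seHom : Vec c hc 1 →+ Q.e := AddMonoidHom.mk' se se_add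

/-- The tracks to zero with given source in the image of `P`. -/
noncomputable def vP : Q.ee →+ Vec c hc 1 :=
  AddMonoidHom.mk' (fun a => vbr (𝟙 _) (𝟙 _) (a, 0)) fun a b => by
    rw [← vbr_add, Prod.mk_add_mk, add_zero]

theorem vP_apply (a : Q.ee) : (vP a : Vec c hc 1) = vbr (𝟙 _) (𝟙 _) (a, 0) := rfl

theorem se_vP (a : Q.ee) : se (vP a : Vec c hc 1) = Q.P a := se_vbr_id _

theorem te_vP (a : Q.ee) : te (vP a : Vec c hc 1) = 0 := (te_vbr_id _).trans Q.P.map_zero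

/-- A track to zero requires a parameter pair `(a, 0)`; this lemma applies once the target half of
the parameter, after the scalars have acted, is zero. -/
theorem vbr_eq_vP (X Y : Vec c hc 1) (a : Q.ee × Q.ee)
    (h : Q.act (te X) (te Y) a.2 1 = 0) : vbr X Y a = vP (Q.act (se X) (se Y) a.1 1) := by
  rw [vbr_eq]
  exact congrArg (vbr _ _) (Prod.ext rfl h)

/-- An axiom of the square ring of tracks at the pair `(a, 0)`; `vP_cross` likewise restricts an
axiom to tracks with target zero. -/
theorem vP_H_vP (a : Q.ee) : (vP (Q.H (Q.P a)) : Vec c hc 1) = vP a + vP a := by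
  refine Eq.trans ?_ ((vecRing c hc).P_H_P (a, 0))
  refine congrArg (vbr _ _) (Prod.ext ?_ ?_)
  · exact congrArg Q.H (se_vP a).symm
  · exact Q.H_zero.symm.trans (congrArg Q.H (te_vP a).symm)

theorem vP_cross (X Y : Vec c hc 1) (hX : te X = 0) (hY : te Y = 0) :
    vP (Q.H (se X + se Y) - Q.H (se Y) - Q.H (se X)) = -X - Y + X + Y := by
  refine Eq.trans ?_ ((vecRing c hc).P_cross X Y)
  refine congrArg (vbr _ _) (Prod.ext ?_ ?_)
  · exact congrArg (Q.H · - _ - _) (se_add X Y).symm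
  · change 0 = Q.H (te (X + Y)) - Q.H (te Y) - Q.H (te X)
    rw [te_add, hX, hY, add_zero, Q.H_zero, sub_zero, sub_zero]

variable (c hc) in
/-- The crossed square ring of tracks to zero. -/
@[reducible] noncomputable def crossedRing : CrossedSquareRing Q where
  C1 := (teHom : Vec c hc 1 →+ Q.e).ker
  P := vP.codRestrict _ te_vP
  d := seHom.comp (AddSubgroup.subtype _)
  d_P := se_vP
  P_H_d_P a := Subtype.ext ((congrArg (fun x => vP (Q.H x)) (se_vP a)).trans (vP_H_vP a))
  P_H_add r s := Subtype.ext (by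
    have h := vP_cross r.1 s.1 r.2 s.2
    change vP (Q.H (se r.1 + se s.1)) = vP (Q.H (se r.1)) + vP (Q.H (se s.1)) +
      (-r.1 - s.1 + r.1 + s.1)
    rw [← h, ← _root_.map_add, ← _root_.map_add]
    congr 1; abel)
  l x r := ⟨r.1 ≫ zs x, by
    change te (r.1 ≫ zs x) = 0
    rw [te_comp, show te r.1 = 0 from r.2, Q.mul_zero]⟩
  rr r x := ⟨zs x ≫ r.1, by
    change te (zs x ≫ r.1) = 0
    rw [te_comp, show te r.1 = 0 from r.2, Q.zero_mul]⟩
  one_l r := Subtype.ext (by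
    change r.1 ≫ zs 1 = r.1
    rw [zs_one, Category.comp_id])
  mul_l x y r := Subtype.ext (by
    change r.1 ≫ zs (x * y) = (r.1 ≫ zs y) ≫ zs x
    rw [zs_mul, Category.assoc])
  rr_one r := Subtype.ext (by
    change zs 1 ≫ r.1 = r.1
    rw [zs_one, Category.id_comp])
  rr_mul r x y := Subtype.ext (by
    change zs (x * y) ≫ r.1 = zs y ≫ zs x ≫ r.1
    rw [zs_mul, Category.assoc])
  l_rr x r y := Subtype.ext (Category.assoc _ _ _)
  P_act x a y := Subtype.ext (by
    change vP (Q.act x x a y) = zs y ≫ vP a ≫ zs x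
    rw [vP_apply a, vbr_comp, Category.id_comp, scalar_vbr, vbr_eq_vP]
    · congr 1
      change _ = Q.act x x (Q.act _ _ a y) 1
      rw [se_id, Q.act_act]; simp
    · change Q.act _ _ (Q.act _ _ 0 _) _ = 0
      rw [Q.act_zero_mid, Q.act_zero_mid])
  d_l_rr x r y := by
    change se (zs y ≫ r.1 ≫ zs x) = _
    rw [se_comp, se_comp, se_zs, se_zs]; rfl
  -- The crossed module condition is interchange: a product of two tracks to zero can be computed
  -- with either factor replaced by the identity of its source.
  d_l r s := Subtype.ext (comp_of_te_eq_zero _ _ s.2 r.2)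
  l_add x r s := Subtype.ext (add_comp _ _ _)
  rr_add r x y := Subtype.ext (by
    change zs (x + y) ≫ r.1 = zs x ≫ r.1 + zs y ≫ r.1
    rw [zs_add, add_comp])
  add_l x y r := Subtype.ext (by
    change r.1 ≫ zs (x + y) = r.1 ≫ zs x + r.1 ≫ zs y + vP (Q.act x y (Q.H (se r.1)) 1)
    rw [zs_add, scalar_add, vbr_eq_vP]
    · rfl
    · change Q.act _ _ (Q.H (te r.1)) 1 = 0
      rw [show te r.1 = 0 from r.2, Q.H_zero, Q.act_zero_mid])
  add_rr r s x := Subtype.ext (by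
    change zs x ≫ (r.1 + s.1) = zs x ≫ r.1 + zs x ≫ s.1 + vP (Q.act (se r.1) (se s.1) (Q.H x) 1)
    rw [scalar_add, vbr_eq_vP]
    · rfl
    · rw [show te r.1 = 0 from r.2, Q.act_zero_fst])

end TrackCat

end TrackModules

/-! ### The extension of `R` by `M` attached to a cochain -/

section TrackModules

open BWCoh RightModule FreeMod

variable {Q : SquareRing.{u}} {R : Type u} [Ring R] {p : Q.Hom (SquareRing.ofRing R)}
  {M : Type u} [AddCommGroup M] [Module R M] [Module Rᵐᵒᵖ M] [SMulCommClass R Rᵐᵒᵖ M]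
  (c : Cochain2 (res (matBifunctor R M) (ModSq.toRing p))) (hc : Descends3 (d2 _ c))

namespace TrackCat

variable {k m n : ℕ}

variable {c hc}

/-- The automorphism of an element of `Q` given by an element of `M`. -/
def vloop (x : Q.e) (m : M) : Vec c hc 1 := loop (fun _ => single x) (Matrix.of fun _ _ => m)

theorem te_vloop (x : Q.e) (m : M) : te (vloop x m : Vec c hc 1) = x := rfl

theorem loop_congr {a b : TrackCat c hc} {f g : a.obj ⟶ b.obj} (h : f = g)
    (x y : Coef (matBifunctor R M) ((ModSq.toRing p).obj a.obj) ((ModSq.toRing p).obj b.obj))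
    (h' : x = y) : (loop f x : a ⟶ b) = loop g y := by rw [h, h']

/-- The row with the automorphisms given by two elements of `M`. -/
def vrow (x : Fin 2 → Q.e) (m : Fin 2 → M) : ob c hc 2 ⟶ ob c hc 1 :=
  loop (fun k : Fin 2 => single (x k)) (Matrix.of fun _ k => m k : Matrix (Fin 1) (Fin 2) M)

theorem inc_vrow (x : Fin 2 → Q.e) (m : Fin 2 → M) (i : Fin 2) :
    (inc i : Vec c hc 2) ≫ vrow x m = vloop (x i) (m i) := by
  refine (z_loop _ _ _).trans (loop_congr (gen_comp _ i) _ _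
    (entry_ext (m := 1) (n := 1) fun j k => ?_))
  rw [Subsingleton.elim k 0]
  exact pull_gen (p := p) (m := 1) (Matrix.of fun _ k => m k : Matrix (Fin 1) (Fin 2) M) i j

theorem tup_vloop (x y : Q.e) (m m' : M) :
    tup ![(vloop x m : Vec c hc 1), vloop y m'] = vrow ![x, y] ![m, m'] := by
  refine hom_ext_inc fun i => ?_
  rw [inc_tup, inc_vrow]
  fin_cases i <;> rfl

/-- The sum is precomposition of a row with an identity track; no correction by `c` occurs for
automorphisms, and the pull along the sum of two generators adds the two entries. -/
theorem vloop_add (x y : Q.e) (m m' : M) :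
    (vloop (x + y) (m + m') : Vec c hc 1) = vloop x m + vloop y m' := by
  have h : (vloop x m + vloop y m' : Vec c hc 1) =
      z (fun _ => gen Q 0 + gen Q 1) ≫ tup ![vloop x m, vloop y m'] := rfl
  rw [h, tup_vloop]
  refine Eq.trans ?_ (z_loop _ _ _).symm
  refine loop_congr (funext fun _ => ?_) _ _ (entry_ext (m := 1) (n := 1) fun j k => ?_)
  · refine Eq.trans ?_ (lift_gen_add_gen _ 0 1).symm
    exact ext_one rfl
  · change m + m' = ∑ l : Fin 2, MulOpposite.op (show R from
      p.e ((gen Q (0 : Fin 2) + gen Q 1).e l)) • ![m, m'] l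
    have h1 : ∀ n : M, MulOpposite.op (show R from p.e 1) • n = n := fun n =>
      (congrArg (fun r : R => MulOpposite.op r • n) p.map_one).trans (one_smul Rᵐᵒᵖ n)
    simp only [Fin.sum_univ_two, add_e, gen]
    simp only [if_true, Fin.isValue, zero_ne_one, one_ne_zero, if_false, add_zero, zero_add]
    exact (congrArg₂ (· + ·) (h1 m) (h1 m')).symm

theorem vloop_comp_zs (m : M) (x y : Q.e) : (vloop y m : Vec c hc 1) ≫ zs x =
    vloop (x * y) ((show R from p.e x) • m) := by
  refine (loop_z _ _ _).trans (loop_congr (funext fun _ => lift_single_single x y) _ _ ?_)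
  refine entry_ext (m := 1) (n := 1) fun j k => ?_
  rw [Subsingleton.elim j 0, Subsingleton.elim k 0]
  exact (Fin.sum_univ_one (fun _ : Fin 1 => (show R from p.e x) • m))

theorem zs_comp_vloop (m : M) (x y : Q.e) : (zs x : Vec c hc 1) ≫ vloop y m =
    vloop (y * x) (MulOpposite.op (show R from p.e x) • m) := by
  refine (z_loop _ _ _).trans (loop_congr (funext fun _ => lift_single_single y x) _ _ ?_)
  refine entry_ext (m := 1) (n := 1) fun j k => ?_
  rw [Subsingleton.elim j 0, Subsingleton.elim k 0]
  exact Fin.sum_univ_one (fun _ : Fin 1 => MulOpposite.op (show R from p.e x) • m)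

theorem eq_vloop {x : Q.e} (X : Vec c hc 1) (hs : se X = x) (ht : te X = x) :
    ∃ m, vloop x m = X := by
  refine ⟨entry 1 1 X.x 0 0, hom_ext ?_ ?_ (entry_ext (m := 1) (n := 1) fun i j => ?_)⟩
  · rw [vec_s X]; exact funext fun _ => (ext_one hs).symm
  · rw [vec_t X]; exact funext fun _ => (ext_one ht).symm
  · rw [Subsingleton.elim i 0, Subsingleton.elim j 0]; rfl

theorem exists_scalar {x y : Q.e} (h : p.e x = p.e y) :
    ∃ X : Vec c hc 1, se X = x ∧ te X = y :=
  ⟨(⟨fun _ => single x, fun _ => single y,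
    (ModSq.toRing_map_eq_iff p _ _).2 fun _ _ => h, 0⟩ : Hom (ob c hc 1) (ob c hc 1)), rfl, rfl⟩

theorem map_se (X : Vec c hc 1) : p.e (se X) = p.e (te X) :=
  (ModSq.toRing_map_eq_iff p _ _).1 X.h 0 0

variable (c hc) in
/-- The crossed square ring extension given by a cochain. -/
@[reducible] noncomputable def crossedExt : CrossedExt p M where
  toCrossedSquareRing := crossedRing c hc
  ι := AddMonoidHom.mk'
    (fun m => ⟨vloop 0 m, (te_vloop 0 m : te (vloop 0 m : Vec c hc 1) = 0)⟩)
    fun m m' => Subtype.ext (by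
    change vloop 0 (m + m') = vloop 0 m + vloop 0 m'
    rw [← vloop_add, add_zero])
  ι_injective m m' h := by
    have h1 : (vloop 0 m : Vec c hc 1) = vloop 0 m' := congrArg Subtype.val h
    exact congrArg (fun X : Vec c hc 1 => entry 1 1 X.x 0 0) h1
  -- Exactness at `C1`: a track from zero to zero is an automorphism, and its coordinate is an
  -- element of `M`.
  range_ι r := by
    constructor
    · intro h
      obtain ⟨m, hm⟩ := eq_vloop r.1 h r.2
      exact ⟨m, Subtype.ext hm⟩
    · rintro ⟨m, rfl⟩; rfl
  -- Exactness at `Q`: a track from `x` to zero exists precisely when `x` and zero have the same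
  -- image in `R`.
  range_d x := by
    constructor
    · intro h
      obtain ⟨X, h1, h2⟩ := exists_scalar (c := c) (hc := hc) (x := x) (y := 0)
        (h.trans p.map_zero.symm)
      exact ⟨⟨X, h2⟩, h1⟩
    · rintro ⟨r, rfl⟩
      refine (map_se r.1).trans ?_
      rw [show te r.1 = 0 from r.2]
      exact p.map_zero
  ι_smul x m := Subtype.ext (by
    change vloop 0 _ = vloop 0 m ≫ zs x
    rw [vloop_comp_zs, Q.mul_zero])
  ι_op_smul m x := Subtype.ext (by
    change vloop 0 _ = zs x ≫ vloop 0 m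
    rw [zs_comp_vloop, Q.zero_mul])

end TrackCat

end TrackModules

/-! ### Comparison of the two square rings of tracks -/

section TrackModules

open BWCoh RightModule FreeMod

variable {Q : SquareRing.{u}} {R : Type u} [Ring R] {p : Q.Hom (SquareRing.ofRing R)}
  {M : Type u} [AddCommGroup M] [Module R M] [Module Rᵐᵒᵖ M] [SMulCommClass R Rᵐᵒᵖ M]
  (c : Cochain2 (res (matBifunctor R M) (ModSq.toRing p))) (hc : Descends3 (d2 _ c))

namespace TrackCat

variable {k m n : ℕ}

variable {c hc}

open CrossedSquareRing

/-- A track between elements of `Q`, as a track to zero plus an identity track. -/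
noncomputable def trackVal (X : Tr (crossedExt c hc).toCrossedSquareRing) : Vec c hc 1 :=
  X.r.1 + zs X.x

theorem te_coe (r : (crossedExt c hc).C1) : te r.1 = 0 := r.2

theorem se_trackVal (X : Tr (crossedExt c hc).toCrossedSquareRing) : se (trackVal X) = X.src := by
  rw [trackVal, se_add]; rfl

theorem te_trackVal (X : Tr (crossedExt c hc).toCrossedSquareRing) : te (trackVal X) = X.x := by
  rw [trackVal, te_add, te_coe, zero_add]; rfl

theorem vP_central (a : Q.ee) (X : Vec c hc 1) : vP a + X = X + vP a := vbr_central _ _ _ _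

/-- The correction term in the sum of pairs is the commutator needed to move the identity track of
`X.x` past `Y.r`. -/
theorem trackVal_add (X Y : Tr (crossedExt c hc).toCrossedSquareRing) :
    trackVal (X + Y) = trackVal X + trackVal Y := by
  change X.r.1 + Y.r.1 + vP (Q.act (se Y.r.1) X.x (Q.H (1 + 1)) 1) + zs (X.x + Y.x) =
    X.r.1 + zs X.x + (Y.r.1 + zs Y.x)
  have h : zs X.x + Y.r.1 = Y.r.1 + zs X.x + vP (Q.act (se Y.r.1) X.x (Q.H (1 + 1)) 1) := by
    rw [vec_swap, vbr_eq_vP, se_zs]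
    rw [te_coe, Q.act_zero_fst]
  rw [add_assoc X.r.1 (zs X.x), ← add_assoc (zs X.x), h, zs_add]
  simp only [add_assoc]
  rw [← add_assoc (vP _) (zs X.x), vP_central, add_assoc]

/-- Expand by `scalar_add`. As `X.r` has target zero, only the source of `Y` matters in its product
with `Y`, and the bracket reduces to the `P`-term in the product of pairs. -/
theorem trackVal_mul (X Y : Tr (crossedExt c hc).toCrossedSquareRing) :
    trackVal (X * Y) = trackVal Y ≫ trackVal X := by
  have h1 : trackVal Y ≫ X.r.1 = zs Y.src ≫ X.r.1 := by
    rw [comp_eq_zs_comp _ _ (te_coe X.r), se_trackVal]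
  have h2 : trackVal Y ≫ zs X.x = Y.r.1 ≫ zs X.x + zs (X.x * Y.x) := by
    rw [zs_mul, ← add_comp]; rfl
  have h3 : vbr X.r.1 (zs X.x) (vH (trackVal Y)) = vP (Q.act (se X.r.1) X.x (Q.H Y.src) 1) := by
    rw [vbr_eq_vP, ← se_trackVal Y]
    · rfl
    · rw [te_coe, Q.act_zero_fst]
  have h4 := scalar_add (trackVal Y) X.r.1 (zs X.x)
  rw [h1, h2, h3] at h4
  refine Eq.trans ?_ h4.symm
  change zs Y.src ≫ X.r.1 + Y.r.1 ≫ zs X.x + vP (Q.act (se X.r.1) X.x (Q.H Y.src) 1) +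
    zs (X.x * Y.x) = _
  rw [add_assoc (_ + _), vP_central, ← add_assoc, ← add_assoc]

variable (c hc) in
/-- The morphism from the square ring of tracks of the extension to the square ring of tracks. -/
noncomputable def trackValHom : (crossedExt c hc).trackRing.Hom (vecRing c hc) where
  e := trackVal
  ee := AddMonoidHom.id _
  map_add := trackVal_add
  map_one := by
    change 0 + zs 1 = 𝟙 _
    rw [zero_add, zs_one]
  map_mul := trackVal_mul
  map_P a := by
    change vbr (𝟙 _) (𝟙 _) (a.1 - a.2, 0) + zs (Q.P a.2) = vbr (𝟙 _) (𝟙 _) a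
    rw [zs_P, ← vbr_add]
    congr 1
    exact Prod.ext (sub_add_cancel _ _) (zero_add _)
  map_H X :=
     Prod.ext (congrArg Q.H (se_trackVal X).symm) (congrArg Q.H (te_trackVal X).symm)
  map_act X Y a Z := by
    refine Prod.ext ?_ ?_
    · change _ = Q.act (se (trackVal X)) (se (trackVal Y)) a.1 (se (trackVal Z))
      exact congr (congrArg₂ (Q.act · · a.1) (se_trackVal X).symm (se_trackVal Y).symm)
        (se_trackVal Z).symm
    · change _ = Q.act (te (trackVal X)) (te (trackVal Y)) a.2 (te (trackVal Z))
      exact congr (congrArg₂ (Q.act · · a.2) (te_trackVal X).symm (te_trackVal Y).symm)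
        (te_trackVal Z).symm

theorem tup_vcomp (α β : Fin n → Vec c hc m) (h : ∀ i, (α i).t = (β i).s)
    (h' : (tup α).t = (tup β).s) :
    tup (fun i => vcomp (α i) (β i) (h i)) = vcomp (tup α) (tup β) h' := by
  refine hom_ext_inc fun i => ?_
  rw [inc_tup, inc, comp_vcomp_z]
  exact vcomp_congr (inc_tup α i).symm (inc_tup β i).symm _

/-- Addition is composition with an identity track after pairing, so it satisfies interchange with
vertical composition. -/
theorem add_vcomp (α β α' β' : Vec c hc n) (h : α.t = β.s) (h' : α'.t = β'.s)
    (h'' : (α + α').t = (β + β').s) :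
    vcomp (α + α') (β + β') h'' = vcomp α β h + vcomp α' β' h' := by
  have hi : ∀ i, (![α, α'] i).t = (![β, β'] i).s := fun i => by fin_cases i; exacts [h, h']
  have ht : (tup ![α, α']).t = (tup ![β, β']).s := by
    rw [tup_s, tup_t]
    exact funext fun i => congrFun (hi i) 0
  have h1 : tup ![vcomp α β h, vcomp α' β' h'] = vcomp (tup ![α, α']) (tup ![β, β']) ht := by
    rw [← tup_vcomp _ _ hi]
    congr 1
    funext i; fin_cases i <;> rfl
  change vcomp (z _ ≫ tup ![α, α']) (z _ ≫ tup ![β, β']) h'' = z _ ≫ tup ![_, _]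
  rw [h1, comp_vcomp_z]

theorem vec_t_eq_s {α β : Vec c hc n} (h : tv α = sv β) : α.t = β.s := by
  rw [vec_t, vec_s, h]

theorem t_eq_s {X Y : Vec c hc 1} (h : te X = se Y) : X.t = Y.s := vec_t_eq_s (ext_one h)

/-- Interchange applied to `X.r` followed by zero and the identity of `X.x` followed by the track of
`Y`. -/
theorem trackVal_comp (X Y : Tr (crossedExt c hc).toCrossedSquareRing) (h : X.x = Y.src) :
    trackVal (Tr.comp X Y) = vcomp (trackVal X) (trackVal Y)
      (t_eq_s (by rw [te_trackVal, se_trackVal, h])) := by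
  change X.r.1 + Y.r.1 + zs Y.x = _
  have h0 : te X.r.1 = se (0 : Vec c hc 1) := te_coe X.r
  have h1 : te (zs X.x : Vec c hc 1) = se (trackVal Y) := by rw [se_trackVal, te_zs, h]
  have h2 : vcomp X.r.1 0 (t_eq_s h0) = X.r.1 := vcomp_z X.r.1 (t_eq_s h0)
  have h3 : vcomp (zs X.x) (trackVal Y) (t_eq_s h1) = trackVal Y := z_vcomp _ (t_eq_s h1)
  have h4 : te (X.r.1 + zs X.x) = se (0 + trackVal Y) := by
    rw [te_add, te_coe, zero_add, zero_add, h1]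
  have h5 := add_vcomp X.r.1 0 (zs X.x) (trackVal Y) (t_eq_s h0) (t_eq_s h1) (t_eq_s h4)
  rw [h2, h3] at h5
  rw [add_assoc]
  refine h5.symm.trans (vcomp_congr rfl (zero_add _) _)

end TrackCat

end TrackModules

/-! ### Comparison of the track categories and the resulting coordinates -/

section TrackModules

open BWCoh RightModule FreeMod

variable {Q : SquareRing.{u}} {R : Type u} [Ring R] {p : Q.Hom (SquareRing.ofRing R)}
  {M : Type u} [AddCommGroup M] [Module R M] [Module Rᵐᵒᵖ M] [SMulCommClass R Rᵐᵒᵖ M]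
  (c : Cochain2 (res (matBifunctor R M) (ModSq.toRing p))) (hc : Descends3 (d2 _ c))

namespace TrackCat

variable {k m n : ℕ}

variable {c hc}

open CrossedSquareRing

theorem map_lift_of_hom {A B : SquareRing.{u}} (ψ : A.Hom B) {V W : Type u} [AddGroup V]
    [AddGroup W] [RightModule A V] [RightModule B W] (φ : V → W) (h0 : φ 0 = 0)
    (ha : ∀ x y, φ (x + y) = φ x + φ y) (hs : ∀ (v : V) (x : A.e), φ (sm v x) = sm (φ v) (ψ.e x))
    (hb : ∀ (v v' : V) (a : A.ee), φ (br v v' a) = br (φ v) (φ v') (ψ.ee a)) (f : Fin n → V)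
    (g : FreeMod A n) : φ (lift f g) = lift (fun k => φ (f k)) (g.map ψ) := by
  unfold lift
  rw [ha, map_osum φ h0 ha, map_psum φ h0 ha]
  simp only [hs, hb, FreeMod.map]

variable (c hc) in
/-- The source as a morphism of square rings. -/
noncomputable def vecSrc : (vecRing c hc).Hom Q where
  e := se
  ee := AddMonoidHom.fst _ _
  map_add := se_add
  map_one := rfl
  map_mul := fun X Y => se_comp X Y
  map_P := se_vbr_id
  map_H _ := rfl
  map_act _ _ _ _ := rfl

variable (c hc) in
/-- The target as a morphism of square rings. -/
noncomputable def vecTgt : (vecRing c hc).Hom Q where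
  e := te
  ee := AddMonoidHom.snd _ _
  map_add := te_add
  map_one := rfl
  map_mul := fun X Y => te_comp X Y
  map_P := te_vbr_id
  map_H _ := rfl
  map_act _ _ _ _ := rfl

theorem sv_lift (f : Fin n → Vec c hc m) (g : FreeMod (vecRing c hc) n) :
    sv (lift f g) = lift (fun k => sv (f k)) (g.map (vecSrc c hc)) := by
  refine map_lift_of_hom (vecSrc c hc) (sv : Vec c hc m → FreeMod Q m) ?_ ?_ ?_ ?_ f g
  · exact sv_zero
  · exact sv_add
  · exact fun α X => sv_comp X α
  · exact fun α β a => sv_vbr α β a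

theorem tv_lift (f : Fin n → Vec c hc m) (g : FreeMod (vecRing c hc) n) :
    tv (lift f g) = lift (fun k => tv (f k)) (g.map (vecTgt c hc)) := by
  refine map_lift_of_hom (vecTgt c hc) (tv : Vec c hc m → FreeMod Q m) ?_ ?_ ?_ ?_ f g
  · exact tv_zero
  · exact tv_add
  · exact fun α X => tv_comp X α
  · exact fun α β a => tv_vbr α β a

theorem lift_proj_eq (i : Fin n) (v : FreeMod (vecRing c hc) n) :
    lift (fun j => if j = i then 𝟙 (ob c hc 1) else (0 : Vec c hc 1)) v = v.e i := by
  have h : (lift (proj (vecRing c hc) i) v).e 0 =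
      lift (fun j => ((proj (vecRing c hc) i j).e 0 : Vec c hc 1)) v := by
    refine RightModule.map_lift (Q := vecRing c hc)
      (fun w : FreeMod (vecRing c hc) 1 => (w.e 0 : Vec c hc 1)) ?_ ?_ ?_ ?_ _ v
    · rfl
    · exact fun _ _ => rfl
    · exact fun _ _ => rfl
    · exact fun w w' a => (vbr_eq _ _ _).symm
  rw [lift_proj] at h
  exact h.symm

/-- The track to a free module given by a track of the extension. -/
noncomputable def vecVal (v : FreeMod (crossedExt c hc).trackRing n) : Vec c hc n :=
  lift (Q := vecRing c hc) inc (v.map (trackValHom c hc))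

/-- After projection, the generators become identity or zero, and the linear combination collapses
to its `i`-th coefficient. -/
theorem vecVal_prj (v : FreeMod (crossedExt c hc).trackRing n) (i : Fin n) :
    vecVal v ≫ prj i = trackVal (v.e i) := by
  rw [vecVal, lift_comp]
  simp only [inc_prj]
  exact lift_proj_eq i _

theorem sv_vecVal (v : FreeMod (crossedExt c hc).trackRing n) :
    sv (vecVal v) = v.map (crossedExt c hc).srcHom := by
  refine (sv_lift _ _).trans ((gen_lift _).trans ?_)
  exact FreeMod.ext' (fun i => se_trackVal _) (fun _ _ _ => rfl)

theorem tv_vecVal (v : FreeMod (crossedExt c hc).trackRing n) :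
    tv (vecVal v) = v.map (crossedExt c hc).tgtHom := by
  refine (tv_lift _ _).trans ((gen_lift _).trans ?_)
  exact FreeMod.ext' (fun i => te_trackVal _) (fun _ _ _ => rfl)

/-- The track in the category of tracks given by a track of the extension. -/
noncomputable def val {a b : ModSq Q} (α : (crossedExt c hc).tracks.Tr a b) :
    (⟨a⟩ : TrackCat c hc) ⟶ ⟨b⟩ :=
  tup (n := a.rank) (m := b.rank) fun k => vecVal (α k)

theorem val_s {a b : ModSq Q} (α : (crossedExt c hc).tracks.Tr a b) :
    (val α).s = (crossedExt c hc).tracks.src α :=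
  (tup_s _).trans (funext fun _ => sv_vecVal _)

theorem val_t {a b : ModSq Q} (α : (crossedExt c hc).tracks.Tr a b) :
    (val α).t = (crossedExt c hc).tracks.tgt α :=
  (tup_t _).trans (funext fun _ => tv_vecVal _)

/-- Both composites are substitutions of linear combinations. The ring morphism `trackValHom`
carries one substitution to the other, and `lift_lift` evaluates it on generators. -/
theorem val_hcomp {a b d : ModSq Q} (α : (crossedExt c hc).tracks.Tr a b)
    (β : (crossedExt c hc).tracks.Tr b d) :
    val ((crossedExt c hc).tracks.hcomp α β) = val α ≫ val β := by
  refine Eq.trans ?_ (tup_comp (n := a.rank) (m := b.rank) (k := d.rank) _ _).symm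
  refine congrArg (tup (n := a.rank) (m := d.rank)) (funext fun k => ?_)
  have h1 : vecVal (α k) ≫ val β = lift (Q := vecRing c hc) (fun i => vecVal (β i))
      ((α k).map (trackValHom c hc)) := by
    refine (lift_comp (c := c) (hc := hc) _ _ _).trans ?_
    congr 1
    exact funext fun i => inc_tup (n := b.rank) (m := d.rank) _ i
  rw [h1]
  refine Eq.trans ?_ (lift_lift (Q := vecRing c hc) inc
    (fun i => (β i).map (trackValHom c hc)) ((α k).map (trackValHom c hc)))
  exact congrArg (lift (Q := vecRing c hc) inc) (FreeMod.map_lift (trackValHom c hc) β (α k))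

theorem sv_vcomp (V W : Vec c hc n) (h : V.t = W.s) : sv (vcomp V W h) = sv V := rfl

theorem tv_vcomp (V W : Vec c hc n) (h : V.t = W.s) : tv (vcomp V W h) = tv W := rfl

theorem vcomp_prj (V W : Vec c hc n) (h : V.t = W.s) (i : Fin n)
    (X Y : Tr (crossedExt c hc).toCrossedSquareRing)
    (hV : V ≫ prj i = trackVal X) (hW : W ≫ prj i = trackVal Y) (hXY : X.x = Y.src) :
    vcomp V W h ≫ prj i = trackVal (Tr.comp X Y) := by
  rw [prj, vcomp_comp_z, trackVal_comp X Y hXY]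
  exact vcomp_congr hV hW _

/-- Vertical composition is compared through source, target and projections, which reduces it to
`trackVal_comp` on entries. -/
theorem vecVal_comp (u v w : FreeMod (crossedExt c hc).trackRing n)
    (hs : u.map (crossedExt c hc).srcHom = v.map (crossedExt c hc).srcHom)
    (ht : u.map (crossedExt c hc).tgtHom = w.map (crossedExt c hc).tgtHom)
    (h : ∀ i, Tr.x (E := (crossedExt c hc).toCrossedSquareRing) (v.e i) =
      Tr.src (E := (crossedExt c hc).toCrossedSquareRing) (w.e i))
    (hu : ∀ i, u.e i = Tr.comp (E := (crossedExt c hc).toCrossedSquareRing) (v.e i) (w.e i))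
    (h' : (vecVal v).t = (vecVal w).s) : vecVal u = vcomp (vecVal v) (vecVal w) h' := by
  refine vec_ext ?_ ?_ fun i => ?_
  · rw [sv_vcomp, sv_vecVal, sv_vecVal, hs]
  · rw [tv_vcomp, tv_vecVal, tv_vecVal, ht]
  · refine Eq.trans ?_ (vcomp_prj _ _ h' i _ _ (vecVal_prj v i) (vecVal_prj w i) (h i)).symm
    exact (vecVal_prj u i).trans (congrArg trackVal (hu i))

theorem val_vcomp {a b : ModSq Q} (α β : (crossedExt c hc).tracks.Tr a b)
    (h : (crossedExt c hc).tracks.tgt α = (crossedExt c hc).tracks.src β) :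
    val ((crossedExt c hc).tracks.vcomp α β h) =
      vcomp (val α) (val β) (by rw [val_t, val_s, h]) := by
  have h1 : ∀ k, (vecVal (α k)).t = (vecVal (β k)).s := fun k =>
    vec_t_eq_s ((tv_vecVal _).trans ((congrFun h k).trans (sv_vecVal _).symm))
  refine Eq.trans ?_ (tup_vcomp (n := a.rank) (m := b.rank) (fun k => vecVal (α k))
    (fun k => vecVal (β k)) h1 _)
  exact congrArg (tup (n := a.rank) (m := b.rank))
    (funext fun k => vecVal_comp _ (α k) (β k)
      (congrFun ((crossedExt c hc).tracks.src_vcomp α β h) k)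
      (congrFun ((crossedExt c hc).tracks.tgt_vcomp α β h) k)
      (fun i => congrArg (fun u => FreeMod.e u i) (congrFun h k)) (fun _ => rfl) (h1 k))

theorem trackVal_loop (x : Q.e) (m : M) :
    trackVal (⟨(crossedExt c hc).ι m, x⟩ : Tr (crossedExt c hc).toCrossedSquareRing) =
      vloop x m := by
  change vloop 0 m + vloop x 0 = vloop x m
  rw [← vloop_add, zero_add, add_zero]

theorem loop_prj (f : FreeMod Q n) (x : Fin n → M) (i : Fin n) :
    (loop (fun _ => f) (Matrix.of fun i _ => x i : Matrix (Fin n) (Fin 1) M) : Vec c hc n) ≫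
      prj i = vloop (f.e i) (x i) := by
  refine (loop_z _ _ _).trans (loop_congr (comp_proj _ i) _ _
    (entry_ext (m := 1) (n := 1) fun j k => ?_))
  rw [Subsingleton.elim j 0]
  exact push_proj (p := p) (m := 1) (Matrix.of fun i _ => x i : Matrix (Fin n) (Fin 1) M) i k

theorem inc_loop (f : Fin m → FreeMod Q n) (x : Matrix (Fin n) (Fin m) M) (k : Fin m) :
    inc k ≫ (loop f x : ob c hc m ⟶ ob c hc n) =
      loop (fun _ => f k) (Matrix.of fun i _ => x i k : Matrix (Fin n) (Fin 1) M) := by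
  refine (z_loop _ _ _).trans (loop_congr (gen_comp _ k) _ _
    (entry_ext (m := 1) (n := n) fun i j => ?_))
  rw [Subsingleton.elim j 0]
  exact pull_gen (p := p) x k i

theorem val_τ {a b : ModSq Q} (f : a ⟶ b)
    (x : Coef (matBifunctor R M) ((ModSq.toRing p).obj a) ((ModSq.toRing p).obj b)) :
    val ((crossedExt c hc).tracks.τ f x) = loop f x := by
  refine hom_ext_inc (n := a.rank) (m := b.rank) fun k => ?_
  refine (inc_tup (n := a.rank) (m := b.rank) _ k).trans
    (Eq.trans ?_ (inc_loop (m := a.rank) (n := b.rank) f x k).symm)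
  refine vec_ext ?_ ?_ fun i => ?_
  · exact (sv_vecVal _).trans ((crossedExt c hc).loop_src _ _)
  · exact tv_vecVal _
  · rw [vecVal_prj]
    exact (trackVal_loop _ _).trans (loop_prj (n := b.rank) (f k)
      (fun i => (show Matrix (Fin b.rank) (Fin a.rank) M from x) i k) i).symm

variable (c hc) in
/-- The tracks of the extension given by a cochain have coordinates for this cochain. -/
theorem isCoord_crossedExt :
    (crossedExt c hc).tracks.IsCoord c fun _ _ α => (val α).x where
  vcomp α β h := congrArg Hom.x (val_vcomp α β h)
  τ f x := congrArg Hom.x (val_τ f x)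
  hcomp α β := by
    -- Composition in `TrackCat` was defined by the coordinate formula, so functoriality of `val`
    -- finishes the proof.
    rw [val_hcomp, comp_x, val_s, val_s, val_t, val_t]

end TrackCat

end TrackModules

/-! ### Classification of extensions by relative Mac Lane cohomology -/

section Classification

open BWCoh

variable {Q : SquareRing.{u}} {R : Type u} [Ring R] {p : Q.Hom (SquareRing.ofRing R)}
  {M : Type u} [AddCommGroup M] [Module R M] [Module Rᵐᵒᵖ M] [SMulCommClass R Rᵐᵒᵖ M]

namespace CrossedExt

theorem represents_relClass_iff (hp : Function.Surjective p.e) (E : CrossedExt p M)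
    {c : Cochain2 (res (matBifunctor R M) (ModSq.toRing p))}
    (hc : d2 _ c ∈ (res3 (matBifunctor R M) (ModSq.toRing p)).range) :
    E.tracks.Represents (relClass c hc) ↔ ∃ κ, E.tracks.IsCoord c κ :=
  TrackExt.represents_iff (ModSq.toRing_map_surjective hp) (ModSq.descends2_iff hp) hc

theorem existsUnique_represents (hp : Function.Surjective p.e) (E : CrossedExt p M) :
    ∃! x : HML3 p M, E.tracks.Represents x :=
  TrackExt.existsUnique_represents (ModSq.toRing_map_surjective hp) (ModSq.descends2_iff hp)
    (fun c => (ModSq.descends3_iff hp c).1) E.tracks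

/-- A morphism of extensions preserves the class. -/
theorem represents_of_hom (hp : Function.Surjective p.e) {E E' : CrossedExt p M} (f : E ⟶ E')
    {x : HML3 p M} (h : E'.tracks.Represents x) : E.tracks.Represents x := by
  obtain ⟨c, hc, rfl⟩ := exists_relClass x
  exact (represents_relClass_iff hp E hc).2
    (Hom.exists_coord f ((represents_relClass_iff hp E' hc).1 h))

/-- Coordinates are transported only against the direction of a morphism; inverting the morphism
gives the other implication for each link of the zigzag. -/
theorem represents_iff_of_zigzag (hp : Function.Surjective p.e) {E E' : CrossedExt p M}
    (h : Zigzag E E') (x : HML3 p M) : E.tracks.Represents x ↔ E'.tracks.Represents x := by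
  induction h with
  | refl => rfl
  | tail _ h ih =>
    refine ih.trans ?_
    rcases h with ⟨⟨f⟩⟩ | ⟨⟨f⟩⟩
    · have := isIso f
      exact ⟨represents_of_hom hp (inv f), represents_of_hom hp f⟩
    · have := isIso f
      exact ⟨represents_of_hom hp f, represents_of_hom hp (inv f)⟩

/-- Extensions with the same class are isomorphic. -/
theorem exists_hom_of_represents (hp : Function.Surjective p.e) {E E' : CrossedExt p M}
    {x : HML3 p M} (h : E.tracks.Represents x) (h' : E'.tracks.Represents x) :
    Nonempty (E ⟶ E') := by
  obtain ⟨c, hc, rfl⟩ := exists_relClass x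
  exact exists_hom_of_coord ((represents_relClass_iff hp E hc).1 h)
    ((represents_relClass_iff hp E' hc).1 h')

/-- Every class is the class of an extension. -/
theorem exists_represents (hp : Function.Surjective p.e) (x : HML3 p M) :
    ∃ E : CrossedExt p M, E.tracks.Represents x := by
  obtain ⟨c, hc, rfl⟩ := exists_relClass x
  exact ⟨TrackCat.crossedExt c ((ModSq.descends3_iff hp _).2 hc),
    (represents_relClass_iff hp _ hc).2 ⟨_, TrackCat.isCoord_crossedExt c _⟩⟩

end CrossedExt

end Classification

theorem theorem4p1 (Q : SquareRing.{u}) (R : Type u) [Ring R] (M : Type u) [AddCommGroup M]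
    [Module R M] [Module Rᵐᵒᵖ M] [SMulCommClass R Rᵐᵒᵖ M]
    (p : Q.Hom (SquareRing.ofRing R)) (hp : Function.Surjective p.e) :
    (∀ (E E' : CrossedExt p M) (f : E ⟶ E'), IsIso f) ∧
    ∃ Φ : ConnectedComponents (CrossedExt p M) ≃ HML3 p M,
      ∀ (E : CrossedExt p M) (x : HML3 p M),
        Φ (Quotient.mk (Zigzag.setoid (CrossedExt p M)) E) = x ↔ E.tracks.Represents x := by
  refine ⟨fun E E' f => CrossedExt.isIso f, ?_⟩
  -- Existence and uniqueness of the represented class turn representation into a function on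
  -- extensions, constant on components.
  choose cl hcl huniq using CrossedExt.existsUnique_represents (M := M) hp
  have hcl_iff : ∀ (E : CrossedExt p M) (x : HML3 p M), cl E = x ↔ E.tracks.Represents x :=
    fun E x => ⟨fun h => h ▸ hcl E, fun h => (huniq E x h).symm⟩
  let Φ : ConnectedComponents (CrossedExt p M) → HML3 p M := Quotient.lift cl fun E E' h =>
    (hcl_iff E _).2 ((CrossedExt.represents_iff_of_zigzag hp h _).2 (hcl E'))
  have hΦ : Function.Bijective Φ := by
    constructor
    · rintro ⟨E⟩ ⟨E'⟩ h
      obtain ⟨f⟩ := CrossedExt.exists_hom_of_represents hp (hcl E) ((hcl_iff E' _).1 h.symm)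
      exact Quotient.sound (Zigzag.of_hom f)
    · intro x
      obtain ⟨E, hE⟩ := CrossedExt.exists_represents hp x
      exact ⟨Quotient.mk _ E, (hcl_iff E x).2 hE⟩
  exact ⟨Equiv.ofBijective Φ hΦ, fun E x => hcl_iff E x⟩
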